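/- **Notation.** Let $0<|q|<1$, $0<|p|<1$, and $(x;q)=\prod_{k\ge0}(1-xq^k)$, $\theta(x;p)=(x;p)(p/x;p)$, $\theta(x;q;p)_m=\prod_{k=0}^{m-1}\theta(xq^k;p)$, $\Gamma(x;p,q)=\prod_{i,j\ge0}\frac{1-p^{i+1}q^{j+1}/x}{1-p^iq^jx}$. Several arguments, and $\pm$ in exponents, denote products. A function $f$ meromorphic on $\mathbb C^*$ belongs to $A(u;p,q)$ with pole order $m$ if $f(z)=f(1/z)=f(pz)$ and $\theta(pqz^{\pm1}/u;q;p)_m f(z)$ is holomorphic on $\mathbb C^*$. For $t_0\cdots t_5=pq$, $f\in A(t_4;p,q)$, $g\in A(t_5;p,q)$ of pole orders $m_f,m_g$, put $\tilde t_r=t_r$ $(r\le3)$, $\tilde t_4=t_4q^{-m_f}$, $\tilde t_5=t_5q^{-m_g}$ and $$\langle f,g\rangle_{t}=\frac{(q;q)(p;p)}{2\prod_{0\le r<s\le5}\Gamma(t_rt_s;p,q)}\int_C f(z)g(z)\frac{\prod_{r=0}^5\Gamma(t_rz^{\pm1};p,q)}{\Gamma(z^{\pm2};p,q)}\frac{dz}{2\pi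 iz},$$ where $C$ is a chain of closed curves in $\mathbb C^*$ with winding number $1$ around all points $p^iq^j\tilde t_r$ and $0$ around their reciprocals ($i,j\ge0$, $0\le r\le5$). Such a $C$ can exist only if no point $p^iq^j\tilde t_r$ is the reciprocal of another such point or of itself; call $p$ *nonresonant* if this is so. Powers of $p$ are taken as $p^a=e^{a\log p}$ with any choice of $\log p$; functions of $p$ may depend on that choice, and $p\to0$ means $\mathrm{Re}\log p\to-\infty$. A family $h(z)=h(z;p)$ *has an expansion* if $h=\sum_s a_s(z)p^s$ with $a_s\in\mathbb C(z)$, only finitely many $a_s\ne0$ with $s\le N$ for each $N$, where outside the zero set of some nonzero polynomial the $a_s$ have no poles on $\mathbb C^*$ and $p^{-val(h)}h$ is the locally uniform sum of the series for small $p$ (on each compact set of such $z\in\mathbb C^*$, uniformly for $0<|p|\le\varepsilon$, for some $\varepsilon>0$ depending on the compact set). Here $val(h)=\min\{s:a_s\ne0\}$ and $lc(h)=a_{val(h)}$ (for $h=0$ put $val=0$, $lc=0$). **Proposition.** Let $0<|q|<1$, let $t_0,\dots,t_5\in\mathbb C$ satisfy $\prod_rt_r=q$ and be generic: $t_rt_s\notin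 q^{\mathbb Z}$ for all $0\le r,s\le5$. Let $-\tfrac12\le\zeta<0$, let $a\ne b$ be in $\{0,\dots,5\}$, and let $\alpha\in\mathbb R^6$ satisfy $\sum_r\alpha_r=1$, $\alpha_a=\alpha_b=\zeta$ and $-\zeta\le\alpha_r\le1+\zeta$ for $r\ne a,b$. Let $f=f(z;p)$, $g=g(z;p)$ be families such that, for all small $p$, $f\in A(t_4p^{\alpha_4};p,q)$ and $g\in A(t_5p^{\alpha_5};p,q)$ with pole orders $m_f,m_g$ independent of $p$, and such that $f(p^\zeta z;p)$ and $g(p^\zeta z;p)$ have expansions; write $val(f),lc(f)$ and $val(g),lc(g)$ for the valuations and leading coefficients of these. Then: 1. There are nonresonant $p$ (for the parameters $t_rp^{\alpha_r}$) arbitrarily close to $0$, and for all nonresonant $p$ close enough to $0$ a contour as in the definition of $\langle f,g\rangle_{t_rp^{\alpha_r}}$ exists. 2. With $\tilde t_r$ as above (formed from the $t_r$), there exists a chain $D$ of closed curves in $\mathbb C^*$ with winding number $1$ around the points $\tilde t_aq^k,\tilde t_bq^k$ and $0$ around the points $q^{-k}/\tilde t_r$ for all $k\ge0$ and all $r$ with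 $\alpha_r=-\zeta$, and, if $\zeta=-\tfrac12$, also for $r=a,b$. 3. For every $w\in\mathbb C^*$ with $\theta(t_aw,t_bw;q)\ne0$, and every choice of such contours, $$\lim_{p\to0}p^{-val(f)-val(g)}\langle f,g\rangle_{t_rp^{\alpha_r}}=\frac{(q;q)\,(t_at_b;q)^{1_{\zeta=-1/2}}\prod_{r:\alpha_r=-\zeta}(t_rt_a,t_rt_b;q)}{\prod_{0\le r<s\le5:\ \alpha_r+\alpha_s=1}(qt_r^{-1}t_s^{-1};q)}$$ $$\times\int_D lc(f)(z)\,lc(g)(z)\,\frac{\prod_{r:\alpha_r=1+\zeta}(qz/t_r;q)}{(t_a/z,t_b/z;q)\prod_{r:\alpha_r=-\zeta}(t_rz;q)}\left(\frac{1-z^2}{(t_az,t_bz;q)}\right)^{1_{\zeta=-1/2}}\frac{\theta(wz,\frac{qz}{t_at_bw};q)}{\theta(t_aw,t_bw;q)}\frac{dz}{2\pi iz},$$ where $p$ runs through the nonresonant values. In particular the right-hand side does not depend on $w$. -/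

import Mathlib

open Complex Filter Topology

noncomputable section

namespace EllipticLimit

/-! ### q-symbols, theta functions and the elliptic gamma function -/

/-- `(x;q) = ∏_{k ≥ 0} (1 - x q^k)`. -/
def qPoch (x q : ℂ) : ℂ := ∏' k : ℕ, (1 - x * q ^ k)

/-- `(x;p,q) = ∏_{i,j ≥ 0} (1 - x p^i q^j)`. -/
def pqPoch (x p q : ℂ) : ℂ := ∏' k : ℕ × ℕ, (1 - x * p ^ k.1 * q ^ k.2)

/-- `θ(x;p) = (x;p) (p/x;p)`. -/
def theta (x p : ℂ) : ℂ := qPoch x p * qPoch (p / x) p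

/-- `θ(x;q;p)_n = ∏_{k < n} θ(x q^k;p)`. -/
def thetaFin (x q p : ℂ) (n : ℕ) : ℂ := ∏ k ∈ Finset.range n, theta (x * q ^ k) p

/-- `Γ(x;p,q) = ∏_{i,j ≥ 0} (1 - p^{i+1} q^{j+1} / x) / (1 - p^i q^j x)`. -/
def ellGamma (x p q : ℂ) : ℂ := pqPoch (p * q / x) p q / pqPoch x p q

/-! ### Contours: chains of closed curves -/

/-- A finite integral combination of closed `C¹` curves in the plane, each one
parametrised by `[0,1]`. -/
structure Chain where
  n : ℕ
  mult : Fin n → ℤ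
  loop : Fin n → ℝ → ℂ
  smooth : ∀ i, ContDiff ℝ 1 (loop i)
  closed : ∀ i, loop i 0 = loop i 1

/-- The integral of `F(z) dz` over a chain. -/
def Chain.integral (C : Chain) (F : ℂ → ℂ) : ℂ :=
  ∑ i, (C.mult i : ℂ) * ∫ t in (0 : ℝ)..1, F (C.loop i t) * deriv (C.loop i) t

/-- The points that lie on one of the curves of a chain. -/
def Chain.support (C : Chain) : Set ℂ := ⋃ i, C.loop i '' Set.Icc 0 1

/-- The winding number of a chain around `x` (for `x` off the support). -/
def Chain.winding (C : Chain) (x : ℂ) : ℂ :=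
  (2 * Real.pi * I)⁻¹ * C.integral (fun z => (z - x)⁻¹)

/-- The chain lies in the punctured plane, contains the points of `inner` and excludes those
of `outer`. (The sets `inner` used below accumulate at `0`, so that the chain then winds once
around `0`.) -/
structure Chain.Separates (C : Chain) (inner outer : Set ℂ) : Prop where
  zero_notMem : (0 : ℂ) ∉ C.support
  disjoint_inner : Disjoint C.support inner
  disjoint_outer : Disjoint C.support outer
  winding_inner : ∀ x ∈ inner, C.winding x = 1
  winding_outer : ∀ x ∈ outer, C.winding x = 0

/-! ### The elliptic level -/

/-- `f ∈ A(u;p,q)`, with `m_f = m`: `f` is a meromorphic function on the punctured plane,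
`f(1/z) = f(z)`, `f(pz) = f(z)`, and `θ(pq z^{±1}/u;q;p)_m f(z)` is holomorphic there (after
removal of the singularities at zeros of the theta factor). -/
structure InA (u p q : ℂ) (m : ℕ) (f : ℂ → ℂ) : Prop where
  meromorphic : ∀ z, z ≠ 0 → MeromorphicAt f z
  symmetric : ∀ z, z ≠ 0 → f z⁻¹ = f z
  abelian : ∀ z, z ≠ 0 → f (p * z) = f z
  holomorphic : ∃ h : ℂ → ℂ, DifferentiableOn ℂ h {0}ᶜ ∧
    ∀ z, z ≠ 0 → thetaFin (p * q * z / u) q p m * thetaFin (p * q * z⁻¹ / u) q p m ≠ 0 →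
      h z = thetaFin (p * q * z / u) q p m * thetaFin (p * q * z⁻¹ / u) q p m * f z

/-- The parameters shifted by the pole orders: `t_4 q^{-m_f}` and `t_5 q^{-m_g}` replace `t_4`
and `t_5`. -/
def shifted (q : ℂ) (mf mg : ℕ) (t : Fin 6 → ℂ) (r : Fin 6) : ℂ :=
  if r = 4 then t 4 / q ^ mf else if r = 5 then t 5 / q ^ mg else t r

/-- The points `p^i q^j τ_r` with `i, j ≥ 0`. -/
def ellInner (τ : Fin 6 → ℂ) (p q : ℂ) : Set ℂ :=
  {z | ∃ (r : Fin 6) (i j : ℕ), z = p ^ i * q ^ j * τ r}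

/-- The reciprocals of the points `p^i q^j τ_r` with `i, j ≥ 0`. -/
def ellOuter (τ : Fin 6 → ℂ) (p q : ℂ) : Set ℂ :=
  {z | ∃ (r : Fin 6) (i j : ℕ), z = (p ^ i * q ^ j * τ r)⁻¹}

/-- The bilinear form `⟨f,g⟩_{t_0,…,t_5;q;p}`, computed with the contour `C`. -/
def ellForm (t : Fin 6 → ℂ) (p q : ℂ) (f g : ℂ → ℂ) (C : Chain) : ℂ :=
  qPoch q q * qPoch p p / (2 * ∏ r, ∏ s ∈ Finset.Ioi r, ellGamma (t r * t s) p q) *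
    C.integral (fun z =>
      f z * g z *
        ((∏ r, ellGamma (t r * z) p q * ellGamma (t r * z⁻¹) p q) /
          (ellGamma (z ^ 2) p q * ellGamma ((z ^ 2)⁻¹) p q)) / (2 * Real.pi * I * z))

/-! ### Power series in `p` with real exponents

The functions involved are multivalued in `p`; a value of `p` together with a branch of its
powers is given by `l = log p`, that is `p = exp l` and `p^a = exp (a l)`. -/

/-- `p^a` for `p = exp l`. -/
def nomePow (a : ℝ) (l : ℂ) : ℂ := exp (a * l)

/-- `p → 0`, with arbitrary argument and branch: `Re (log p) → -∞`. -/
def nomeToZero : Filter ℂ := comap re atBot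

/-- Formal series `∑_s a_s(z) p^s`, with rational coefficients and a set of exponents that is
discrete and bounded from below (finitely many exponents below any bound). -/
structure NomeSeries where
  coeff : ℝ → RatFunc ℂ
  finite_le : ∀ N : ℝ, {s | s ≤ N ∧ coeff s ≠ 0}.Finite

/-- The smallest exponent (and `0` for the zero series). -/
def NomeSeries.val (F : NomeSeries) : ℝ := sInf {s | F.coeff s ≠ 0}

/-- The leading coefficient, as a function of `z`. -/
def NomeSeries.lc (F : NomeSeries) (z : ℂ) : ℂ := (F.coeff F.val).eval (RingHom.id ℂ) z

/-- The sum of the terms with exponent at most `N`, at the point `z` and at `p = exp l`. -/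
def NomeSeries.partialSum (F : NomeSeries) (N : ℝ) (l z : ℂ) : ℂ :=
  ∑ s ∈ (F.finite_le N).toFinset, (F.coeff s).eval (RingHom.id ℂ) z * nomePow s l

/-- `f(l,z)` is the sum of the series `F`: for `z` outside the zero set of some nonzero
polynomial the coefficients have no poles, and on every compact set `K` of such (nonzero) `z`
the series `p^{-val} F` converges uniformly to `p^{-val} f`, for `z ∈ K` and `0 < |p| ≤ ε`. -/
def NomeSeries.ConvergesTo (F : NomeSeries) (f : ℂ → ℂ → ℂ) : Prop :=
  ∃ P : Polynomial ℂ, P ≠ 0 ∧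
    (∀ s z, z ≠ 0 → P.eval z ≠ 0 → (F.coeff s).denom.eval z ≠ 0) ∧
    ∀ K : Set ℂ, IsCompact K → (∀ z ∈ K, z ≠ 0 ∧ P.eval z ≠ 0) →
      ∃ M : ℝ, TendstoUniformlyOn
        (fun (N : ℝ) (x : ℂ × ℂ) => nomePow (-F.val) x.1 * F.partialSum N x.1 x.2)
        (fun x : ℂ × ℂ => nomePow (-F.val) x.1 * f x.1 x.2)
        atTop ({l : ℂ | l.re ≤ M} ×ˢ K)

/-! ### The limiting bilinear form -/

/-- Points to be contained in the contour of the limiting form: the zeros `τ_a q^k`, `τ_b q^k`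
of `(τ_a/z, τ_b/z;q)`. -/
def limInner (q : ℂ) (τ : Fin 6 → ℂ) (a b : Fin 6) : Set ℂ :=
  {z | ∃ k : ℕ, z = τ a * q ^ k ∨ z = τ b * q ^ k}

/-- Points to be excluded: the zeros `q^{-k}/τ_r` of `(τ_r z;q)`, for every `r` for which
`(t_r z;q)` occurs in the denominator of the limiting weight. -/
def limOuter (q : ℂ) (τ : Fin 6 → ℂ) (α : Fin 6 → ℝ) (ζ : ℝ) (a b : Fin 6) : Set ℂ :=
  {z | ∃ (r : Fin 6) (k : ℕ), (α r = -ζ ∨ (ζ = -1 / 2 ∧ (r = a ∨ r = b))) ∧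
    z = (τ r * q ^ k)⁻¹}

/-- The constant in front of the limiting integral. -/
def limPrefactor (q : ℂ) (t : Fin 6 → ℂ) (α : Fin 6 → ℝ) (ζ : ℝ) (a b : Fin 6) : ℂ :=
  qPoch q q * (if ζ = -1 / 2 then qPoch (t a * t b) q else 1) *
    (∏ r with α r = -ζ, qPoch (t r * t a) q * qPoch (t r * t b) q) /
    ∏ r, ∏ s ∈ Finset.Ioi r with α r + α s = 1, qPoch (q * (t r)⁻¹ * (t s)⁻¹) q

/-- The weight of the limiting integral, with the auxiliary parameter `w`. -/
def limWeight (q : ℂ) (t : Fin 6 → ℂ) (α : Fin 6 → ℝ) (ζ : ℝ) (a b : Fin 6) (w z : ℂ) : ℂ :=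
  (∏ r with α r = 1 + ζ, qPoch (q * z / t r) q) /
      (qPoch (t a / z) q * qPoch (t b / z) q * ∏ r with α r = -ζ, qPoch (t r * z) q) *
    (if ζ = -1 / 2 then (1 - z ^ 2) / (qPoch (t a * z) q * qPoch (t b * z) q) else 1) *
    (theta (w * z) q * theta (q * z / (t a * t b * w)) q /
      (theta (t a * w) q * theta (t b * w) q))

/-- The limiting bilinear form, computed with the contour `C`. -/
def limForm (q : ℂ) (t : Fin 6 → ℂ) (α : Fin 6 → ℝ) (ζ : ℝ) (a b : Fin 6) (w : ℂ)
    (f g : ℂ → ℂ) (C : Chain) : ℂ :=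
  limPrefactor q t α ζ a b *
    C.integral (fun z => f z * g z * limWeight q t α ζ a b w z / (2 * Real.pi * I * z))

/-- The parameters `t_r p^{α_r}` for `p = exp l`. -/
def scaled (t : Fin 6 → ℂ) (α : Fin 6 → ℝ) (l : ℂ) (r : Fin 6) : ℂ := t r * nomePow (α r) l

/-- The points that the contour of `⟨f,g⟩_{t_r p^{α_r}}` has to contain. -/
def scaledInner (q : ℂ) (mf mg : ℕ) (t : Fin 6 → ℂ) (α : Fin 6 → ℝ) (l : ℂ) : Set ℂ :=
  ellInner (shifted q mf mg (scaled t α l)) (exp l) q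

/-- The points that the contour of `⟨f,g⟩_{t_r p^{α_r}}` has to exclude. -/
def scaledOuter (q : ℂ) (mf mg : ℕ) (t : Fin 6 → ℂ) (α : Fin 6 → ℝ) (l : ℂ) : Set ℂ :=
  ellOuter (shifted q mf mg (scaled t α l)) (exp l) q

/-- The values of `l = log p` for which `⟨f,g⟩_{t_r p^{α_r}}` is given by a contour integral:
no point has to be both contained in and excluded by the contour. -/
def nonresonant (q : ℂ) (mf mg : ℕ) (t : Fin 6 → ℂ) (α : Fin 6 → ℝ) : Set ℂ :=
  {l | Disjoint (scaledInner q mf mg t α l) (scaledOuter q mf mg t α l)}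

end EllipticLimit

end

/-!
By the symmetry `z ↦ 1/z`, the poles of the integrand of `⟨f,g⟩` cluster at the two scales `|p|^ζ`
and `|p|^{-ζ}`, whereas the limit only sees the first. So the symmetry is broken before passing to
the limit: the three-term relation for theta functions exhibits the integrand as a constant multiple
of `B(z) + B(1/z)`, where the broken integrand `B` contains `Γ(p t_a z)` and `Γ(p t_b z)` in place
of `Γ(t_a z)` and `Γ(t_b z)`, and thereby loses the poles at the second scale. Hence `⟨f,g⟩` is, up
to that constant, twice the integral of `B`.

After the substitution `z ↦ p^ζ z` with `W = w p^{-ζ}`, each elliptic gamma factor of the broken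
integrand has an argument `x p^e` with `0 ≤ e ≤ 1` and converges: to `1` for `0 < e < 1`, and to a
`q`-symbol at the endpoints. Cauchy's theorem for chains replaces the contour, for small `p`, by the
fixed chain `D` of the limiting form dilated by `p^ζ`, since both have the same winding number
around every pole. The passage to the limit under the integral over `D` is dominated: where the
expansions of `f` and `g` are not known to converge, the maximum principle on small circles bounds
the regularised integrand.
-/

noncomputable section

namespace EllipticLimit

open MeasureTheory Set

/-! ### Integration along chains -/

theorem countable_setOf_mem_and_deriv_ne_zero {E : Type*} [NormedAddCommGroup E]
    [NormedSpace ℝ E] {γ : ℝ → E} (hγ : Differentiable ℝ γ) {A : Set E} (hA : A.Countable) :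
    {s | γ s ∈ A ∧ deriv γ s ≠ 0}.Countable := by
  have hfiber (c : E) : {s | γ s = c ∧ deriv γ s ≠ 0}.Countable := by
    have : DiscreteTopology {s | γ s = c ∧ deriv γ s ≠ 0} := by
      rw [discreteTopology_subtype_iff]
      rintro s ⟨_, hs⟩
      rw [inf_principal_eq_bot]
      filter_upwards [(hγ s).hasDerivAt.eventually_ne (c := c) hs] with x hx h
      exact hx h.1
    exact countable_coe_iff.1
      (countable_of_Lindelof_of_discrete (X := {s | γ s = c ∧ deriv γ s ≠ 0}))
  refine (hA.biUnion fun c _ => hfiber c).mono fun s hs => ?_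
  exact mem_biUnion hs.1 ⟨rfl, hs.2⟩

theorem sub_div_sub_mem_slitPlane {x y z : ℂ} (hz : z ∉ segment ℝ x y) :
    (z - x) / (z - y) ∈ slitPlane := by
  have hzy : z - y ≠ 0 := fun h => hz (sub_eq_zero.1 h ▸ right_mem_segment ℝ x y)
  by_contra hns
  rw [mem_slitPlane_iff_not_le_zero, not_not, Complex.le_def] at hns
  obtain ⟨c, hc⟩ : ∃ c : ℝ, c = -((z - x) / (z - y)).re := ⟨_, rfl⟩
  have hc0 : 0 ≤ c := by simpa [hc] using hns.1
  have hquot : (z - x) / (z - y) = -(c : ℂ) :=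
    Complex.ext (by simp [hc]) (by simpa using hns.2)
  rw [div_eq_iff hzy] at hquot
  refine hz ⟨1 / (1 + c), c / (1 + c), by positivity, by positivity, by field_simp, ?_⟩
  have hc1 : (1 + c : ℂ) ≠ 0 := mod_cast (by positivity : (1 + c : ℝ) ≠ 0)
  simp only [real_smul, ofReal_div, ofReal_one, ofReal_add]
  field_simp
  linear_combination -hquot

theorem one_sub_div_mem_slitPlane {z x : ℂ} (h : ‖z‖ < ‖x‖) : 1 - z / x ∈ slitPlane := by
  refine Or.inl ?_
  have hlt : ‖z / x‖ < 1 := by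
    rw [norm_div]
    exact (div_lt_one ((norm_nonneg z).trans_lt h)).2 h
  simp only [sub_re, one_re]
  linarith [Complex.re_le_norm (z / x)]

namespace Chain

theorem mem_support (C : Chain) (i : Fin C.n) {s : ℝ} (hs : s ∈ Icc (0 : ℝ) 1) :
    C.loop i s ∈ C.support :=
  mem_iUnion.2 ⟨i, mem_image_of_mem _ hs⟩

theorem isCompact_support (C : Chain) : IsCompact C.support :=
  isCompact_iUnion fun i => isCompact_Icc.image (C.smooth i).continuous

theorem continuous_deriv_loop (C : Chain) (i : Fin C.n) : Continuous (deriv (C.loop i)) :=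
  (C.smooth i).continuous_deriv le_rfl

theorem hasDerivAt_loop (C : Chain) (i : Fin C.n) (s : ℝ) :
    HasDerivAt (C.loop i) (deriv (C.loop i) s) s :=
  ((C.smooth i).differentiable one_ne_zero s).hasDerivAt

theorem continuousOn_comp_loop {C : Chain} {F : ℂ → ℂ} (hF : ContinuousOn F C.support)
    (i : Fin C.n) : ContinuousOn (fun s => F (C.loop i s)) (Icc 0 1) :=
  hF.comp (C.smooth i).continuous.continuousOn fun _ hs => C.mem_support i hs

theorem continuousOn_integrand {C : Chain} {F : ℂ → ℂ} (hF : ContinuousOn F C.support)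
    (i : Fin C.n) :
    ContinuousOn (fun s => F (C.loop i s) * deriv (C.loop i) s) (Icc 0 1) :=
  (continuousOn_comp_loop hF i).mul (C.continuous_deriv_loop i).continuousOn

theorem intervalIntegrable {C : Chain} {F : ℂ → ℂ} (hF : ContinuousOn F C.support)
    (i : Fin C.n) :
    IntervalIntegrable (fun s => F (C.loop i s) * deriv (C.loop i) s) volume 0 1 :=
  ContinuousOn.intervalIntegrable (by
    rw [uIcc_of_le zero_le_one]; exact continuousOn_integrand hF i)

theorem integral_congr_of_countable {C : Chain} {F G : ℂ → ℂ} {E : Set ℂ} (hE : E.Countable)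
    (h : ∀ z ∈ C.support, z ∉ E → F z = G z) : C.integral F = C.integral G := by
  refine Finset.sum_congr rfl fun i _ => ?_
  congr 1
  refine intervalIntegral.integral_congr_ae ?_
  have := (countable_setOf_mem_and_deriv_ne_zero
    ((C.smooth i).differentiable one_ne_zero) hE).ae_notMem volume
  filter_upwards [this] with s hs hs'
  rw [uIoc_of_le zero_le_one] at hs'
  by_cases h0 : deriv (C.loop i) s = 0
  · simp [h0]
  · rw [h _ (C.mem_support i (Ioc_subset_Icc_self hs')) fun hE' => hs ⟨hE', h0⟩]

theorem integral_congr {C : Chain} {F G : ℂ → ℂ}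
    (h : ∀ z ∈ C.support, F z = G z) : C.integral F = C.integral G :=
  integral_congr_of_countable countable_empty fun z hz _ => h z hz

theorem integral_add {C : Chain} {F G : ℂ → ℂ} (hF : ContinuousOn F C.support)
    (hG : ContinuousOn G C.support) :
    C.integral (fun z => F z + G z) = C.integral F + C.integral G := by
  simp only [integral, ← Finset.sum_add_distrib, ← mul_add]
  refine Finset.sum_congr rfl fun i _ => ?_
  rw [← intervalIntegral.integral_add (intervalIntegrable hF i) (intervalIntegrable hG i)]
  simp only [add_mul]

theorem integral_const_mul (C : Chain) (c : ℂ) (F : ℂ → ℂ) :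
    C.integral (fun z => c * F z) = c * C.integral F := by
  simp only [integral, Finset.mul_sum]
  refine Finset.sum_congr rfl fun i _ => ?_
  simp only [mul_assoc, intervalIntegral.integral_const_mul]
  ring

theorem integral_sub {C : Chain} {F G : ℂ → ℂ} (hF : ContinuousOn F C.support)
    (hG : ContinuousOn G C.support) :
    C.integral (fun z => F z - G z) = C.integral F - C.integral G := by
  have h := integral_add hF (G := fun z => -1 * G z) (continuousOn_const.mul hG)
  rw [integral_const_mul] at h
  simpa [sub_eq_add_neg] using h

theorem integral_eq_zero_of_hasDerivAt {C : Chain} {P F : ℂ → ℂ} (hF : ContinuousOn F C.support)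
    (hP : ∀ z ∈ C.support, HasDerivAt P (F z) z) : C.integral F = 0 := by
  refine Finset.sum_eq_zero fun i _ => ?_
  rw [intervalIntegral.integral_eq_sub_of_hasDerivAt (f := fun s => P (C.loop i s))
    (fun s hs => ?_) (intervalIntegrable hF i), ← C.closed i]
  · simp
  · rw [uIcc_of_le zero_le_one] at hs
    exact (hP _ (C.mem_support i hs)).comp_of_eq s (C.hasDerivAt_loop i s) rfl

theorem exists_norm_integral_le (C : Chain) : ∃ B : ℝ, 0 ≤ B ∧ ∀ (F : ℂ → ℂ) (M : ℝ),
    (∀ z ∈ C.support, ‖F z‖ ≤ M) → ‖C.integral F‖ ≤ B * M := by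
  have hbdd (i : Fin C.n) : ∃ b : ℝ, ∀ s ∈ Icc (0 : ℝ) 1, ‖deriv (C.loop i) s‖ ≤ b :=
    isCompact_Icc.exists_bound_of_continuousOn (C.continuous_deriv_loop i).continuousOn
  choose b hb using hbdd
  have hb0 (i : Fin C.n) : 0 ≤ b i := (norm_nonneg _).trans (hb i 0 (by simp))
  refine ⟨∑ i, ‖(C.mult i : ℂ)‖ * b i, Finset.sum_nonneg fun i _ =>
    mul_nonneg (norm_nonneg _) (hb0 i), fun F M hF => ?_⟩
  rw [Finset.sum_mul]
  refine (norm_sum_le _ _).trans (Finset.sum_le_sum fun i _ => ?_)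
  rw [norm_mul, mul_assoc]
  refine mul_le_mul_of_nonneg_left ?_ (norm_nonneg _)
  have hint : ‖∫ s in (0 : ℝ)..1, F (C.loop i s) * deriv (C.loop i) s‖ ≤ b i * M * |1 - 0| := by
    refine intervalIntegral.norm_integral_le_of_norm_le_const fun s hs => ?_
    rw [uIoc_of_le zero_le_one] at hs
    have hs' := Ioc_subset_Icc_self hs
    rw [norm_mul, mul_comm]
    exact mul_le_mul (hb i s hs') (hF _ (C.mem_support i hs')) (norm_nonneg _) (hb0 i)
  simpa using hint

theorem isOpen_compl_support (C : Chain) : IsOpen C.supportᶜ :=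
  C.isCompact_support.isClosed.isOpen_compl

theorem continuousOn_inv_sub {C : Chain} {x : ℂ} (hx : x ∉ C.support) :
    ContinuousOn (fun z => (z - x)⁻¹) C.support :=
  (continuousOn_id.sub continuousOn_const).inv₀ fun z hz h => hx (by
    rwa [← show z = x from sub_eq_zero.1 h])

theorem winding_eq_of_segment {C : Chain} {x y : ℂ} (h : Disjoint (segment ℝ x y) C.support) :
    C.winding x = C.winding y := by
  have hx : x ∉ C.support := disjoint_left.1 h (left_mem_segment ℝ x y)
  have hy : y ∉ C.support := disjoint_left.1 h (right_mem_segment ℝ x y)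
  unfold winding
  congr 1
  rw [← sub_eq_zero, ← integral_sub (continuousOn_inv_sub hx) (continuousOn_inv_sub hy)]
  -- off the segment, `log ((z - x) / (z - y))` is a primitive of the integrand
  refine integral_eq_zero_of_hasDerivAt (P := fun z => log ((z - x) / (z - y)))
    ((continuousOn_inv_sub hx).sub (continuousOn_inv_sub hy)) fun z hz => ?_
  have hzx : z - x ≠ 0 := fun h => hx (sub_eq_zero.1 h ▸ hz)
  have hzy : z - y ≠ 0 := fun h => hy (sub_eq_zero.1 h ▸ hz)
  have hquot : HasDerivAt (fun z => (z - x) / (z - y))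
      ((1 * (z - y) - (z - x) * 1) / (z - y) ^ 2) z :=
    ((hasDerivAt_id z).sub_const x).div ((hasDerivAt_id z).sub_const y) hzy
  convert hquot.clog (sub_div_sub_mem_slitPlane (disjoint_right.1 h hz)) using 1
  field_simp

theorem exists_ball_winding_eq {C : Chain} {x : ℂ} (hx : x ∉ C.support) :
    ∃ δ > 0, ∀ y ∈ Metric.ball x δ, y ∉ C.support ∧ C.winding y = C.winding x := by
  obtain ⟨δ, hδ, h⟩ := Metric.isOpen_iff.1 C.isOpen_compl_support x hx
  refine ⟨δ, hδ, fun y hy => ⟨h hy, winding_eq_of_segment ?_⟩⟩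
  exact (disjoint_left.2 fun z hz hz' => h ((convex_ball x δ).segment_subset hy
    (Metric.mem_ball_self hδ) hz) hz')

theorem winding_eq_zero_of_norm_lt {C : Chain} {x : ℂ} (hx : ∀ z ∈ C.support, ‖z‖ < ‖x‖) :
    C.winding x = 0 := by
  have hxs : x ∉ C.support := fun h => lt_irrefl _ (hx x h)
  unfold winding
  rw [integral_eq_zero_of_hasDerivAt (P := fun z => log (1 - z / x)) (continuousOn_inv_sub hxs)
    fun z hz => ?_, mul_zero]
  have hx0 : x ≠ 0 := norm_pos_iff.1 ((norm_nonneg z).trans_lt (hx z hz))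
  have hzx : z - x ≠ 0 := sub_ne_zero.2 fun h => hxs (h ▸ hz)
  have hxz : x - z ≠ 0 := sub_ne_zero.2 fun h => hxs (h ▸ hz)
  have hlin : HasDerivAt (fun z => 1 - z / x) (-(1 / x)) z :=
    ((hasDerivAt_id z).div_const x).const_sub 1
  convert hlin.clog (one_sub_div_mem_slitPlane (hx z hz)) using 1
  rw [show 1 - z / x = (x - z) / x by field_simp]
  field_simp
  ring

theorem exists_winding_eq_zero (C : Chain) :
    ∃ R > 0, (∀ z ∈ C.support, ‖z‖ < R) ∧ ∀ x, R ≤ ‖x‖ → C.winding x = 0 := by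
  obtain ⟨R, hR0, hR⟩ := C.isCompact_support.isBounded.exists_pos_norm_lt
  exact ⟨R, hR0, hR, fun x hx => winding_eq_zero_of_norm_lt fun z hz => (hR z hz).trans_le hx⟩

/-- The formal difference of two chains. -/
def sub (C D : Chain) : Chain where
  n := C.n + D.n
  mult := Fin.append C.mult fun j => -D.mult j
  loop := Fin.append C.loop D.loop
  smooth := Fin.addCases (fun i => by simpa using C.smooth i) fun i => by simpa using D.smooth i
  closed := Fin.addCases (fun i => by simpa using C.closed i) fun i => by simpa using D.closed i

theorem integral_chain_sub (C D : Chain) (F : ℂ → ℂ) :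
    (C.sub D).integral F = C.integral F - D.integral F := by
  have := Fin.sum_univ_add (fun i : Fin (C.n + D.n) =>
    ((Fin.append C.mult (fun j => -D.mult j) i : ℤ) : ℂ) *
      ∫ s in (0 : ℝ)..1, F (Fin.append C.loop D.loop i s) * deriv (Fin.append C.loop D.loop i) s)
  refine this.trans ?_
  simp [integral, sub_eq_add_neg]

theorem support_sub_subset (C D : Chain) : (C.sub D).support ⊆ C.support ∪ D.support := by
  refine iUnion_subset ?_
  refine Fin.addCases (fun i => ?_) fun i => ?_
  · simp only [sub, Fin.append_left]
    exact (subset_iUnion (fun i => C.loop i '' Icc 0 1) i).trans subset_union_left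
  · simp only [sub, Fin.append_right]
    exact (subset_iUnion (fun i => D.loop i '' Icc 0 1) i).trans subset_union_right

/-- The dilation of a chain by a factor `c`. -/
def dilate (c : ℂ) (C : Chain) : Chain where
  n := C.n
  mult := C.mult
  loop i s := c * C.loop i s
  smooth i := contDiff_const.mul (C.smooth i)
  closed i := by rw [C.closed i]

theorem integral_dilate (c : ℂ) (C : Chain) (F : ℂ → ℂ) :
    (C.dilate c).integral F = C.integral fun z => c * F (c * z) := by
  refine Finset.sum_congr rfl fun i _ => ?_
  congr 1
  refine intervalIntegral.integral_congr fun s _ => ?_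
  simp only [dilate]
  rw [((C.hasDerivAt_loop i s).const_mul c).deriv]
  ring

theorem support_dilate (c : ℂ) (C : Chain) :
    (C.dilate c).support = (fun z => c * z) '' C.support := by
  simp only [support, image_iUnion, image_image]
  rfl

theorem winding_dilate {c : ℂ} (hc : c ≠ 0) (C : Chain) (x : ℂ) :
    (C.dilate c).winding (c * x) = C.winding x := by
  simp only [winding, integral_dilate]
  congr 2
  funext z
  rw [← mul_sub, mul_inv, mul_inv_cancel_left₀ hc]

/-- The image of a chain under `z ↦ 1/z`, with the opposite orientation. -/
def inversion (C : Chain) (h : ∀ i s, C.loop i s ≠ 0) : Chain where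
  n := C.n
  mult i := -C.mult i
  loop i s := (C.loop i s)⁻¹
  smooth i := (C.smooth i).inv (h i)
  closed i := by rw [C.closed i]

theorem integral_inversion (C : Chain) (h : ∀ i s, C.loop i s ≠ 0) (F : ℂ → ℂ) :
    (C.inversion h).integral F = C.integral fun z => F z⁻¹ / z ^ 2 := by
  refine Finset.sum_congr rfl fun i _ => ?_
  simp only [inversion, Int.cast_neg, neg_mul, ← mul_neg]
  rw [← intervalIntegral.integral_neg]
  congr 1
  refine intervalIntegral.integral_congr fun s _ => ?_
  have := ((C.hasDerivAt_loop i s).inv (h i s)).deriv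
  simp only [Pi.inv_def] at this
  simp only [this]
  ring

theorem support_inversion (C : Chain) (h : ∀ i s, C.loop i s ≠ 0) :
    (C.inversion h).support = (fun z => z⁻¹) '' C.support := by
  simp only [support, image_iUnion, image_image]
  rfl

theorem winding_inversion (C : Chain) (h : ∀ i s, C.loop i s ≠ 0) (h0 : (0 : ℂ) ∉ C.support)
    {x : ℂ} (hx : x ≠ 0) (hxs : x⁻¹ ∉ C.support) :
    (C.inversion h).winding x = C.winding 0 - C.winding x⁻¹ := by
  simp only [winding, integral_inversion]
  rw [← mul_sub, ← integral_sub (continuousOn_inv_sub h0) (continuousOn_inv_sub hxs)]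
  congr 1
  refine integral_congr fun z hz => ?_
  have hz0 : z ≠ 0 := fun h => h0 (h ▸ hz)
  have hzx : z - x⁻¹ ≠ 0 := sub_ne_zero.2 fun h => hxs (h ▸ hz)
  have hxz : z * x - 1 ≠ 0 := by
    rw [show z * x - 1 = x * (z - x⁻¹) by field_simp]
    exact mul_ne_zero hx hzx
  rw [show z⁻¹ - x = -(z * x - 1) / z by field_simp; ring,
    show z - x⁻¹ = (z * x - 1) / x by field_simp, sub_zero]
  field_simp
  ring

end Chain

/-! ### The homology form of Cauchy's theorem -/

theorem aestronglyMeasurable_of_ae_hasDerivAt {α 𝕜 E : Type*} [MeasurableSpace α]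
    {μ : Measure α} [NontriviallyNormedField 𝕜] [NormedAddCommGroup E] [NormedSpace 𝕜 E]
    {F : 𝕜 → α → E} {F' : α → E} {z₀ : 𝕜}
    (hF : ∀ᶠ z in 𝓝 z₀, AEStronglyMeasurable (F z) μ)
    (hF' : ∀ᵐ s ∂μ, HasDerivAt (fun z => F z s) (F' s) z₀) : AEStronglyMeasurable F' μ := by
  obtain ⟨u, hu⟩ := exists_seq_tendsto (𝓝[≠] z₀)
  obtain ⟨N, hN⟩ := eventually_atTop.1
    ((hu.mono_right nhdsWithin_le_nhds).eventually hF)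
  refine aestronglyMeasurable_of_tendsto_ae atTop
    (f := fun n s => slope (fun z => F z s) z₀ (u (n + N))) (fun n => ?_) ?_
  · simp only [slope, vsub_eq_sub]
    exact ((hN _ (Nat.le_add_left N n)).sub hF.self_of_nhds).const_smul _
  · filter_upwards [hF'] with s hs
    exact (hasDerivAt_iff_tendsto_slope.1 hs).comp (hu.comp (tendsto_add_atTop_nat N))

theorem exists_bound_dslope {U : Set ℂ} (hU : IsOpen U) {F : ℂ → ℂ} (hF : DifferentiableOn ℂ F U)
    {K : Set ℂ} (hK : IsCompact K) (hKU : K ⊆ U) {z₀ : ℂ} (hz₀ : z₀ ∈ U) :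
    ∃ r > 0, Metric.ball z₀ r ⊆ U ∧ ∃ B, ∀ z ∈ Metric.ball z₀ r, ∀ w ∈ K, ‖dslope F z w‖ ≤ B := by
  obtain ⟨ε, hε, hεU⟩ := Metric.nhds_basis_closedBall.mem_iff.1 (hU.mem_nhds hz₀)
  have hcb := isCompact_closedBall z₀ ε
  obtain ⟨MK, hMK⟩ := hK.exists_bound_of_continuousOn (hF.continuousOn.mono hKU)
  obtain ⟨Mε, hMε⟩ := hcb.exists_bound_of_continuousOn (hF.continuousOn.mono hεU)
  obtain ⟨M', hM'⟩ := hcb.exists_bound_of_continuousOn ((hF.deriv hU).continuousOn.mono hεU)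
  have hsub : Metric.ball z₀ (ε / 2) ⊆ Metric.closedBall z₀ ε :=
    (Metric.ball_subset_ball (by linarith)).trans Metric.ball_subset_closedBall
  refine ⟨ε / 2, half_pos hε, hsub.trans hεU, max M' ((ε / 2)⁻¹ * (MK + Mε)), fun z hz w hw => ?_⟩
  rcases eq_or_ne w z with rfl | hne
  · rw [dslope_same]
    exact (hM' _ (hsub hz)).trans (le_max_left _ _)
  rw [dslope_of_ne _ hne, slope, vsub_eq_sub, norm_smul, norm_inv]
  have hwz : 0 < ‖w - z‖ := norm_pos_iff.2 (sub_ne_zero.2 hne)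
  by_cases hwε : w ∈ Metric.closedBall z₀ ε
  · refine le_trans ?_ (le_max_left _ _)
    rw [inv_mul_le_iff₀ hwz, mul_comm]
    exact (convex_closedBall z₀ ε).norm_image_sub_le_of_norm_deriv_le
      (fun y hy => hF.differentiableAt (hU.mem_nhds (hεU hy))) hM' (hsub hz) hwε
  · refine le_trans ?_ (le_max_right _ _)
    have hfar : ε / 2 ≤ ‖w - z‖ := by
      rw [Metric.mem_closedBall, not_le] at hwε
      rw [Metric.mem_ball] at hz
      rw [← dist_eq_norm]
      linarith [dist_triangle w z z₀]
    refine mul_le_mul (inv_anti₀ (half_pos hε) hfar) ?_ (norm_nonneg _) (by positivity)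
    exact (norm_sub_le _ _).trans (add_le_add (hMK w hw) (hMε z (hsub hz)))

theorem dslope_comm {𝕜 E : Type*} [NontriviallyNormedField 𝕜] [NormedAddCommGroup E]
    [NormedSpace 𝕜 E] (F : 𝕜 → E) (z w : 𝕜) : dslope F z w = dslope F w z := by
  rcases eq_or_ne w z with rfl | hne
  · rfl
  · rw [dslope_of_ne _ hne, dslope_of_ne _ hne.symm, slope_comm]

namespace Chain

theorem norm_deriv_le_of_mem_ball_half {F : ℂ → ℂ} {z₀ z : ℂ} {r B : ℝ}
    (hr : 0 < r) (hd : DifferentiableOn ℂ F (Metric.ball z₀ r))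
    (hB : ∀ y ∈ Metric.ball z₀ r, ‖F y‖ ≤ B) (hz : z ∈ Metric.ball z₀ (r / 2)) :
    ‖deriv F z‖ ≤ B / (r / 4) := by
  have hball : Metric.closedBall z (r / 4) ⊆ Metric.ball z₀ r :=
    Metric.closedBall_subset_ball' (by rw [Metric.mem_ball] at hz; linarith)
  exact norm_deriv_le_of_forall_mem_sphere_norm_le (by positivity) (hd.diffContOnCl_ball hball)
    fun y hy => hB y (hball (Metric.sphere_subset_closedBall hy))

theorem differentiableAt_integral {C : Chain} {K : ℂ → ℂ → ℂ} {z₀ : ℂ} {r B : ℝ} (hr : 0 < r)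
    (hc : ∀ z ∈ Metric.ball z₀ r, ContinuousOn (K z) C.support)
    (hd : ∀ w ∈ C.support, DifferentiableOn ℂ (fun z => K z w) (Metric.ball z₀ r))
    (hB : ∀ z ∈ Metric.ball z₀ r, ∀ w ∈ C.support, ‖K z w‖ ≤ B) :
    DifferentiableAt ℂ (fun z => C.integral (K z)) z₀ := by
  have hz₀ : z₀ ∈ Metric.ball z₀ r := Metric.mem_ball_self hr
  have hB0 {w : ℂ} (hw : w ∈ C.support) : 0 ≤ B := (norm_nonneg _).trans (hB z₀ hz₀ w hw)
  have hhas (i : Fin C.n) {s : ℝ} (hs : s ∈ uIoc (0 : ℝ) 1) {z : ℂ} (hz : z ∈ Metric.ball z₀ r) :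
      HasDerivAt (fun z => K z (C.loop i s) * deriv (C.loop i) s)
        (deriv (fun z => K z (C.loop i s)) z * deriv (C.loop i) s) z := by
    rw [uIoc_of_le zero_le_one] at hs
    exact ((hd _ (C.mem_support i (Ioc_subset_Icc_self hs))).differentiableAt
      (Metric.isOpen_ball.mem_nhds hz)).hasDerivAt.mul_const _
  have hmeas (i : Fin C.n) : ∀ᶠ z in 𝓝 z₀, AEStronglyMeasurable
      (fun s => K z (C.loop i s) * deriv (C.loop i) s) (volume.restrict (uIoc 0 1)) := by
    filter_upwards [Metric.ball_mem_nhds z₀ hr] with z hz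
    rw [uIoc_of_le zero_le_one]
    exact (intervalIntegrable (hc z hz) i).1.aestronglyMeasurable
  unfold integral
  refine DifferentiableAt.fun_sum fun i _ => DifferentiableAt.const_mul ?_ _
  obtain ⟨b, hb⟩ := isCompact_Icc.exists_bound_of_continuousOn (s := Icc (0 : ℝ) 1)
    (C.continuous_deriv_loop i).continuousOn
  refine (intervalIntegral.hasDerivAt_integral_of_dominated_loc_of_deriv_le
    (bound := fun _ => B / (r / 4) * b) (Metric.ball_mem_nhds z₀ (half_pos hr)) (hmeas i)
    (intervalIntegrable (hc _ hz₀) i)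
    (aestronglyMeasurable_of_ae_hasDerivAt (hmeas i) ((ae_restrict_mem measurableSet_uIoc).mono
      fun s hs => hhas i hs hz₀))
    (Eventually.of_forall fun s hs z hz => ?_) intervalIntegrable_const
    (Eventually.of_forall fun s hs z hz =>
      hhas i hs (Metric.ball_subset_ball (by linarith) hz))).2.differentiableAt
  rw [uIoc_of_le zero_le_one] at hs
  have hw := C.mem_support i (Ioc_subset_Icc_self hs)
  rw [norm_mul]
  exact mul_le_mul
    (norm_deriv_le_of_mem_ball_half hr (hd _ hw) (fun y hy => hB y hy _ hw) hz)
    (hb s (Ioc_subset_Icc_self hs)) (norm_nonneg _) (div_nonneg (hB0 hw) (by positivity))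

theorem differentiableAt_integral_dslope {C : Chain} {U : Set ℂ} (hU : IsOpen U)
    (hC : C.support ⊆ U) {F : ℂ → ℂ} (hF : DifferentiableOn ℂ F U) {z₀ : ℂ} (hz₀ : z₀ ∈ U) :
    DifferentiableAt ℂ (fun z => C.integral (dslope F z)) z₀ := by
  obtain ⟨r, hr, hrU, B, hB⟩ := exists_bound_dslope hU hF C.isCompact_support hC hz₀
  refine differentiableAt_integral hr (fun z hz => ?_) (fun w hw => ?_) hB
  · exact ((differentiableOn_dslope (hU.mem_nhds (hrU hz))).2 hF).continuousOn.mono hC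
  · simp only [dslope_comm F _ w]
    exact ((differentiableOn_dslope (hU.mem_nhds (hC hw))).2 hF).mono hrU

/-- The Cauchy transform along the chain `C`, without the factor `(2πi)⁻¹`. It is the exterior
part of the entire function in Dixon's proof of Cauchy's theorem. -/
def cauchyTransform (C : Chain) (F : ℂ → ℂ) (z : ℂ) : ℂ :=
  C.integral fun w => F w * (w - z)⁻¹

variable {C : Chain} {F : ℂ → ℂ}

theorem differentiableAt_cauchyTransform (hF : ContinuousOn F C.support) {z₀ : ℂ}
    (hz₀ : z₀ ∉ C.support) : DifferentiableAt ℂ (C.cauchyTransform F) z₀ := by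
  obtain ⟨δ, hδ, hdisj⟩ := Metric.isOpen_iff.1 C.isOpen_compl_support z₀ hz₀
  obtain ⟨M, hM⟩ := C.isCompact_support.exists_bound_of_continuousOn hF
  have hsub : Metric.ball z₀ (δ / 2) ⊆ Metric.ball z₀ δ := Metric.ball_subset_ball (by linarith)
  refine differentiableAt_integral (B := M * (δ / 2)⁻¹) (half_pos hδ)
    (fun z hz => hF.mul (continuousOn_inv_sub (hdisj (hsub hz)))) (fun w hw => ?_)
    fun z hz w hw => ?_
  · refine DifferentiableOn.const_mul (DifferentiableOn.inv ?_ fun z hz h => ?_) _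
    · exact (differentiable_const w).differentiableOn.sub differentiableOn_id
    · exact hdisj (hsub hz) (by rwa [← show w = z from sub_eq_zero.1 h])
  · have hfar : δ / 2 ≤ ‖w - z‖ := by
      have hwz₀ : δ ≤ dist w z₀ := le_of_not_gt fun hlt => hdisj hlt hw
      rw [Metric.mem_ball] at hz
      rw [← dist_eq_norm]
      linarith [dist_triangle w z z₀]
    rw [norm_mul, norm_inv]
    exact mul_le_mul (hM w hw) (inv_anti₀ (half_pos hδ) hfar) (by positivity)
      ((norm_nonneg _).trans (hM w hw))

theorem tendsto_cauchyTransform (hF : ContinuousOn F C.support) :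
    Tendsto (C.cauchyTransform F) (cocompact ℂ) (𝓝 0) := by
  obtain ⟨R, -, hR, -⟩ := C.exists_winding_eq_zero
  obtain ⟨M, hM⟩ := C.isCompact_support.exists_bound_of_continuousOn hF
  obtain ⟨B, -, hB⟩ := C.exists_norm_integral_le
  have hlim : Tendsto (fun z : ℂ => B * (M * (‖z‖ - R)⁻¹)) (cocompact ℂ) (𝓝 0) := by
    simpa [sub_eq_add_neg] using ((tendsto_inv_atTop_zero.comp (tendsto_atTop_add_const_right _ (-R)
      (tendsto_norm_cocompact_atTop (E := ℂ)))).const_mul M).const_mul B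
  refine squeeze_zero_norm' ?_ hlim
  filter_upwards [(tendsto_norm_cocompact_atTop (E := ℂ)).eventually_gt_atTop R] with z hz
  refine hB _ _ fun w hw => ?_
  have hfar : ‖z‖ - R ≤ ‖w - z‖ := by
    have := norm_sub_norm_le z w
    rw [norm_sub_rev] at this
    linarith [hR w hw]
  rw [norm_mul, norm_inv]
  exact mul_le_mul (hM w hw) (inv_anti₀ (sub_pos.2 hz) hfar) (by positivity)
    ((norm_nonneg _).trans (hM w hw))

theorem mul_cauchyTransform (hF : ContinuousOn F C.support) {z : ℂ} (hz : z ∉ C.support) :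
    z * C.cauchyTransform F z = C.cauchyTransform (fun w => F w * w) z - C.integral F := by
  have hinv := continuousOn_inv_sub hz
  rw [cauchyTransform, cauchyTransform, ← integral_const_mul,
    ← integral_sub (F := fun w => F w * w * (w - z)⁻¹) ((hF.mul continuousOn_id).mul hinv) hF]
  refine integral_congr fun w hw => ?_
  have : w - z ≠ 0 := sub_ne_zero.2 fun h => hz (h ▸ hw)
  field_simp
  ring

theorem tendsto_mul_cauchyTransform (hF : ContinuousOn F C.support) :
    Tendsto (fun z => z * C.cauchyTransform F z) (cocompact ℂ) (𝓝 (-C.integral F)) := by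
  have hlim := (tendsto_cauchyTransform (hF.mul continuousOn_id)).sub_const (C.integral F)
  rw [zero_sub] at hlim
  refine hlim.congr' ?_
  filter_upwards [C.isCompact_support.compl_mem_cocompact] with z hz
  exact (mul_cauchyTransform hF hz).symm

theorem integral_dslope_eq_cauchyTransform (hF : ContinuousOn F C.support) {z : ℂ}
    (hz : z ∉ C.support) (hw : C.winding z = 0) :
    C.integral (dslope F z) = C.cauchyTransform F z := by
  have hinv : C.integral (fun w => (w - z)⁻¹) = 0 := by
    rwa [winding, mul_eq_zero, or_iff_right (by simp [Real.pi_ne_zero])] at hw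
  have hcont := continuousOn_inv_sub hz
  calc C.integral (dslope F z)
      = C.integral fun w => F w * (w - z)⁻¹ - F z * (w - z)⁻¹ := by
        refine integral_congr fun w hw => ?_
        have hne : w ≠ z := fun h => hz (h ▸ hw)
        rw [dslope_of_ne _ hne, slope, vsub_eq_sub, smul_eq_mul]
        ring
    _ = C.cauchyTransform F z := by
        rw [integral_sub (F := fun w => F w * (w - z)⁻¹) (G := fun w => F z * (w - z)⁻¹)
          (hF.mul hcont) (continuousOn_const.mul hcont), integral_const_mul, hinv, mul_zero,
          sub_zero, cauchyTransform]

/-- **Cauchy's theorem**, homology form, after Dixon. -/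
theorem integral_eq_zero_of_winding {U : Set ℂ} (hU : IsOpen U) (hC : C.support ⊆ U)
    (hF : DifferentiableOn ℂ F U) (hw : ∀ x ∉ U, C.winding x = 0) : C.integral F = 0 := by
  classical
  have hFC : ContinuousOn F C.support := hF.continuousOn.mono hC
  set h : ℂ → ℂ := fun z => if z ∈ U then C.integral (dslope F z) else C.cauchyTransform F z
    with h_def
  have h_eq {z : ℂ} (hz : z ∉ C.support) (hwz : C.winding z = 0) :
      h z = C.cauchyTransform F z := by
    simp only [h_def]
    split_ifs
    exacts [integral_dslope_eq_cauchyTransform hFC hz hwz, rfl]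
  have h_diff : Differentiable ℂ h := by
    intro z
    by_cases hz : z ∈ U
    · refine (differentiableAt_integral_dslope hU hC hF hz).congr_of_eventuallyEq ?_
      filter_upwards [hU.mem_nhds hz] with y hy using if_pos hy
    · have hzC : z ∉ C.support := fun h => hz (hC h)
      refine (differentiableAt_cauchyTransform hFC hzC).congr_of_eventuallyEq ?_
      obtain ⟨δ, hδ, hball⟩ := exists_ball_winding_eq hzC
      filter_upwards [Metric.ball_mem_nhds z hδ] with y hy
      exact h_eq (hball y hy).1 ((hball y hy).2.trans (hw z hz))
  have h_far : h =ᶠ[cocompact ℂ] C.cauchyTransform F := by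
    obtain ⟨R, -, hR, hR0⟩ := C.exists_winding_eq_zero
    filter_upwards [(tendsto_norm_cocompact_atTop (E := ℂ)).eventually_ge_atTop R] with z hz
    exact h_eq (fun hzC => (hR z hzC).not_ge hz) (hR0 z hz)
  have h_zero (z : ℂ) : h z = 0 :=
    h_diff.apply_eq_of_tendsto_cocompact z ((tendsto_cauchyTransform hFC).congr' h_far.symm)
  have hlim : Tendsto (fun _ : ℂ => (0 : ℂ)) (cocompact ℂ) (𝓝 (-C.integral F)) := by
    refine (tendsto_mul_cauchyTransform hFC).congr' ?_
    filter_upwards [h_far] with z hz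
    rw [← hz, h_zero, mul_zero]
  exact neg_eq_zero.1 (tendsto_nhds_unique hlim tendsto_const_nhds)

theorem winding_sub {C D : Chain} (x : ℂ) : (C.sub D).winding x = C.winding x - D.winding x := by
  simp only [winding, integral_chain_sub, mul_sub]

theorem integral_eq_of_winding_eq {C D : Chain} {U : Set ℂ} (hU : IsOpen U) (hC : C.support ⊆ U)
    (hD : D.support ⊆ U) {F : ℂ → ℂ} (hF : DifferentiableOn ℂ F U)
    (hw : ∀ x ∉ U, C.winding x = D.winding x) : C.integral F = D.integral F := by
  rw [← sub_eq_zero, ← integral_chain_sub]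
  refine integral_eq_zero_of_winding hU ((support_sub_subset C D).trans (union_subset hC hD)) hF
    fun x hx => ?_
  rw [winding_sub, hw x hx, sub_self]

end Chain

/-! ### Existence of separating chains -/

theorem exists_lt_norm_sub {E : Type*} [NormedAddCommGroup E] {S : Set E}
    (hS : ∀ ε > 0, ∀ R : ℝ, {y ∈ S | ε ≤ ‖y‖ ∧ ‖y‖ ≤ R}.Finite) {x : E} (hx : x ≠ 0) :
    ∃ d > 0, d < ‖x‖ ∧ ∀ y ∈ S, y ≠ x → d < ‖y - x‖ := by
  have hx' : 0 < ‖x‖ := norm_pos_iff.2 hx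
  have hopen : IsOpen ({y ∈ S | ‖x‖ / 2 ≤ ‖y‖ ∧ ‖y‖ ≤ 2 * ‖x‖} \ {x})ᶜ :=
    ((hS _ (half_pos hx') _).subset sdiff_subset).isClosed.isOpen_compl
  obtain ⟨ε, hε, hball⟩ := Metric.isOpen_iff.1 hopen x (by simp)
  refine ⟨min (ε / 2) (‖x‖ / 3), by positivity, (min_le_right _ _).trans_lt (by linarith),
    fun y hy hyx => ?_⟩
  by_contra! hle
  have hyε : ‖y - x‖ ≤ ε / 2 := hle.trans (min_le_left _ _)
  have hyx' : ‖y - x‖ ≤ ‖x‖ / 3 := hle.trans (min_le_right _ _)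
  refine hball (a := y) (by rw [Metric.mem_ball, dist_eq_norm]; linarith) ⟨⟨hy, ?_, ?_⟩, hyx⟩
  · have := norm_sub_norm_le x y
    rw [norm_sub_rev] at this
    linarith
  · linarith [norm_sub_norm_le y x]

namespace Chain

/-- The chain of the circles around the points `c ∈ A`, of radius `δ c` and multiplicity `m c`. -/
def circles (A : Finset ℂ) (δ : ℂ → ℝ) (m : ℂ → ℤ) : Chain where
  n := A.card
  mult i := m (A.equivFin.symm i)
  loop i s := circleMap (A.equivFin.symm i) (δ (A.equivFin.symm i)) (2 * Real.pi * s)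
  smooth i := (contDiff_circleMap _ _).comp (contDiff_const.mul contDiff_id)
  closed i := by
    have := periodic_circleMap (A.equivFin.symm i : ℂ) (δ (A.equivFin.symm i)) 0
    rw [mul_zero, mul_one, ← this, zero_add]

theorem integral_circles (A : Finset ℂ) (δ : ℂ → ℝ) (m : ℂ → ℤ) (F : ℂ → ℂ) :
    (circles A δ m).integral F = ∑ c ∈ A, (m c : ℂ) * ∮ z in C(c, δ c), F z := by
  rw [← Finset.sum_coe_sort, ← A.equivFin.symm.sum_comp]
  refine Finset.sum_congr rfl fun i _ => ?_
  simp only [circles]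
  congr 1
  set c : ℂ := ((A.equivFin.symm i : A) : ℂ)
  have hsubst := intervalIntegral.smul_integral_comp_mul_left (a := 0) (b := 1)
    (fun θ => deriv (circleMap c (δ c)) θ • F (circleMap c (δ c) θ)) (2 * Real.pi)
  rw [mul_zero, mul_one] at hsubst
  rw [circleIntegral, ← hsubst, ← intervalIntegral.integral_smul]
  refine intervalIntegral.integral_congr fun s _ => ?_
  have hlin : HasDerivAt (fun s : ℝ => 2 * Real.pi * s) (2 * Real.pi) s := by
    simpa using (hasDerivAt_id s).const_mul (2 * Real.pi)
  have hcircle : HasDerivAt (fun s : ℝ => circleMap c (δ c) (2 * Real.pi * s))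
      ((2 * Real.pi) • deriv (circleMap c (δ c)) (2 * Real.pi * s)) s :=
    (differentiable_circleMap c (δ c) _).hasDerivAt.scomp s hlin
  rw [hcircle.deriv]
  simp only [smul_eq_mul, real_smul]
  ring

theorem loop_circles_ne {A : Finset ℂ} {δ : ℂ → ℝ} {x : ℂ} (hx : ∀ c ∈ A, ‖x - c‖ ≠ |δ c|)
    (m : ℂ → ℤ) (i : Fin (circles A δ m).n) (s : ℝ) : (circles A δ m).loop i s ≠ x := by
  rintro rfl
  exact hx _ (A.equivFin.symm i).2 (by simp [circles])

theorem notMem_support_of_loop_ne {C : Chain} {x : ℂ} (h : ∀ i s, C.loop i s ≠ x) :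
    x ∉ C.support := fun hx => by
  obtain ⟨i, s, -, hs⟩ := mem_iUnion.1 hx
  exact h i s hs

theorem loop_sub_ne {C D : Chain} {x : ℂ} (hC : ∀ i s, C.loop i s ≠ x)
    (hD : ∀ i s, D.loop i s ≠ x) : ∀ i s, (C.sub D).loop i s ≠ x :=
  Fin.addCases (fun i s => by simpa [sub] using hC i s) fun i s => by simpa [sub] using hD i s

theorem winding_circles (A : Finset ℂ) {δ : ℂ → ℝ} (m : ℂ → ℤ) {x : ℂ}
    (hδ : ∀ c ∈ A, 0 < δ c) (hx : ∀ c ∈ A, ‖x - c‖ ≠ δ c) :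
    (circles A δ m).winding x = ∑ c ∈ A, if ‖x - c‖ < δ c then (m c : ℂ) else 0 := by
  rw [winding, integral_circles, Finset.mul_sum]
  refine Finset.sum_congr rfl fun c hc => ?_
  split_ifs with h
  · rw [circleIntegral.integral_sub_inv_of_mem_ball (by rwa [Metric.mem_ball, dist_eq_norm])]
    field_simp [Real.pi_ne_zero]
  · have hlt : δ c < ‖x - c‖ := lt_of_le_of_ne (not_lt.1 h) (hx c hc).symm
    rw [DiffContOnCl.circleIntegral_eq_zero (hδ c hc).le, mul_zero, mul_zero]
    refine DifferentiableOn.diffContOnCl fun z hz => ?_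
    rw [closure_ball _ (hδ c hc).ne', Metric.mem_closedBall, dist_eq_norm] at hz
    have : z - x ≠ 0 := fun h => by
      rw [sub_eq_zero.1 h] at hz
      exact absurd hz (not_le.2 hlt)
    exact ((differentiableAt_id.sub_const x).inv this).differentiableWithinAt

theorem winding_circles_of_isolating [DecidableEq ℂ] {A : Finset ℂ} {δ : ℂ → ℝ}
    (hδ : ∀ c ∈ A, 0 < δ c) (m : ℂ → ℤ) {x : ℂ} (hx : ∀ c ∈ A, x ≠ c → δ c < ‖x - c‖) :
    (circles A δ m).winding x = if x ∈ A then (m x : ℂ) else 0 := by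
  have hlt_iff {c : ℂ} (hc : c ∈ A) : ‖x - c‖ < δ c ↔ x = c := by
    refine ⟨fun h => by_contra fun hxc => lt_asymm h (hx c hc hxc), ?_⟩
    rintro rfl
    simpa using hδ x hc
  rw [winding_circles A m hδ fun c hc => ?_, ← Finset.sum_ite_eq A x fun c => (m c : ℂ)]
  · exact Finset.sum_congr rfl fun c hc => if_congr (hlt_iff hc) rfl rfl
  · rcases eq_or_ne x c with rfl | hxc
    · simpa using (hδ x hc).ne
    · exact (hx c hc hxc).ne'

theorem winding_circles_singleton {ρ : ℝ} (hρ : 0 < ρ) {x : ℂ} (hx : ‖x‖ ≠ ρ) :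
    (circles {0} (fun _ => ρ) fun _ => 1).winding x = if ‖x‖ < ρ then 1 else 0 := by
  rw [winding_circles _ _ (fun _ _ => hρ) (by simpa using hx), Finset.sum_singleton]
  simp

theorem loop_circle_sub_circles_ne {ρ : ℝ} (hρ : 0 < ρ) {A : Finset ℂ} {δ : ℂ → ℝ}
    (hδ : ∀ c ∈ A, 0 < δ c) (m : ℂ → ℤ) {x : ℂ} (hxρ : ‖x‖ ≠ ρ)
    (hx : ∀ c ∈ A, x ≠ c → δ c < ‖x - c‖) :
    ∀ i s, ((circles {0} (fun _ => ρ) fun _ => 1).sub (circles A δ m)).loop i s ≠ x := by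
  refine loop_sub_ne (loop_circles_ne (by simpa [abs_of_pos hρ] using hxρ) _)
    (loop_circles_ne (fun c hc => ?_) _)
  rw [abs_of_pos (hδ c hc)]
  rcases eq_or_ne x c with rfl | hxc
  · simpa using (hδ x hc).ne
  · exact (hx c hc hxc).ne'

theorem winding_circle_sub_circles [DecidableEq ℂ] {ρ : ℝ} (hρ : 0 < ρ) {A : Finset ℂ}
    {δ : ℂ → ℝ} (hδ : ∀ c ∈ A, 0 < δ c) (m : ℂ → ℤ) {x : ℂ} (hxρ : ‖x‖ ≠ ρ)
    (hx : ∀ c ∈ A, x ≠ c → δ c < ‖x - c‖) :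
    ((circles {0} (fun _ => ρ) fun _ => 1).sub (circles A δ m)).winding x =
      (if ‖x‖ < ρ then 1 else 0) - if x ∈ A then (m x : ℂ) else 0 := by
  rw [winding_sub, winding_circles_singleton hρ hxρ, winding_circles_of_isolating hδ m hx]

/-- The separating chain is a circle around the origin, corrected by small circles around the
finitely many points of `Inn` outside it and of `Out` inside it. -/
theorem exists_separates {Inn Out : Set ℂ} (hdis : Disjoint Inn Out) (h0i : (0 : ℂ) ∉ Inn)
    (h0o : (0 : ℂ) ∉ Out) (hin : ∀ ε > 0, {x ∈ Inn | ε ≤ ‖x‖}.Finite)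
    (hout : ∀ R : ℝ, {x ∈ Out | ‖x‖ ≤ R}.Finite) :
    ∃ C : Chain, C.Separates Inn Out ∧ ∀ i s, C.loop i s ≠ 0 := by
  classical
  have hfin (ε : ℝ) (hε : 0 < ε) (R : ℝ) : {x ∈ Inn ∪ Out | ε ≤ ‖x‖ ∧ ‖x‖ ≤ R}.Finite :=
    ((hin ε hε).union (hout R)).subset fun x hx =>
      hx.1.imp (fun h => ⟨h, hx.2.1⟩) fun h => ⟨h, hx.2.2⟩
  obtain ⟨ρ, hρmem, hρfin⟩ :=
    (Icc_infinite (α := ℝ) one_lt_two).exists_notMem_finite ((hfin 1 one_pos 2).image norm)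
  have hρ : 0 < ρ := one_pos.trans_le hρmem.1
  have hρne (x : ℂ) (hx : x ∈ Inn ∪ Out) : ‖x‖ ≠ ρ :=
    fun h => hρfin ⟨x, ⟨hx, by rwa [h]⟩, h⟩
  choose! d hd0 hdx hd using fun x (hx : x ≠ 0) => exists_lt_norm_sub hfin hx
  obtain ⟨A, hA⟩ := ((hin ρ hρ).union (hout ρ)).exists_finset
  have hAsub {c : ℂ} (hc : c ∈ A) : c ∈ Inn ∪ Out := ((hA c).1 hc).imp And.left And.left
  have hAne {c : ℂ} (hc : c ∈ A) : c ≠ 0 := by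
    rintro rfl
    exact (hAsub hc).elim h0i h0o
  set m : ℂ → ℤ := fun c => if c ∈ Inn then -1 else 1 with m_def
  have hδ (c : ℂ) (hc : c ∈ A) : 0 < d c := hd0 c (hAne hc)
  have hloop0 := loop_circle_sub_circles_ne (x := 0) hρ hδ m (by simpa using hρ.ne)
    fun c hc _ => by simpa using hdx c (hAne hc)
  have hisol (x : ℂ) (hx : x ∈ Inn ∪ Out) (c : ℂ) (hc : c ∈ A) : x ≠ c → d c < ‖x - c‖ :=
    hd c (hAne hc) x hx
  have hsupp : Disjoint ((circles {0} (fun _ => ρ) fun _ => 1).sub (circles A d m)).support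
      (Inn ∪ Out) := disjoint_right.2 fun x hx => notMem_support_of_loop_ne <|
    loop_circle_sub_circles_ne hρ hδ m (hρne x hx) (hisol x hx)
  have hwind (x : ℂ) (hx : x ∈ Inn ∪ Out) :=
    winding_circle_sub_circles hρ hδ m (hρne x hx) (hisol x hx)
  rw [disjoint_union_right] at hsupp
  refine ⟨_, ⟨notMem_support_of_loop_ne hloop0, hsupp.1, hsupp.2, fun x hx => ?_,
    fun x hx => ?_⟩, hloop0⟩
  · have hxA : x ∈ A ↔ ¬‖x‖ < ρ := by
      simp [hA, hx, disjoint_left.1 hdis hx]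
    rw [hwind x (Or.inl hx)]
    by_cases h : ‖x‖ < ρ <;> simp [hxA, m_def, h, hx]
  · have hxi : x ∉ Inn := disjoint_right.1 hdis hx
    have hxA : x ∈ A ↔ ‖x‖ < ρ := by
      simp [hA, hx, hxi, (hρne x (Or.inr hx)).le_iff_lt]
    rw [hwind x (Or.inr hx)]
    by_cases h : ‖x‖ < ρ <;> simp [hxA, m_def, h, hxi]

end Chain

/-! ### Analytic properties of the `q`-symbols -/

theorem summable_geometric_prod {ρ σ : ℝ} (hρ0 : 0 ≤ ρ) (hρ : ρ < 1) (hσ0 : 0 ≤ σ) (hσ : σ < 1)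
    (R : ℝ) : Summable fun k : ℕ × ℕ => R * (ρ ^ k.1 * σ ^ k.2) :=
  ((summable_geometric_of_lt_one hρ0 hρ).mul_of_nonneg (summable_geometric_of_lt_one hσ0 hσ)
    (fun _ => pow_nonneg hρ0 _) fun _ => pow_nonneg hσ0 _).mul_left R

variable {p q x : ℂ}

theorem summable_pqPoch (hp : ‖p‖ < 1) (hq : ‖q‖ < 1) (x : ℂ) :
    Summable fun k : ℕ × ℕ => ‖-(x * p ^ k.1 * q ^ k.2)‖ := by
  simpa [mul_assoc] using
    summable_geometric_prod (norm_nonneg p) hp (norm_nonneg q) hq ‖x‖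

theorem multipliable_pqPoch (hp : ‖p‖ < 1) (hq : ‖q‖ < 1) (x : ℂ) :
    Multipliable fun k : ℕ × ℕ => 1 - x * p ^ k.1 * q ^ k.2 := by
  simpa only [sub_eq_add_neg] using multipliable_one_add_of_summable (summable_pqPoch hp hq x)

theorem multipliable_qPoch (hq : ‖q‖ < 1) (x : ℂ) : Multipliable fun k : ℕ => 1 - x * q ^ k := by
  have hsum : Summable fun k : ℕ => ‖-(x * q ^ k)‖ := by
    simpa using (summable_geometric_of_lt_one (norm_nonneg q) hq).mul_left ‖x‖
  simpa only [sub_eq_add_neg] using multipliable_one_add_of_summable hsum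

theorem pqPoch_eq_zero (hp : ‖p‖ < 1) (hq : ‖q‖ < 1) (h : pqPoch x p q = 0) :
    ∃ i j : ℕ, x * p ^ i * q ^ j = 1 := by
  by_contra! hne
  refine tprod_one_add_ne_zero_of_summable (f := fun k : ℕ × ℕ => -(x * p ^ k.1 * q ^ k.2))
    (fun k => ?_) (summable_pqPoch hp hq x) ?_
  · rw [← sub_eq_add_neg]; exact sub_ne_zero.2 (hne k.1 k.2).symm
  · simpa only [← sub_eq_add_neg, pqPoch] using h

theorem pqPoch_comm (x p q : ℂ) : pqPoch x p q = pqPoch x q p := by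
  unfold pqPoch
  rw [← (Equiv.prodComm ℕ ℕ).tprod_eq]
  refine tprod_congr fun k => ?_
  simp only [Equiv.prodComm_apply, Prod.fst_swap, Prod.snd_swap]
  ring

theorem pqPoch_zero_right (x p : ℂ) : pqPoch x p 0 = qPoch x p := by
  have hinj : Function.Injective fun i : ℕ => ((i, 0) : ℕ × ℕ) := fun i j h => by simpa using h
  unfold pqPoch qPoch
  rw [← hinj.tprod_eq]
  · simp
  · rintro ⟨i, j⟩ h
    rcases j with _ | j
    · exact ⟨i, rfl⟩
    · simp at h

theorem pqPoch_zero_middle (x q : ℂ) : pqPoch x 0 q = qPoch x q := by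
  rw [pqPoch_comm, pqPoch_zero_right]

theorem pqPoch_eq_mul_left (hp : ‖p‖ < 1) (hq : ‖q‖ < 1) (x : ℂ) :
    pqPoch x p q = qPoch x q * pqPoch (p * x) p q := by
  let zeroRow : ℕ → ℕ × ℕ := fun j => (0, j)
  let otherRows : ℕ × ℕ → ℕ × ℕ := fun k => (k.1 + 1, k.2)
  have hzero : Function.Injective zeroRow := fun i j h => (Prod.mk.inj h).2
  have hother : Function.Injective otherRows := fun i j h => by
    simp only [otherRows, Prod.mk.injEq, add_left_inj] at h
    exact Prod.ext h.1 h.2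
  have hcompl : IsCompl (range zeroRow) (range otherRows) := by
    rw [isCompl_iff, disjoint_left, codisjoint_iff_le_sup]
    refine ⟨?_, ?_⟩
    · rintro _ ⟨j, rfl⟩ ⟨k, hk⟩
      simp [zeroRow, otherRows] at hk
    · rintro ⟨i, j⟩ -
      rcases i with _ | i
      · exact Or.inl ⟨j, rfl⟩
      · exact Or.inr ⟨(i, j), rfl⟩
  set f : ℕ × ℕ → ℂ := fun k => 1 - x * p ^ k.1 * q ^ k.2 with hf
  have hprod_zero : HasProd (f ∘ zeroRow) (qPoch x q) := by
    simpa [Function.comp_def, hf, zeroRow, qPoch] using (multipliable_qPoch hq x).hasProd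
  have hprod_other : HasProd (f ∘ otherRows) (pqPoch (p * x) p q) := by
    have : HasProd _ (pqPoch (p * x) p q) := (multipliable_pqPoch hp hq (p * x)).hasProd
    convert this using 2 with k
    simp only [Function.comp_apply, hf, otherRows, pow_succ]
    ring
  exact (HasProd.mul_isCompl hcompl (hzero.hasProd_range_iff.2 hprod_zero)
    (hother.hasProd_range_iff.2 hprod_other)).tprod_eq

theorem pqPoch_eq_mul_right (hp : ‖p‖ < 1) (hq : ‖q‖ < 1) (x : ℂ) :
    pqPoch x p q = qPoch x p * pqPoch (q * x) p q := by
  rw [pqPoch_comm, pqPoch_eq_mul_left hq hp, pqPoch_comm]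

theorem qPoch_eq_mul (hp : ‖p‖ < 1) (x : ℂ) : qPoch x p = (1 - x) * qPoch (p * x) p := by
  have hshift (k : ℕ) : 1 - x * p ^ (k + 1) = 1 - p * x * p ^ k := by ring
  rw [qPoch, tprod_eq_zero_mul' (by simpa only [hshift] using multipliable_qPoch hp (p * x))]
  simp only [hshift, pow_zero, mul_one, qPoch]

theorem qPoch_zero_left (q : ℂ) : qPoch 0 q = 1 := by simp [qPoch]

theorem qPoch_zero_right (x : ℂ) : qPoch x 0 = 1 - x := by
  rw [qPoch_eq_mul (by simp), zero_mul, qPoch_zero_left, mul_one]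

theorem qPoch_eq_zero (hq : ‖q‖ < 1) (h : qPoch x q = 0) : ∃ j : ℕ, x * q ^ j = 1 := by
  rw [← pqPoch_zero_right] at h
  obtain ⟨i, j, h⟩ := pqPoch_eq_zero hq (by simp) h
  rcases j with _ | j
  · exact ⟨i, by simpa using h⟩
  · simp at h

theorem qPoch_of_eq_one {j : ℕ} (h : x * q ^ j = 1) : qPoch x q = 0 :=
  tprod_of_exists_eq_zero ⟨j, by rw [h, sub_self]⟩

theorem qPoch_ne_zero_of_pqPoch (hp : ‖p‖ < 1) (hq : ‖q‖ < 1) (h : pqPoch x p q ≠ 0) :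
    qPoch x p ≠ 0 ∧ qPoch x q ≠ 0 :=
  ⟨left_ne_zero_of_mul (pqPoch_eq_mul_right hp hq x ▸ h),
    left_ne_zero_of_mul (pqPoch_eq_mul_left hp hq x ▸ h)⟩

theorem tendstoLocallyUniformlyOn_pqPoch (hq : ‖q‖ < 1) {ρ : ℝ} (hρ0 : 0 ≤ ρ) (hρ : ρ < 1)
    (R : ℝ) : TendstoLocallyUniformlyOn
      (fun (s : Finset (ℕ × ℕ)) (v : ℂ × ℂ) => ∏ k ∈ s, (1 + -(v.1 * v.2 ^ k.1 * q ^ k.2)))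
      (fun v => pqPoch v.1 v.2 q) atTop (Metric.ball 0 R ×ˢ Metric.ball 0 ρ) := by
  have hprod := Summable.hasProdLocallyUniformlyOn_one_add
    (f := fun (k : ℕ × ℕ) (v : ℂ × ℂ) => -(v.1 * v.2 ^ k.1 * q ^ k.2))
    (K := Metric.ball 0 R ×ˢ Metric.ball 0 ρ) (Metric.isOpen_ball.prod Metric.isOpen_ball)
    (summable_geometric_prod hρ0 hρ (norm_nonneg q) hq R) (Eventually.of_forall ?_) ?_
  · simp only [pqPoch, sub_eq_add_neg]
    exact hprod
  · rintro k v ⟨hv₁, hv₂⟩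
    rw [mem_ball_zero_iff] at hv₁ hv₂
    rw [norm_neg, norm_mul, norm_mul, norm_pow, norm_pow, mul_assoc]
    have hR := (norm_nonneg _).trans hv₁.le
    gcongr
  · intro k
    fun_prop

theorem continuousAt_pqPoch (hq : ‖q‖ < 1) (x : ℂ) (hp : ‖p‖ < 1) :
    ContinuousAt (fun v : ℂ × ℂ => pqPoch v.1 v.2 q) (x, p) := by
  obtain ⟨ρ, hpρ, hρ⟩ := exists_between hp
  have hcont := (tendstoLocallyUniformlyOn_pqPoch hq ((norm_nonneg p).trans hpρ.le) hρ
    (‖x‖ + 1)).continuousOn (Eventually.frequently (Eventually.of_forall fun s => by fun_prop))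
  refine hcont.continuousAt (prod_mem_nhds (Metric.isOpen_ball.mem_nhds ?_)
    (Metric.isOpen_ball.mem_nhds ?_))
  · simp
  · simpa using hpρ

theorem continuousAt_qPoch (x : ℂ) (hp : ‖p‖ < 1) :
    ContinuousAt (fun v : ℂ × ℂ => qPoch v.1 v.2) (x, p) := by
  simpa only [pqPoch_zero_right] using continuousAt_pqPoch (q := 0) (by simp) x hp

theorem differentiable_pqPoch (hp : ‖p‖ < 1) (hq : ‖q‖ < 1) :
    Differentiable ℂ fun x => pqPoch x p q := by
  intro x
  obtain ⟨ρ, hpρ, hρ⟩ := exists_between hp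
  have hunif := (tendstoLocallyUniformlyOn_pqPoch hq ((norm_nonneg p).trans hpρ.le) hρ
    (‖x‖ + 1)).comp (fun x : ℂ => (x, p)) (t := Metric.ball 0 (‖x‖ + 1))
    (fun y hy => ⟨hy, by simpa using hpρ⟩) (by fun_prop)
  refine (hunif.differentiableOn (Eventually.of_forall fun s => ?_)
    Metric.isOpen_ball).differentiableAt (Metric.isOpen_ball.mem_nhds (by simp))
  simp only [Function.comp_def]
  fun_prop

theorem differentiable_qPoch (hp : ‖p‖ < 1) : Differentiable ℂ fun x => qPoch x p := by
  simpa only [pqPoch_zero_right] using differentiable_pqPoch (q := 0) hp (by simp)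

/-! ### Functional equations -/

theorem theta_div (hp0 : p ≠ 0) (x : ℂ) : theta (p / x) p = theta x p := by
  rw [theta, theta, div_div_cancel₀ hp0, mul_comm]

theorem theta_mul (hp0 : p ≠ 0) (hp : ‖p‖ < 1) (hx : x ≠ 0) :
    theta (p * x) p = -x⁻¹ * theta x p := by
  rw [theta, theta, qPoch_eq_mul hp x, show p / (p * x) = x⁻¹ by field_simp,
    qPoch_eq_mul hp x⁻¹, ← div_eq_mul_inv]
  field_simp
  ring

theorem theta_inv (hp0 : p ≠ 0) (hp : ‖p‖ < 1) (hx : x ≠ 0) :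
    theta x⁻¹ p = -x⁻¹ * theta x p := by
  rw [← theta_mul hp0 hp hx, ← theta_div hp0 (p * x)]
  congr 1
  field_simp

theorem theta_one (p : ℂ) : theta 1 p = 0 := by
  rw [theta, qPoch_of_eq_one (j := 0) (by simp), zero_mul]

theorem theta_eq_zero (hp0 : p ≠ 0) (hp : ‖p‖ < 1) (hx : x ≠ 0) (h : theta x p = 0) :
    ∃ n : ℤ, x = p ^ n := by
  rcases mul_eq_zero.1 h with h | h
  · obtain ⟨j, h⟩ := qPoch_eq_zero hp h
    refine ⟨-j, ?_⟩
    rw [zpow_neg, zpow_natCast]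
    exact eq_inv_of_mul_eq_one_left h
  · obtain ⟨j, h⟩ := qPoch_eq_zero hp h
    refine ⟨j + 1, ?_⟩
    rw [zpow_add_one₀ hp0, zpow_natCast]
    field_simp at h
    rw [← h]
    ring

theorem differentiableAt_theta (hp : ‖p‖ < 1) (hx : x ≠ 0) :
    DifferentiableAt ℂ (fun x => theta x p) x :=
  (differentiable_qPoch hp x).mul ((differentiable_qPoch hp (p / x)).comp x
    ((differentiableAt_const p).div differentiableAt_id hx))

theorem ellGamma_mul_right (hp : ‖p‖ < 1) (hq : ‖q‖ < 1) (hq0 : q ≠ 0)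
    (h : pqPoch x p q ≠ 0) : ellGamma (q * x) p q = theta x p * ellGamma x p q := by
  have hx : qPoch x p ≠ 0 := (qPoch_ne_zero_of_pqPoch hp hq h).1
  have hshift := pqPoch_eq_mul_right hp hq x
  have hqx : pqPoch (q * x) p q ≠ 0 := right_ne_zero_of_mul (hshift ▸ h)
  rw [ellGamma, ellGamma, theta, hshift, show p * q / (q * x) = p / x by field_simp,
    pqPoch_eq_mul_right hp hq (p / x), show q * (p / x) = p * q / x by ring]
  field_simp [hqx]

theorem ellGamma_comm (x p q : ℂ) : ellGamma x p q = ellGamma x q p := by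
  rw [ellGamma, ellGamma, pqPoch_comm, pqPoch_comm x, mul_comm p q]

theorem ellGamma_mul_left (hp : ‖p‖ < 1) (hq : ‖q‖ < 1) (hp0 : p ≠ 0)
    (h : pqPoch x p q ≠ 0) : ellGamma (p * x) p q = theta x q * ellGamma x p q := by
  rw [ellGamma_comm, ellGamma_mul_right hq hp hp0 (by rwa [pqPoch_comm]), ellGamma_comm]

theorem ellGamma_mul_inv (hp : ‖p‖ < 1) (hq : ‖q‖ < 1)
    (hx : pqPoch x p q ≠ 0) (hx' : pqPoch x⁻¹ p q ≠ 0) :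
    1 / (ellGamma x p q * ellGamma x⁻¹ p q) = theta x q * theta x⁻¹ p := by
  have hfactor : pqPoch x p q = qPoch x q * (qPoch (p * x) p * pqPoch (q * (p * x)) p q) := by
    rw [← pqPoch_eq_mul_right hp hq, ← pqPoch_eq_mul_left hp hq]
  have hfactor' : pqPoch x⁻¹ p q =
      qPoch x⁻¹ p * (qPoch (q * x⁻¹) q * pqPoch (p * (q * x⁻¹)) p q) := by
    rw [← pqPoch_eq_mul_left hp hq, ← pqPoch_eq_mul_right hp hq]
  have hne := right_ne_zero_of_mul (right_ne_zero_of_mul (hfactor ▸ hx))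
  have hne' := right_ne_zero_of_mul (right_ne_zero_of_mul (hfactor' ▸ hx'))
  rw [ellGamma, ellGamma, theta, theta, div_inv_eq_mul, div_inv_eq_mul,
    show p * q / x = p * (q * x⁻¹) by ring, show p * q * x = q * (p * x) by ring, hfactor,
    hfactor', div_eq_mul_inv q x]
  generalize pqPoch (q * (p * x)) p q = A at *
  generalize pqPoch (p * (q * x⁻¹)) p q = B at *
  field_simp

/-! ### The three-term relation for theta functions -/

theorem frequently_notMem_of_countable {E : Set ℂ} (hE : E.Countable) (x : ℂ) :
    ∃ᶠ y in 𝓝 x, y ∉ E :=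
  mem_closure_iff_frequently.1 (hE.dense_compl ℂ x)

theorem eq_of_eq_off_countable {Y : Type*} [TopologicalSpace Y] [T2Space Y] {f g : ℂ → Y} {x : ℂ}
    (hf : ContinuousAt f x) (hg : ContinuousAt g x) {E : Set ℂ} (hE : E.Countable)
    (h : ∀ᶠ y in 𝓝 x, y ∉ E → f y = g y) : f x = g x := by
  by_contra hne
  have hne' : ∀ᶠ y in 𝓝 x, f y ≠ g y := (hf.prodMk hg).eventually
    ((isOpen_ne_fun continuous_fst continuous_snd).mem_nhds hne)
  obtain ⟨y, hyE, hy, hy'⟩ :=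
    ((frequently_notMem_of_countable hE x).and_eventually (hne'.and h)).exists
  exact hy (hy' hyE)

theorem exists_eq_mul_of_simple_zeros {U : Set ℂ} (hU : IsOpen U) {T G : ℂ → ℂ}
    (hT : DifferentiableOn ℂ T U) (hG : DifferentiableOn ℂ G U)
    (h0 : ∀ x ∈ U, T x = 0 → deriv T x ≠ 0 ∧ G x = 0) :
    ∃ Q : ℂ → ℂ, DifferentiableOn ℂ Q U ∧ ∀ x ∈ U, G x = T x * Q x := by
  refine ⟨fun x => if T x = 0 then deriv G x / deriv T x else G x / T x,
    fun x hx => DifferentiableAt.differentiableWithinAt ?_, fun x hx => ?_⟩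
  · have hUx := hU.mem_nhds hx
    by_cases hTx : T x = 0
    · obtain ⟨hT', hGx⟩ := h0 x hx hTx
      have hd {H : ℂ → ℂ} (hH : DifferentiableOn ℂ H U) : DifferentiableAt ℂ (dslope H x) x :=
        ((differentiableOn_dslope hUx).2 hH).differentiableAt hUx
      have hne : dslope T x x ≠ 0 := by rwa [dslope_same]
      refine ((hd hG).div (hd hT) hne).congr_of_eventuallyEq ?_
      filter_upwards [(hd hT).continuousAt.eventually_ne hne] with y hy
      rw [Pi.div_apply]
      rcases eq_or_ne y x with rfl | hyx
      · rw [if_pos hTx, dslope_same, dslope_same]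
      · have hsub := sub_ne_zero.2 hyx
        have hTy : T y = (y - x) * dslope T x y := by
          rw [← smul_eq_mul, sub_smul_dslope, hTx, sub_zero]
        have hGy : G y = (y - x) * dslope G x y := by
          rw [← smul_eq_mul, sub_smul_dslope, hGx, sub_zero]
        rw [if_neg (by rw [hTy]; exact mul_ne_zero hsub hy), hTy, hGy, mul_div_mul_left _ _ hsub]
    · refine ((hG.differentiableAt hUx).div (hT.differentiableAt hUx) hTx).congr_of_eventuallyEq ?_
      filter_upwards [(hT.differentiableAt hUx).continuousAt.eventually_ne hTx] with y hy
      rw [Pi.div_apply, if_neg hy]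
  · by_cases hTx : T x = 0
    · rw [hTx, zero_mul, (h0 x hx hTx).2]
    · simp only [if_neg hTx, mul_div_cancel₀ _ hTx]

theorem zpow_mul_iff {G : Type*} [GroupWithZero G] {q : G} (hq0 : q ≠ 0) {P : G → Prop}
    (h : ∀ x, x ≠ 0 → (P (q * x) ↔ P x)) (n : ℤ) {x : G} (hx : x ≠ 0) : P (q ^ n * x) ↔ P x := by
  have hstep (n : ℤ) : P (q ^ (n + 1) * x) ↔ P (q ^ n * x) := by
    rw [add_comm, zpow_one_add₀ hq0, mul_assoc, h _ (mul_ne_zero (zpow_ne_zero _ hq0) hx)]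
  induction n using Int.induction_on with
  | zero => rw [zpow_zero, one_mul]
  | succ n ih => exact (hstep n).trans ih
  | pred n ih =>
    have hpred := hstep (-(n : ℤ) - 1)
    rw [sub_add_cancel] at hpred
    exact hpred.symm.trans ih

variable {q : ℂ}

theorem hasDerivAt_theta_one (hq : ‖q‖ < 1) :
    HasDerivAt (fun x => theta x q) (-(qPoch q q * qPoch q q)) 1 := by
  have hfactor : (fun x => theta x q) = fun x => (1 - x) * (qPoch (q * x) q * qPoch (q / x) q) := by
    funext x
    rw [theta, qPoch_eq_mul hq x, mul_assoc]
  have hd : DifferentiableAt ℂ (fun x => qPoch (q * x) q * qPoch (q / x) q) 1 :=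
    ((differentiable_qPoch hq _).comp 1 (differentiableAt_id.const_mul q)).mul
      ((differentiable_qPoch hq _).comp 1
        ((differentiableAt_const q).div differentiableAt_id one_ne_zero))
  rw [hfactor]
  exact (HasDerivAt.fun_mul (c := fun x => 1 - x) ((hasDerivAt_id (1 : ℂ)).const_sub 1)
    hd.hasDerivAt).congr_deriv (by simp)

theorem qPoch_self_ne_zero (hq : ‖q‖ < 1) : qPoch q q ≠ 0 := by
  intro h
  obtain ⟨j, hj⟩ := qPoch_eq_zero hq h
  have hnorm : ‖q‖ ^ (j + 1) = 1 := by rw [← norm_pow, pow_succ', hj, norm_one]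
  exact (pow_lt_one₀ (norm_nonneg q) hq (Nat.succ_ne_zero j)).ne hnorm

theorem mul_deriv_theta_mul (hq0 : q ≠ 0) (hq : ‖q‖ < 1) {x : ℂ} (hx : x ≠ 0) :
    q * deriv (fun x => theta x q) (q * x) =
      (x ^ 2)⁻¹ * theta x q - x⁻¹ * deriv (fun x => theta x q) x := by
  have hleft : HasDerivAt (fun y => theta (q * y) q)
      (deriv (fun x => theta x q) (q * x) * q) x :=
    (differentiableAt_theta hq (mul_ne_zero hq0 hx)).hasDerivAt.comp x
      (by simpa using (hasDerivAt_id x).const_mul q)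
  have hright : HasDerivAt (fun y => -y⁻¹ * theta y q)
      (-(-(x ^ 2)⁻¹) * theta x q + -x⁻¹ * deriv (fun x => theta x q) x) x :=
    (hasDerivAt_inv hx).neg.mul (differentiableAt_theta hq hx).hasDerivAt
  have heq : (fun y => theta (q * y) q) =ᶠ[𝓝 x] fun y => -y⁻¹ * theta y q := by
    filter_upwards [isOpen_ne.mem_nhds hx] with y hy using theta_mul hq0 hq hy
  linear_combination hleft.unique (hright.congr_of_eventuallyEq heq)

theorem theta_zpow (hq0 : q ≠ 0) (hq : ‖q‖ < 1) (n : ℤ) :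
    theta (q ^ n) q = 0 ∧ deriv (fun x => theta x q) (q ^ n) ≠ 0 := by
  rw [← mul_one (q ^ n)]
  refine (zpow_mul_iff hq0
    (P := fun x => theta x q = 0 ∧ deriv (fun x => theta x q) x ≠ 0) (fun x hx => ?_) n
    one_ne_zero).2 ⟨theta_one q, ?_⟩
  · have hzero : theta (q * x) q = 0 ↔ theta x q = 0 := by
      rw [theta_mul hq0 hq hx, mul_eq_zero, or_iff_right (by simpa using hx)]
    rw [hzero]
    refine and_congr_right fun hθ => ?_
    have hderiv := mul_deriv_theta_mul hq0 hq hx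
    rw [hθ, mul_zero, zero_sub] at hderiv
    rw [← mul_ne_zero_iff_left hq0, hderiv, neg_ne_zero, mul_ne_zero_iff_left (inv_ne_zero hx)]
  · rw [(hasDerivAt_theta_one hq).deriv]
    simpa using qPoch_self_ne_zero hq

theorem theta_zpow_mul_eq_zero_iff (hq0 : q ≠ 0) (hq : ‖q‖ < 1) (n : ℤ) {x : ℂ} (hx : x ≠ 0) :
    theta (q ^ n * x) q = 0 ↔ theta x q = 0 :=
  zpow_mul_iff hq0 (P := fun x => theta x q = 0) (fun y hy => by
    rw [theta_mul hq0 hq hy, mul_eq_zero, or_iff_right (by simpa using hy)]) n hx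

theorem differentiableAt_theta_const_mul (hq : ‖q‖ < 1) {c x : ℂ} (hc : c ≠ 0) (hx : x ≠ 0) :
    DifferentiableAt ℂ (fun x => theta (c * x) q) x :=
  (differentiableAt_theta hq (mul_ne_zero hc hx)).comp x (differentiableAt_id.const_mul c)

theorem exists_eq_theta_mul (hq0 : q ≠ 0) (hq : ‖q‖ < 1) {G : ℂ → ℂ} {c : ℂ} (hc : c ≠ 0)
    (hG : DifferentiableOn ℂ G {0}ᶜ) (hG0 : ∀ n : ℤ, G (q ^ n * c⁻¹) = 0) :
    ∃ Q : ℂ → ℂ, DifferentiableOn ℂ Q {0}ᶜ ∧ ∀ x, x ≠ 0 → G x = theta (c * x) q * Q x := by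
  refine exists_eq_mul_of_simple_zeros isOpen_compl_singleton
    (fun x hx => (differentiableAt_theta_const_mul hq hc hx).differentiableWithinAt) hG
    fun x hx h => ?_
  obtain ⟨n, hn⟩ := theta_eq_zero hq0 hq (mul_ne_zero hc hx) h
  constructor
  · rw [deriv_comp_mul_left c (fun x => theta x q), hn]
    exact smul_ne_zero hc (theta_zpow hq0 hq n).2
  · rw [← hG0 n, ← hn]
    field_simp

theorem eq_of_periodic (hq0 : q ≠ 0) (hq : ‖q‖ < 1) {Q : ℂ → ℂ} (hQ : DifferentiableOn ℂ Q {0}ᶜ)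
    (hper : ∀ x, x ≠ 0 → Q (q * x) = Q x) {x y : ℂ} (hx : x ≠ 0) (hy : y ≠ 0) : Q x = Q y := by
  have hd {z : ℂ} (hz : z ≠ 0) : DifferentiableAt ℂ Q z :=
    hQ.differentiableAt (isOpen_compl_singleton.mem_nhds hz)
  have hq0' : 0 < ‖q‖ := norm_pos_iff.2 hq0
  have hannulus : IsCompact {z : ℂ | ‖q‖ ≤ ‖z‖ ∧ ‖z‖ ≤ 1} := by
    refine (isCompact_closedBall (0 : ℂ) 1).of_isClosed_subset ?_ fun z hz => by simpa using hz.2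
    exact (isClosed_le continuous_const continuous_norm).inter
      (isClosed_le continuous_norm continuous_const)
  obtain ⟨M, hM⟩ := hannulus.exists_bound_of_continuousOn (f := Q) fun z hz =>
    (hd (norm_pos_iff.1 (hq0'.trans_le hz.1))).continuousAt.continuousWithinAt
  have hbound (z : ℂ) (hz : z ≠ 0) : ‖Q z‖ ≤ M := by
    obtain ⟨n, -, hlt, hle, -⟩ := rescale_to_shell_zpow (c := q⁻¹)
      (by rw [norm_inv]; exact (one_lt_inv₀ hq0').2 hq) one_pos hz
    rw [norm_inv, one_div, inv_inv] at hle
    rw [inv_zpow', smul_eq_mul] at hlt hle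
    rw [← (zpow_mul_iff hq0 (P := fun y => Q y = Q z) (fun y hy => by rw [hper y hy])
      (-n) hz).2 rfl]
    exact hM _ ⟨hle, hlt.le⟩
  have hentire : Differentiable ℂ fun u => Q (exp u) := fun u =>
    (hd (exp_ne_zero u)).comp u differentiable_exp.differentiableAt
  have := hentire.apply_eq_apply_of_bounded
    (isBounded_iff_forall_norm_le.2 ⟨M, by rintro _ ⟨u, rfl⟩; exact hbound _ (exp_ne_zero u)⟩)
    (log x) (log y)
  simpa [exp_log hx, exp_log hy] using this

theorem countable_theta_eq_zero (hq0 : q ≠ 0) (hq : ‖q‖ < 1) {c : ℂ} (hc : c ≠ 0) :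
    {x : ℂ | theta (c * x) q = 0}.Countable := by
  refine ((countable_range fun n : ℤ => c⁻¹ * q ^ n).insert 0).mono fun x hx => ?_
  rcases eq_or_ne x 0 with rfl | hx0
  · exact mem_insert _ _
  · obtain ⟨n, hn⟩ := theta_eq_zero hq0 hq (mul_ne_zero hc hx0) hx
    refine Or.inr ⟨n, ?_⟩
    simp only [← hn]
    field_simp

theorem quotient_periodic_of_quasiperiodic (hq0 : q ≠ 0) (hq : ‖q‖ < 1) {D Q : ℂ → ℂ} {u v : ℂ}
    (hu : u ≠ 0) (hv : v ≠ 0) (hper : ∀ x, x ≠ 0 → D (q * x) = u * v / x ^ 2 * D x)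
    (hQ : DifferentiableOn ℂ Q {0}ᶜ)
    (hDQ : ∀ x, x ≠ 0 → D x = theta (u⁻¹ * x) q * theta (v⁻¹ * x) q * Q x) {y : ℂ} (hy : y ≠ 0) :
    Q (q * y) = Q y := by
  have hu' := inv_ne_zero hu
  have hv' := inv_ne_zero hv
  have hQcont {y : ℂ} (hy : y ≠ 0) : ContinuousAt Q y :=
    (hQ.differentiableAt (isOpen_compl_singleton.mem_nhds hy)).continuousAt
  refine eq_of_eq_off_countable (f := fun x => Q (q * x))
    ((hQcont (mul_ne_zero hq0 hy)).comp (f := fun x => q * x) (continuous_const_mul q).continuousAt)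
    (hQcont hy)
    ((countable_theta_eq_zero hq0 hq hu').union (countable_theta_eq_zero hq0 hq hv')) ?_
  filter_upwards [isOpen_ne.mem_nhds hy] with z hz hzE
  simp only [mem_union, mem_ofPred_eq, not_or] at hzE
  have hDz := hper z hz
  rw [hDQ _ (mul_ne_zero hq0 hz), hDQ z hz, mul_left_comm, theta_mul hq0 hq (mul_ne_zero hu' hz),
    mul_left_comm, theta_mul hq0 hq (mul_ne_zero hv' hz)] at hDz
  refine mul_left_cancel₀ (mul_ne_zero hzE.1 hzE.2) ?_
  field_simp at hDz ⊢
  exact hDz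

/-- A theta function of degree two with one zero more than the degree allows vanishes. -/
theorem eq_zero_of_quasiperiodic (hq0 : q ≠ 0) (hq : ‖q‖ < 1) {D : ℂ → ℂ} {u v w : ℂ}
    (hu : u ≠ 0) (hv : v ≠ 0) (hw : w ≠ 0) (hD : DifferentiableOn ℂ D {0}ᶜ)
    (hper : ∀ x, x ≠ 0 → D (q * x) = u * v / x ^ 2 * D x) (hDu : D u = 0) (hDv : D v = 0)
    (hDw : D w = 0) (huv : theta (u⁻¹ * v) q ≠ 0) (huw : theta (u⁻¹ * w) q ≠ 0)
    (hvw : theta (v⁻¹ * w) q ≠ 0) {x : ℂ} (hx : x ≠ 0) : D x = 0 := by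
  have hu' := inv_ne_zero hu
  have hv' := inv_ne_zero hv
  have hzeros {y : ℂ} (hy : y ≠ 0) (hDy : D y = 0) (n : ℤ) : D (q ^ n * y) = 0 :=
    (zpow_mul_iff hq0 (P := fun x => D x = 0) (fun x hx => by
      rw [hper x hx, mul_eq_zero, or_iff_right (by positivity)]) n hy).2 hDy
  obtain ⟨Q₁, hQ₁, hDQ₁⟩ := exists_eq_theta_mul hq0 hq hu' hD fun n => by
    rw [inv_inv]; exact hzeros hu hDu n
  obtain ⟨Q, hQ, hQ₁Q⟩ := exists_eq_theta_mul hq0 hq hv' hQ₁ fun n => by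
    rw [inv_inv]
    have hDn := hDQ₁ _ (mul_ne_zero (zpow_ne_zero n hq0) hv)
    rw [hzeros hv hDv n, mul_left_comm, zero_eq_mul] at hDn
    refine hDn.resolve_left ?_
    rwa [theta_zpow_mul_eq_zero_iff hq0 hq n (mul_ne_zero hu' hv)]
  have hDQ (y : ℂ) (hy : y ≠ 0) : D y = theta (u⁻¹ * y) q * theta (v⁻¹ * y) q * Q y := by
    rw [hDQ₁ y hy, hQ₁Q y hy, mul_assoc]
  have hQper (y : ℂ) (hy : y ≠ 0) : Q (q * y) = Q y :=
    quotient_periodic_of_quasiperiodic hq0 hq hu hv hper hQ hDQ hy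
  have hQw : Q w = 0 := by
    rw [hDQ w hw, mul_eq_zero] at hDw
    exact hDw.resolve_left (mul_ne_zero huw hvw)
  rw [hDQ x hx, eq_of_periodic hq0 hq hQ hQper hx hw, hQw, mul_zero]

section ThreeTerm

/-- The difference of the two sides of `theta_three_term`, with the last theta factors inverted by
`θ(q/x;q) = θ(x;q)` so that it is visibly a theta function of `W`. -/
def threeTermDefect (q A B z W : ℂ) : ℂ :=
  theta (z ^ 2) q * theta (A * B) q * theta (A * W) q * theta (B * W) q -
    theta (A * z) q * theta (B * z) q * theta (z * W) q * theta (A * B / z * W) q +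
    z ^ 2 * (theta (A * z⁻¹) q * theta (B * z⁻¹) q * theta (z⁻¹ * W) q * theta (A * B * z * W) q)

variable {A B z : ℂ}

theorem differentiableOn_threeTermDefect (hq : ‖q‖ < 1) (hA : A ≠ 0) (hB : B ≠ 0) (hz : z ≠ 0) :
    DifferentiableOn ℂ (threeTermDefect q A B z) {0}ᶜ := by
  intro x hx
  have hd {c : ℂ} (hc : c ≠ 0) := differentiableAt_theta_const_mul hq hc hx
  have hAB := mul_ne_zero hA hB
  exact (((((hd hA).const_mul _).mul (hd hB)).sub
    (((hd hz).const_mul _).mul (hd (div_ne_zero hAB hz)))).add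
    ((((hd (inv_ne_zero hz)).const_mul _).mul
      (hd (mul_ne_zero hAB hz))).const_mul _)).differentiableWithinAt

theorem threeTermDefect_mul (hq0 : q ≠ 0) (hq : ‖q‖ < 1) (hA : A ≠ 0) (hB : B ≠ 0) (hz : z ≠ 0)
    {x : ℂ} (hx : x ≠ 0) : threeTermDefect q A B z (q * x) =
      z⁻¹ * (z / (A * B)) / x ^ 2 * threeTermDefect q A B z x := by
  have hmul {c : ℂ} (hc : c ≠ 0) : theta (c * (q * x)) q = -(c * x)⁻¹ * theta (c * x) q := by
    rw [mul_left_comm, theta_mul hq0 hq (mul_ne_zero hc hx)]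
  have hAB := mul_ne_zero hA hB
  simp only [threeTermDefect]
  rw [hmul hA, hmul hB, hmul hz, hmul (div_ne_zero hAB hz), hmul (inv_ne_zero hz),
    hmul (mul_ne_zero hAB hz)]
  field_simp

theorem threeTermDefect_self (hz : z ≠ 0) : threeTermDefect q A B z z = 0 := by
  simp only [threeTermDefect]
  rw [inv_mul_cancel₀ hz, theta_one, div_mul_cancel₀ _ hz, ← pow_two]
  ring

theorem threeTermDefect_inv (hq0 : q ≠ 0) (hq : ‖q‖ < 1) (hz : z ≠ 0) :
    threeTermDefect q A B z z⁻¹ = 0 := by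
  simp only [threeTermDefect]
  rw [mul_inv_cancel₀ hz, theta_one, show z⁻¹ * z⁻¹ = (z ^ 2)⁻¹ by rw [pow_two, mul_inv],
    theta_inv hq0 hq (pow_ne_zero 2 hz), mul_inv_cancel_right₀ hz]
  field_simp
  ring

theorem threeTermDefect_div (hq0 : q ≠ 0) (hq : ‖q‖ < 1) (hA : A ≠ 0) (hB : B ≠ 0) (hz : z ≠ 0) :
    threeTermDefect q A B z (z / (A * B)) = 0 := by
  have hz' := inv_ne_zero hz
  simp only [threeTermDefect]
  rw [show A * B / z * (z / (A * B)) = 1 by field_simp, theta_one,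
    show z⁻¹ * (z / (A * B)) = (A * B)⁻¹ by field_simp, theta_inv hq0 hq (mul_ne_zero hA hB),
    show A * B * z * (z / (A * B)) = z ^ 2 by field_simp,
    show A * (z / (A * B)) = (B * z⁻¹)⁻¹ by field_simp,
    show B * (z / (A * B)) = (A * z⁻¹)⁻¹ by field_simp,
    theta_inv hq0 hq (mul_ne_zero hA hz'), theta_inv hq0 hq (mul_ne_zero hB hz')]
  field_simp
  ring

theorem theta_three_term (hq0 : q ≠ 0) (hq : ‖q‖ < 1) {W : ℂ} (hA : A ≠ 0) (hB : B ≠ 0)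
    (hz : z ≠ 0) (hW : W ≠ 0) (hAB : theta (A * B) q ≠ 0) (hzz : theta (z ^ 2) q ≠ 0)
    (hzAB : theta (z ^ 2 / (A * B)) q ≠ 0) :
    theta (z ^ 2) q * theta (A * B) q * theta (A * W) q * theta (B * W) q =
      theta (A * z) q * theta (B * z) q * theta (W * z) q * theta (q * z / (A * B * W)) q -
      z ^ 2 * (theta (A * z⁻¹) q * theta (B * z⁻¹) q * theta (W * z⁻¹) q *
        theta (q * z⁻¹ / (A * B * W)) q) := by
  have hdefect : threeTermDefect q A B z W = 0 :=
    eq_zero_of_quasiperiodic hq0 hq (inv_ne_zero hz) (div_ne_zero hz (mul_ne_zero hA hB)) hz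
      (differentiableOn_threeTermDefect hq hA hB hz)
      (fun x hx => threeTermDefect_mul hq0 hq hA hB hz hx) (threeTermDefect_inv hq0 hq hz)
      (threeTermDefect_div hq0 hq hA hB hz) (threeTermDefect_self hz)
      (by rwa [inv_inv, mul_div_assoc', ← pow_two]) (by rwa [inv_inv, ← pow_two])
      (by rwa [inv_div, div_mul_cancel₀ _ hz]) hW
  rw [← theta_div hq0 (q * z / (A * B * W)), ← theta_div hq0 (q * z⁻¹ / (A * B * W)),
    show q / (q * z / (A * B * W)) = A * B / z * W by field_simp,
    show q / (q * z⁻¹ / (A * B * W)) = A * B * z * W by field_simp, mul_comm W z, mul_comm W z⁻¹]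
  rw [threeTermDefect] at hdefect
  linear_combination hdefect

end ThreeTerm

/-! ### The lattice of zeros and poles -/

/-- The multiplicative lattice `p^ℤ q^ℤ`, together with `0`. -/
def nomeLattice (p q : ℂ) : Set ℂ := insert 0 (range fun n : ℤ × ℤ => p ^ n.1 * q ^ n.2)

variable {p q x : ℂ}

theorem countable_nomeLattice (p q : ℂ) : (nomeLattice p q).Countable :=
  (countable_range _).insert 0

theorem ne_zero_of_notMem_nomeLattice (h : x ∉ nomeLattice p q) : x ≠ 0 :=
  fun h0 => h (Or.inl h0)

theorem inv_mem_nomeLattice : x⁻¹ ∈ nomeLattice p q ↔ x ∈ nomeLattice p q := by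
  have hinv (x : ℂ) : x ∈ nomeLattice p q → x⁻¹ ∈ nomeLattice p q := by
    rintro (rfl | ⟨n, rfl⟩)
    · exact Or.inl inv_zero
    · exact Or.inr ⟨-n, by simp [mul_comm]⟩
  exact ⟨fun h => inv_inv x ▸ hinv _ h, hinv x⟩

theorem div_pow_mem_nomeLattice (hq0 : q ≠ 0) (k : ℕ) :
    x / q ^ k ∈ nomeLattice p q ↔ x ∈ nomeLattice p q := by
  have hk := pow_ne_zero k hq0
  constructor
  · rintro (h | ⟨n, h⟩)
    · exact Or.inl ((div_eq_zero_iff.1 h).resolve_right hk)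
    · refine Or.inr ⟨(n.1, n.2 + k), ?_⟩
      simp only [zpow_add₀ hq0, zpow_natCast, ← mul_assoc] at h ⊢
      rw [h]
      field_simp
  · rintro (rfl | ⟨n, rfl⟩)
    · exact Or.inl (zero_div _)
    · refine Or.inr ⟨(n.1, n.2 - k), ?_⟩
      simp only [zpow_sub₀ hq0, zpow_natCast]
      field_simp

theorem pqPoch_ne_zero (hp : ‖p‖ < 1) (hq : ‖q‖ < 1) (h : x ∉ nomeLattice p q) :
    pqPoch x p q ≠ 0 := by
  intro h0
  obtain ⟨i, j, hij⟩ := pqPoch_eq_zero hp hq h0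
  refine h (inv_mem_nomeLattice.1 (Or.inr ⟨(i, j), ?_⟩))
  simp only [zpow_natCast]
  rw [mul_assoc] at hij
  exact eq_inv_of_mul_eq_one_right hij

theorem theta_ne_zero_left (hp0 : p ≠ 0) (hp : ‖p‖ < 1) (h : x ∉ nomeLattice p q) :
    theta x p ≠ 0 := by
  intro h0
  obtain ⟨n, hn⟩ := theta_eq_zero hp0 hp (ne_zero_of_notMem_nomeLattice h) h0
  exact h (Or.inr ⟨(n, 0), by simp [hn]⟩)

theorem theta_ne_zero_right (hq0 : q ≠ 0) (hq : ‖q‖ < 1) (h : x ∉ nomeLattice p q) :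
    theta x q ≠ 0 := by
  intro h0
  obtain ⟨n, hn⟩ := theta_eq_zero hq0 hq (ne_zero_of_notMem_nomeLattice h) h0
  exact h (Or.inr ⟨(0, n), by simp [hn]⟩)

/-! ### Shifting the arguments of theta and gamma functions -/

theorem thetaFin_div (hp0 : p ≠ 0) (hq0 : q ≠ 0) {T z : ℂ} (hT : T ≠ 0) (hz : z ≠ 0) (m : ℕ) :
    thetaFin (p * q * z / T) q p m = ∏ k ∈ Finset.range m, theta (T * z⁻¹ / q ^ (k + 1)) p := by
  refine Finset.prod_congr rfl fun k _ => ?_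
  rw [← theta_div hp0 (T * z⁻¹ / q ^ (k + 1))]
  congr 1
  rw [pow_succ']
  field_simp

theorem ellGamma_eq_prod_theta (hp : ‖p‖ < 1) (hq0 : q ≠ 0) (hq : ‖q‖ < 1) (m : ℕ)
    (h : pqPoch (x / q ^ m) p q ≠ 0) : ellGamma x p q =
      (∏ k ∈ Finset.range m, theta (x / q ^ (k + 1)) p) * ellGamma (x / q ^ m) p q := by
  induction m with
  | zero => simp
  | succ m ih =>
    have hshift : x / q ^ m = q * (x / q ^ (m + 1)) := by
      rw [pow_succ]
      field_simp
    have hpole : pqPoch (x / q ^ m) p q ≠ 0 := by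
      rw [hshift]
      exact right_ne_zero_of_mul (pqPoch_eq_mul_right hp hq _ ▸ h)
    rw [ih hpole, hshift, ellGamma_mul_right hp hq hq0 h, Finset.prod_range_succ, mul_assoc]

theorem exists_prod_theta_mul (hp0 : p ≠ 0) (hp : ‖p‖ < 1) (hq0 : q ≠ 0) {ε : ℂ}
    (hε : ε = 1 ∨ ε = p) (m : ℕ) : ∃ M : ℂ → ℂ, (∀ x, x ≠ 0 → DifferentiableAt ℂ M x) ∧
      ∀ x, x ≠ 0 → ∏ k ∈ Finset.range m, theta (ε * x / q ^ (k + 1)) p =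
        M x * ∏ k ∈ Finset.range m, theta (x / q ^ (k + 1)) p := by
  rcases hε with rfl | rfl
  · exact ⟨fun _ => 1, fun x _ => differentiableAt_const _, fun x _ => by simp⟩
  · have hne (k : ℕ) {x : ℂ} (hx : x ≠ 0) : x / q ^ (k + 1) ≠ 0 :=
      div_ne_zero hx (pow_ne_zero _ hq0)
    refine ⟨fun x => ∏ k ∈ Finset.range m, -(x / q ^ (k + 1))⁻¹, fun x hx => ?_, fun x hx => ?_⟩
    · refine DifferentiableAt.fun_finsetProd fun k _ => ?_
      have hdiv : DifferentiableAt ℂ (fun x => x / q ^ (k + 1)) x := differentiableAt_id.div_const _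
      exact (hdiv.fun_inv (hne k hx)).fun_neg
    · rw [← Finset.prod_mul_distrib]
      refine Finset.prod_congr rfl fun k _ => ?_
      rw [mul_div_assoc, theta_mul hp0 hp (hne k hx)]

theorem differentiableAt_ellGamma (hp : ‖p‖ < 1) (hq : ‖q‖ < 1) (hx : x ≠ 0)
    (h : pqPoch x p q ≠ 0) : DifferentiableAt ℂ (fun x => ellGamma x p q) x :=
  ((differentiable_pqPoch hp hq _).comp x
    ((differentiableAt_const (p * q)).div differentiableAt_id hx)).div
      (differentiable_pqPoch hp hq x) h

theorem thetaFin_mul_thetaFin_inv_ne_zero (hp0 : p ≠ 0) (hp : ‖p‖ < 1) (hq0 : q ≠ 0) {T z : ℂ}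
    (hT : T ≠ 0) (hz : z ≠ 0) (h : T * z ∉ nomeLattice p q) (h' : T * z⁻¹ ∉ nomeLattice p q)
    (m : ℕ) : thetaFin (p * q * z / T) q p m * thetaFin (p * q * z⁻¹ / T) q p m ≠ 0 := by
  rw [thetaFin_div hp0 hq0 hT hz, thetaFin_div hp0 hq0 hT (inv_ne_zero hz), inv_inv]
  exact mul_ne_zero
    (Finset.prod_ne_zero_iff.2 fun k _ =>
      theta_ne_zero_left hp0 hp ((div_pow_mem_nomeLattice hq0 _).not.2 h'))
    (Finset.prod_ne_zero_iff.2 fun k _ =>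
      theta_ne_zero_left hp0 hp ((div_pow_mem_nomeLattice hq0 _).not.2 h))

/-- Shifting `T` by `q^{-m}` trades the first poles in `q` of the gamma factors for the zeros of the
theta factors. -/
theorem exists_ellGamma_mul_eq (hp0 : p ≠ 0) (hp : ‖p‖ < 1) (hq0 : q ≠ 0) (hq : ‖q‖ < 1) {T ε : ℂ}
    (hT : T ≠ 0) (hε : ε = 1 ∨ ε = p) (m : ℕ) : ∃ R : ℂ → ℂ, ∀ z, z ≠ 0 →
      pqPoch (ε * (T / q ^ m) * z) p q ≠ 0 → pqPoch (T / q ^ m * z⁻¹) p q ≠ 0 →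
        DifferentiableAt ℂ R z ∧ ellGamma (ε * T * z) p q * ellGamma (T * z⁻¹) p q =
          thetaFin (p * q * z / T) q p m * thetaFin (p * q * z⁻¹ / T) q p m * R z := by
  obtain ⟨M, hM, hprod⟩ := exists_prod_theta_mul hp0 hp hq0 hε m
  have hε0 : ε ≠ 0 := by rcases hε with rfl | rfl <;> simp [hp0]
  have hT' : T / q ^ m ≠ 0 := div_ne_zero hT (pow_ne_zero _ hq0)
  refine ⟨fun z => M (T * z) * (ellGamma (ε * (T / q ^ m) * z) p q *
    ellGamma (T / q ^ m * z⁻¹) p q), fun z hz hpole hpole' => ⟨?_, ?_⟩⟩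
  · refine .mul ?_ (.mul ?_ ?_)
    · exact (hM _ (mul_ne_zero hT hz)).comp z (differentiableAt_id.const_mul _)
    · exact (differentiableAt_ellGamma hp hq (mul_ne_zero (mul_ne_zero hε0 hT') hz) hpole).comp z
        (differentiableAt_id.const_mul _)
    · exact (differentiableAt_ellGamma hp hq (mul_ne_zero hT' (inv_ne_zero hz)) hpole').comp z
        ((differentiableAt_inv hz).const_mul _)
  · have harg : ε * (T / q ^ m) * z = ε * (T * z) / q ^ m := by ring
    have harg' : T / q ^ m * z⁻¹ = T * z⁻¹ / q ^ m := by ring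
    rw [harg] at hpole
    rw [harg'] at hpole'
    rw [thetaFin_div hp0 hq0 hT hz, thetaFin_div hp0 hq0 hT (inv_ne_zero hz), inv_inv, mul_assoc ε,
      ellGamma_eq_prod_theta hp hq0 hq m hpole, ellGamma_eq_prod_theta hp hq0 hq m hpole',
      hprod _ (mul_ne_zero hT hz)]
    simp only [harg, harg']
    ring

/-! ### The regularised integrand -/

/-- The pole condition in the definition of `A(u;p,q)`, with pole order `m`. -/
def HasPoleOrder (u p q : ℂ) (m : ℕ) (f : ℂ → ℂ) : Prop :=
  ∃ h : ℂ → ℂ, DifferentiableOn ℂ h {0}ᶜ ∧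
    ∀ z, z ≠ 0 → thetaFin (p * q * z / u) q p m * thetaFin (p * q * z⁻¹ / u) q p m ≠ 0 →
      h z = thetaFin (p * q * z / u) q p m * thetaFin (p * q * z⁻¹ / u) q p m * f z

/-- The number of steps by which the parameter with index `r` is shifted. -/
def shiftOrder (mf mg : ℕ) (r : Fin 6) : ℕ := if r = 4 then mf else if r = 5 then mg else 0

theorem shifted_eq (q : ℂ) (mf mg : ℕ) (T : Fin 6 → ℂ) (r : Fin 6) :
    shifted q mf mg T r = T r / q ^ shiftOrder mf mg r := by
  unfold shifted shiftOrder
  split_ifs with h4 h5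
  · rw [h4]
  · rw [h5]
  · simp

theorem shifted_ne_zero (hq0 : q ≠ 0) {t : Fin 6 → ℂ} (ht : ∀ r, t r ≠ 0) (mf mg : ℕ) (r : Fin 6) :
    shifted q mf mg t r ≠ 0 := by
  rw [shifted_eq]
  exact div_ne_zero (ht r) (pow_ne_zero _ hq0)

theorem prod_shiftOrder {M : Type*} [CommMonoid M] (φ : Fin 6 → ℕ → M) (hφ : ∀ r, φ r 0 = 1)
    (mf mg : ℕ) : ∏ r, φ r (shiftOrder mf mg r) = φ 4 mf * φ 5 mg := by
  simp [Fin.prod_univ_six, shiftOrder, hφ]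

/-- The domain on which the regularised integrand is holomorphic. -/
def regularDomain (τ ε : Fin 6 → ℂ) (p q : ℂ) : Set ℂ :=
  {z | z ≠ 0 ∧ ∀ r, pqPoch (ε r * τ r * z) p q ≠ 0 ∧ pqPoch (τ r * z⁻¹) p q ≠ 0}

/-- The weight obtained from the integrand by breaking the symmetry `z ↦ 1/z`. In the application
`ε r = p` for `r = a, b` and `ε r = 1` otherwise. -/
def brokenWeight (T ε : Fin 6 → ℂ) (p q : ℂ) (a b : Fin 6) (W z : ℂ) : ℂ :=
  (∏ r, ellGamma (ε r * T r * z) p q * ellGamma (T r * z⁻¹) p q) * theta ((z ^ 2)⁻¹) p *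
    (theta (W * z) q * theta (q * z / (T a * T b * W)) q)

theorem isOpen_regularDomain (hp : ‖p‖ < 1) (hq : ‖q‖ < 1) (τ ε : Fin 6 → ℂ) :
    IsOpen (regularDomain τ ε p q) := by
  rw [isOpen_iff_mem_nhds]
  rintro z ⟨hz, h⟩
  have hcont := (differentiable_pqPoch hp hq).continuous
  have hleft (r : Fin 6) : ∀ᶠ y in 𝓝 z, pqPoch (ε r * τ r * y) p q ≠ 0 :=
    (hcont.comp (continuous_const_mul (ε r * τ r))).continuousAt.eventually_ne (h r).1
  have hright (r : Fin 6) : ∀ᶠ y in 𝓝 z, pqPoch (τ r * y⁻¹) p q ≠ 0 :=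
    (ContinuousAt.comp (f := fun y => τ r * y⁻¹) hcont.continuousAt
      (continuousAt_const.mul (continuousAt_inv₀ hz))).eventually_ne (h r).2
  filter_upwards [isOpen_ne.mem_nhds hz, eventually_all.2 hleft, eventually_all.2 hright]
    with y hy hyleft hyright using ⟨hy, fun r => ⟨hyleft r, hyright r⟩⟩

theorem differentiableAt_breakingFactor (hp : ‖p‖ < 1) (hq0 : q ≠ 0) (hq : ‖q‖ < 1) {c W z : ℂ}
    (hc : c ≠ 0) (hW : W ≠ 0) (hz : z ≠ 0) :
    DifferentiableAt ℂ (fun z => theta ((z ^ 2)⁻¹) p *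
      (theta (W * z) q * theta (q * z / (c * W)) q)) z := by
  have hsq := pow_ne_zero 2 hz
  refine .mul ?_ (.mul ?_ ?_)
  · exact DifferentiableAt.comp (g := fun x => theta x p) z
      (differentiableAt_theta hp (inv_ne_zero hsq)) ((differentiableAt_pow 2).fun_inv hsq)
  · exact differentiableAt_theta_const_mul hq hW hz
  · exact DifferentiableAt.comp (g := fun x => theta x q) (f := fun z => q * z / (c * W)) z
      (differentiableAt_theta hq (div_ne_zero (mul_ne_zero hq0 hz) (mul_ne_zero hc hW)))
      ((differentiableAt_id.const_mul _).div_const _)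

/-- `Ψ` is `f g` times the broken weight, with the removable singularities at the zeros of the theta
factors of the pole conditions removed. The values of `Ψ` are prescribed off countably many points
only, where none of the functions involved takes a junk value. -/
structure IsRegularised (mf mg : ℕ) (T ε : Fin 6 → ℂ) (p q : ℂ) (a b : Fin 6) (W : ℂ)
    (f g Ψ : ℂ → ℂ) : Prop where
  differentiableOn : DifferentiableOn ℂ Ψ (regularDomain (shifted q mf mg T) ε p q)
  eq_of_notMem : ∀ z ∈ regularDomain (shifted q mf mg T) ε p q,
    (∀ r, T r * z ∉ nomeLattice p q) → (∀ r, T r * z⁻¹ ∉ nomeLattice p q) →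
      Ψ z = f z * g z * brokenWeight T ε p q a b W z

theorem exists_isRegularised (hp0 : p ≠ 0) (hp : ‖p‖ < 1) (hq0 : q ≠ 0) (hq : ‖q‖ < 1)
    {T ε : Fin 6 → ℂ} (hT : ∀ r, T r ≠ 0) (hε : ∀ r, ε r = 1 ∨ ε r = p) {f g : ℂ → ℂ} {mf mg : ℕ}
    (hf : HasPoleOrder (T 4) p q mf f) (hg : HasPoleOrder (T 5) p q mg g) (a b : Fin 6) {W : ℂ}
    (hW : W ≠ 0) : ∃ Ψ : ℂ → ℂ, IsRegularised mf mg T ε p q a b W f g Ψ := by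
  obtain ⟨F, hFd, hF⟩ := hf
  obtain ⟨G, hGd, hG⟩ := hg
  choose R hR using fun r => exists_ellGamma_mul_eq hp0 hp hq0 hq (hT r) (hε r)
    (shiftOrder mf mg r)
  simp only [← shifted_eq] at hR
  refine ⟨fun z => F z * G z * (∏ r, R r z) * (theta ((z ^ 2)⁻¹) p *
    (theta (W * z) q * theta (q * z / (T a * T b * W)) q)), fun z ⟨hz, hpole⟩ => ?_,
    fun z ⟨hz, hpole⟩ hleft hright => ?_⟩
  · have hz' : {0}ᶜ ∈ 𝓝 z := isOpen_compl_singleton.mem_nhds hz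
    exact ((((hFd.differentiableAt hz').mul (hGd.differentiableAt hz')).mul
      (DifferentiableAt.fun_finsetProd fun r _ => (hR r z hz (hpole r).1 (hpole r).2).1)).mul
      (differentiableAt_breakingFactor hp hq0 hq (mul_ne_zero (hT a) (hT b)) hW
        hz)).differentiableWithinAt
  · have hΘ (r : Fin 6) := thetaFin_mul_thetaFin_inv_ne_zero hp0 hp hq0 (hT r) hz (hleft r)
      (hright r)
    have hprod := prod_shiftOrder (fun r m => thetaFin (p * q * z / T r) q p m *
      thetaFin (p * q * z⁻¹ / T r) q p m) (fun r => by simp [thetaFin]) mf mg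
    rw [brokenWeight, Finset.prod_congr rfl fun r _ => (hR r z hz (hpole r).1 (hpole r).2).2,
      Finset.prod_mul_distrib, hprod]
    simp only [hF z hz (hΘ 4 mf), hG z hz (hΘ 5 mg)]
    ring

/-! ### Symmetrisation of the elliptic integral -/

theorem Chain.Separates.winding_zero {C : Chain} {Inn Out : Set ℂ} (h : C.Separates Inn Out)
    (h0 : 0 ∈ closure Inn) : C.winding 0 = 1 := by
  obtain ⟨δ, hδ, hball⟩ := Chain.exists_ball_winding_eq h.zero_notMem
  obtain ⟨x, hx, hxδ⟩ := Metric.mem_closure_iff.1 h0 δ hδ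
  rw [← h.winding_inner x hx, (hball x (Metric.mem_ball'.2 hxδ)).2]

theorem Chain.Separates.disjoint {C : Chain} {Inn Out : Set ℂ} (h : C.Separates Inn Out) :
    Disjoint Inn Out :=
  disjoint_left.2 fun x hi ho => zero_ne_one ((h.winding_outer x ho).symm.trans
    (h.winding_inner x hi))

theorem Chain.Separates.winding_eq {C D : Chain} {Inn Out : Set ℂ} (hC : C.Separates Inn Out)
    (hD : D.Separates Inn Out) (h0 : 0 ∈ closure Inn) {x : ℂ}
    (hx : x = 0 ∨ x ∈ Inn ∨ x ∈ Out) : C.winding x = D.winding x := by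
  rcases hx with rfl | hx | hx
  · rw [hC.winding_zero h0, hD.winding_zero h0]
  · rw [hC.winding_inner x hx, hD.winding_inner x hx]
  · rw [hC.winding_outer x hx, hD.winding_outer x hx]

theorem Chain.Separates.support_subset {C : Chain} {Inn Out U : Set ℂ} (hC : C.Separates Inn Out)
    (hU : ∀ x ∉ U, x = 0 ∨ x ∈ Inn ∨ x ∈ Out) : C.support ⊆ U := by
  intro z hz
  by_contra hzU
  rcases hU z hzU with rfl | h | h
  · exact hC.zero_notMem hz
  · exact disjoint_left.1 hC.disjoint_inner hz h
  · exact disjoint_left.1 hC.disjoint_outer hz h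

variable {p q : ℂ} {τ ε : Fin 6 → ℂ}

theorem tendsto_pow_mul_pow (hp : ‖p‖ < 1) (hq : ‖q‖ < 1) (c : ℂ) :
    Tendsto (fun k : ℕ × ℕ => p ^ k.1 * q ^ k.2 * c) cofinite (𝓝 0) := by
  refine squeeze_zero_norm (fun k => le_of_eq ?_)
    (summable_geometric_prod (norm_nonneg p) hp (norm_nonneg q) hq ‖c‖).tendsto_cofinite_zero
  rw [norm_mul, norm_mul, norm_pow, norm_pow, mul_comm]

theorem finite_ellInner (hp : ‖p‖ < 1) (hq : ‖q‖ < 1) (τ : Fin 6 → ℂ) {d : ℝ} (hd : 0 < d) :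
    {x ∈ ellInner τ p q | d ≤ ‖x‖}.Finite := by
  have hfin (r : Fin 6) : {k : ℕ × ℕ | d ≤ ‖p ^ k.1 * q ^ k.2 * τ r‖}.Finite := by
    have hlt := (tendsto_pow_mul_pow hp hq (τ r)).norm.eventually
      (gt_mem_nhds (by simpa using hd))
    simpa only [Filter.Eventually, mem_cofinite, compl_ofPred, not_lt] using hlt
  refine (finite_iUnion fun r => (hfin r).image fun k => p ^ k.1 * q ^ k.2 * τ r).subset ?_
  rintro _ ⟨⟨r, i, j, rfl⟩, hx⟩
  exact mem_iUnion.2 ⟨r, (i, j), hx, rfl⟩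

theorem mem_ellOuter_iff {x : ℂ} : x ∈ ellOuter τ p q ↔ x⁻¹ ∈ ellInner τ p q := by
  constructor
  · rintro ⟨r, i, j, rfl⟩
    exact ⟨r, i, j, inv_inv _⟩
  · rintro ⟨r, i, j, h⟩
    exact ⟨r, i, j, by rw [← h, inv_inv]⟩

theorem zero_notMem_ellInner (hp0 : p ≠ 0) (hq0 : q ≠ 0) (hτ : ∀ r, τ r ≠ 0) :
    (0 : ℂ) ∉ ellInner τ p q := by
  rintro ⟨r, i, j, h⟩
  exact mul_ne_zero (mul_ne_zero (pow_ne_zero i hp0) (pow_ne_zero j hq0)) (hτ r) h.symm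

theorem finite_ellOuter (hp0 : p ≠ 0) (hp : ‖p‖ < 1) (hq0 : q ≠ 0) (hq : ‖q‖ < 1)
    (hτ : ∀ r, τ r ≠ 0) (R : ℝ) : {x ∈ ellOuter τ p q | ‖x‖ ≤ R}.Finite := by
  have hR : 0 < (max R 1)⁻¹ := by positivity
  refine ((finite_ellInner hp hq τ hR).image fun x => x⁻¹).subset ?_
  rintro x ⟨hx, hxR⟩
  rw [mem_ellOuter_iff] at hx
  refine ⟨x⁻¹, ⟨hx, ?_⟩, inv_inv x⟩
  have hx0 : x ≠ 0 := by
    rintro rfl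
    rw [inv_zero] at hx
    exact zero_notMem_ellInner hp0 hq0 hτ hx
  rw [norm_inv]
  exact inv_anti₀ (norm_pos_iff.2 hx0) (hxR.trans (le_max_left _ _))

theorem zero_mem_closure_ellInner (hq : ‖q‖ < 1) (τ : Fin 6 → ℂ) :
    0 ∈ closure (ellInner τ p q) := by
  have hlim : Tendsto (fun j : ℕ => q ^ j * τ 0) atTop (𝓝 0) := by
    simpa using (tendsto_pow_atTop_nhds_zero_of_norm_lt_one hq).mul_const (τ 0)
  exact mem_closure_of_tendsto hlim
    (Eventually.of_forall fun j => ⟨0, 0, j, by rw [pow_zero, one_mul]⟩)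

theorem exists_separates_ell (hp0 : p ≠ 0) (hp : ‖p‖ < 1) (hq0 : q ≠ 0) (hq : ‖q‖ < 1)
    (hτ : ∀ r, τ r ≠ 0) (hdis : Disjoint (ellInner τ p q) (ellOuter τ p q)) :
    ∃ C : Chain, C.Separates (ellInner τ p q) (ellOuter τ p q) ∧ ∀ i s, C.loop i s ≠ 0 := by
  refine Chain.exists_separates hdis (zero_notMem_ellInner hp0 hq0 hτ) ?_
    (fun d hd => finite_ellInner hp hq τ hd) (finite_ellOuter hp0 hp hq0 hq hτ)
  rw [mem_ellOuter_iff, inv_zero]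
  exact zero_notMem_ellInner hp0 hq0 hτ

theorem Chain.Separates.inversion {C : Chain} (hp0 : p ≠ 0) (hq0 : q ≠ 0) (hq : ‖q‖ < 1)
    (hτ : ∀ r, τ r ≠ 0) (h : C.Separates (ellInner τ p q) (ellOuter τ p q))
    (hl : ∀ i s, C.loop i s ≠ 0) :
    (C.inversion hl).Separates (ellInner τ p q) (ellOuter τ p q) := by
  have hwind0 := h.winding_zero (zero_mem_closure_ellInner hq τ)
  have hne {x : ℂ} (hx : x ∈ ellInner τ p q) : x ≠ 0 :=
    fun h0 => zero_notMem_ellInner hp0 hq0 hτ (h0 ▸ hx)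
  have hsupp (x : ℂ) (hx : x ∈ (C.inversion hl).support) : x⁻¹ ∈ C.support := by
    rw [Chain.support_inversion] at hx
    obtain ⟨y, hy, rfl⟩ := hx
    rwa [inv_inv]
  have hinner {x : ℂ} (hx : x ∈ ellInner τ p q) : x⁻¹ ∈ ellOuter τ p q := by
    rwa [mem_ellOuter_iff, inv_inv]
  have houter {x : ℂ} (hx : x ∈ ellOuter τ p q) : x⁻¹ ∈ ellInner τ p q := mem_ellOuter_iff.1 hx
  refine ⟨fun hx => ?_, ?_, ?_, fun x hx => ?_, fun x hx => ?_⟩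
  · exact h.zero_notMem (inv_zero (G₀ := ℂ) ▸ hsupp 0 hx)
  · exact disjoint_left.2 fun x hs hx => disjoint_left.1 h.disjoint_outer (hsupp x hs) (hinner hx)
  · exact disjoint_left.2 fun x hs hx => disjoint_left.1 h.disjoint_inner (hsupp x hs) (houter hx)
  · rw [C.winding_inversion hl h.zero_notMem (hne hx)
      (disjoint_right.1 h.disjoint_outer (hinner hx)), hwind0, h.winding_outer _ (hinner hx),
      sub_zero]
  · rw [C.winding_inversion hl h.zero_notMem (fun h0 => hne (houter hx) (inv_eq_zero.2 h0))
      (disjoint_right.1 h.disjoint_inner (houter hx)), hwind0, h.winding_inner _ (houter hx),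
      sub_self]

theorem inv_eq_zero_or_mem_ell_iff {z : ℂ} :
    (z⁻¹ = 0 ∨ z⁻¹ ∈ ellInner τ p q ∨ z⁻¹ ∈ ellOuter τ p q) ↔
      z = 0 ∨ z ∈ ellInner τ p q ∨ z ∈ ellOuter τ p q := by
  rw [inv_eq_zero, ← mem_ellOuter_iff, mem_ellOuter_iff (x := z⁻¹), inv_inv,
    or_comm (a := z ∈ ellOuter τ p q)]

theorem Chain.Separates.integral_add_comp_inv {C : Chain} (hp0 : p ≠ 0) (hp : ‖p‖ < 1)
    (hq0 : q ≠ 0) (hq : ‖q‖ < 1) (hτ : ∀ r, τ r ≠ 0)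
    (hC : C.Separates (ellInner τ p q) (ellOuter τ p q)) {U : Set ℂ} (hU : IsOpen U)
    (hUc : ∀ z ∉ U, z = 0 ∨ z ∈ ellInner τ p q ∨ z ∈ ellOuter τ p q) {A : ℂ → ℂ}
    (hA : DifferentiableOn ℂ A U) :
    C.integral (fun z => A z + A z⁻¹ / z ^ 2) = 2 * C.integral A := by
  have h0 := zero_mem_closure_ellInner (p := p) hq τ
  let V : Set ℂ := {z | z ≠ 0 ∧ z ∈ U ∧ z⁻¹ ∈ U}
  have hV : IsOpen V := by
    rw [isOpen_iff_mem_nhds]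
    rintro z ⟨hz0, hz, hz'⟩
    filter_upwards [isOpen_ne.mem_nhds hz0, hU.mem_nhds hz,
      (continuousAt_inv₀ hz0).preimage_mem_nhds (hU.mem_nhds hz')] with y hy0 hy hy'
      using ⟨hy0, hy, hy'⟩
  have hVc (z : ℂ) (hz : z ∉ V) : z = 0 ∨ z ∈ ellInner τ p q ∨ z ∈ ellOuter τ p q := by
    by_cases hzU : z ∈ U
    · by_cases hzU' : z⁻¹ ∈ U
      · exact Or.inl (not_not.1 fun hz0 => hz ⟨hz0, hzU, hzU'⟩)
      · exact inv_eq_zero_or_mem_ell_iff.1 (hUc _ hzU')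
    · exact hUc z hzU
  have hA' : DifferentiableOn ℂ (fun z => A z⁻¹ / z ^ 2) V :=
    (DifferentiableOn.fun_comp hA (fun z hz => (differentiableAt_inv hz.1).differentiableWithinAt)
      fun z hz => hz.2.2).fun_div (differentiableOn_pow 2) fun z hz => pow_ne_zero 2 hz.1
  have hAV : DifferentiableOn ℂ A V := hA.mono fun z hz => hz.2.1
  obtain ⟨C', hC', hl⟩ := exists_separates_ell hp0 hp hq0 hq hτ hC.disjoint
  have hmove {E : Chain} (hE : E.Separates (ellInner τ p q) (ellOuter τ p q)) {B : ℂ → ℂ}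
      (hB : DifferentiableOn ℂ B V) : E.integral B = C.integral B :=
    Chain.integral_eq_of_winding_eq hV (hE.support_subset hVc) (hC.support_subset hVc) hB
      fun x hx => hE.winding_eq hC h0 (hVc x hx)
  rw [Chain.integral_add (hAV.continuousOn.mono (hC.support_subset hVc))
    (hA'.continuousOn.mono (hC.support_subset hVc)), ← hmove hC' hA',
    ← Chain.integral_inversion C' hl, hmove (hC'.inversion hp0 hq0 hq hτ hl) hAV, two_mul]

theorem notMem_regularDomain (hp : ‖p‖ < 1) (hq : ‖q‖ < 1) (hε : ∀ r, ε r = 1 ∨ ε r = p) {z : ℂ}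
    (hz : z ∉ regularDomain τ ε p q) : z = 0 ∨ z ∈ ellInner τ p q ∨ z ∈ ellOuter τ p q := by
  by_contra! hcon
  obtain ⟨h0, hi, ho⟩ := hcon
  refine hz ⟨h0, fun r => ⟨fun h => ?_, fun h => ?_⟩⟩
  · obtain ⟨i, j, hij⟩ := pqPoch_eq_zero hp hq h
    refine ho (mem_ellOuter_iff.2 ?_)
    rcases hε r with hr | hr
    · refine ⟨r, i, j, inv_eq_of_mul_eq_one_right ?_⟩
      rw [← hij, hr]
      ring
    · refine ⟨r, i + 1, j, inv_eq_of_mul_eq_one_right ?_⟩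
      rw [← hij, hr]
      ring
  · obtain ⟨i, j, hij⟩ := pqPoch_eq_zero hp hq h
    refine hi ⟨r, i, j, ?_⟩
    field_simp at hij
    rw [← hij]
    ring

theorem mul_brokenWeight (hp0 : p ≠ 0) (hp : ‖p‖ < 1) (hq : ‖q‖ < 1) {T : Fin 6 → ℂ}
    {a b : Fin 6} (hab : a ≠ b) (hε : ∀ r, ε r = if r = a ∨ r = b then p else 1) {W z : ℂ}
    (h : ∀ r, T r * z ∉ nomeLattice p q) :
    brokenWeight T ε p q a b W z = (∏ r, ellGamma (T r * z) p q * ellGamma (T r * z⁻¹) p q) *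
      theta ((z ^ 2)⁻¹) p * (theta (T a * z) q * theta (T b * z) q * theta (W * z) q *
        theta (q * z / (T a * T b * W)) q) := by
  have hfactor (r : Fin 6) : ellGamma (ε r * T r * z) p q * ellGamma (T r * z⁻¹) p q =
      ((if r = a then theta (T a * z) q else 1) * (if r = b then theta (T b * z) q else 1)) *
      (ellGamma (T r * z) p q * ellGamma (T r * z⁻¹) p q) := by
    rw [hε, mul_assoc (ite _ _ _)]
    have hpole := pqPoch_ne_zero hp hq (h r)
    by_cases ha : r = a
    · simp only [ha, true_or, if_true, hab, if_false] at hpole ⊢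
      rw [ellGamma_mul_left hp hq hp0 hpole]
      ring
    · by_cases hb : r = b
      · simp only [hb, or_true, if_true, hab.symm, if_false] at hpole ⊢
        rw [ellGamma_mul_left hp hq hp0 hpole]
        ring
      · simp [ha, hb]
  rw [brokenWeight, Finset.prod_congr rfl fun r _ => hfactor r, Finset.prod_mul_distrib,
    Finset.prod_mul_distrib]
  simp only [Finset.prod_ite_eq', Finset.mem_univ, if_true]
  ring

theorem countable_setOf_sq_mem {E : Set ℂ} (hE : E.Countable) {c : ℂ} (hc : c ≠ 0) :
    {z : ℂ | z ^ 2 / c ∈ E}.Countable := by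
  refine (hE.biUnion fun e _ => ?_).mono (s₁ := {z : ℂ | z ^ 2 / c ∈ E})
    (s₂ := ⋃ e ∈ E, {z : ℂ | z ^ 2 / c = e})
    fun z hz => mem_iUnion₂.2 ⟨_, hz, rfl⟩
  rcases eq_empty_or_nonempty {z : ℂ | z ^ 2 / c = e} with hempty | ⟨w, rfl⟩
  · rw [hempty]
    exact countable_empty
  · refine ((countable_singleton (-w)).insert w).mono fun z hz => ?_
    exact sq_eq_sq_iff_eq_or_eq_neg.1 ((div_left_inj' hc).1 hz)

theorem brokenWeight_add_inv (hp0 : p ≠ 0) (hp : ‖p‖ < 1) (hq0 : q ≠ 0) (hq : ‖q‖ < 1)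
    {T : Fin 6 → ℂ} (hT : ∀ r, T r ≠ 0) {a b : Fin 6} (hab : a ≠ b)
    (hε : ∀ r, ε r = if r = a ∨ r = b then p else 1) {W z : ℂ} (hW : W ≠ 0) (hz : z ≠ 0)
    (hTab : theta (T a * T b) q ≠ 0) (hleft : ∀ r, T r * z ∉ nomeLattice p q)
    (hright : ∀ r, T r * z⁻¹ ∉ nomeLattice p q) (hsq : z ^ 2 ∉ nomeLattice p q)
    (hsq' : z ^ 2 / (T a * T b) ∉ nomeLattice p q) :
    brokenWeight T ε p q a b W z + brokenWeight T ε p q a b W z⁻¹ =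
      theta (T a * T b) q * theta (T a * W) q * theta (T b * W) q *
        ((∏ r, ellGamma (T r * z) p q * ellGamma (T r * z⁻¹) p q) /
          (ellGamma (z ^ 2) p q * ellGamma ((z ^ 2)⁻¹) p q)) := by
  have hthree := theta_three_term hq0 hq (hT a) (hT b) hz hW hTab (theta_ne_zero_right hq0 hq hsq)
    (theta_ne_zero_right hq0 hq hsq')
  have hrefl := ellGamma_mul_inv hp hq (pqPoch_ne_zero hp hq hsq)
    (pqPoch_ne_zero hp hq (inv_mem_nomeLattice.not.2 hsq))
  have htheta : theta (z ^ 2) p = -(z ^ 2) * theta (z ^ 2)⁻¹ p := by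
    have hinv := theta_inv hp0 hp (inv_ne_zero (pow_ne_zero 2 hz))
    rwa [inv_inv] at hinv
  rw [mul_brokenWeight hp0 hp hq hab hε hleft, mul_brokenWeight hp0 hp hq hab hε hright, inv_inv,
    inv_pow, inv_inv, htheta, div_eq_mul_one_div (∏ r, _) (ellGamma _ p q * _), hrefl,
    Finset.prod_congr rfl fun r _ => mul_comm (ellGamma (T r * z⁻¹) p q)
      (ellGamma (T r * z) p q)]
  linear_combination -((∏ r, ellGamma (T r * z) p q * ellGamma (T r * z⁻¹) p q) *
    theta (z ^ 2)⁻¹ p) * hthree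

theorem IsRegularised.add_inv {f g Ψ : ℂ → ℂ} {mf mg : ℕ} {T : Fin 6 → ℂ} {a b : Fin 6} {W z : ℂ}
    (hΨ : IsRegularised mf mg T ε p q a b W f g Ψ) (hf : f z⁻¹ = f z) (hg : g z⁻¹ = g z)
    (hz : z ∈ regularDomain (shifted q mf mg T) ε p q)
    (hzinv : z⁻¹ ∈ regularDomain (shifted q mf mg T) ε p q)
    (hleft : ∀ r, T r * z ∉ nomeLattice p q) (hright : ∀ r, T r * z⁻¹ ∉ nomeLattice p q) :
    Ψ z + Ψ z⁻¹ =
      f z * g z * (brokenWeight T ε p q a b W z + brokenWeight T ε p q a b W z⁻¹) := by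
  rw [hΨ.eq_of_notMem z hz hleft hright,
    hΨ.eq_of_notMem z⁻¹ hzinv hright fun r => by rw [inv_inv]; exact hleft r, hf, hg, mul_add]

theorem integral_eq_integral_symmetrised (hp0 : p ≠ 0) (hp : ‖p‖ < 1) (hq0 : q ≠ 0) (hq : ‖q‖ < 1)
    {T : Fin 6 → ℂ} (hT : ∀ r, T r ≠ 0) {a b : Fin 6} (hab : a ≠ b)
    (hε : ∀ r, ε r = if r = a ∨ r = b then p else 1) {f g : ℂ → ℂ} {mf mg : ℕ}
    (hf : ∀ z, z ≠ 0 → f z⁻¹ = f z) (hg : ∀ z, z ≠ 0 → g z⁻¹ = g z) {W : ℂ} (hW : W ≠ 0)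
    (hTab : theta (T a * T b) q ≠ 0) (haW : theta (T a * W) q ≠ 0) (hbW : theta (T b * W) q ≠ 0)
    {Ψ : ℂ → ℂ} (hΨ : IsRegularised mf mg T ε p q a b W f g Ψ) {C : Chain}
    (hC : C.support ⊆ regularDomain (shifted q mf mg T) ε p q)
    (hCinv : C.support ⊆ Inv.inv ⁻¹' regularDomain (shifted q mf mg T) ε p q) :
    C.integral (fun z => f z * g z *
        ((∏ r, ellGamma (T r * z) p q * ellGamma (T r * z⁻¹) p q) /
          (ellGamma (z ^ 2) p q * ellGamma ((z ^ 2)⁻¹) p q)) / (2 * Real.pi * I * z)) =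
      (theta (T a * T b) q * theta (T a * W) q * theta (T b * W) q)⁻¹ *
        C.integral (fun z => Ψ z / (2 * Real.pi * I * z) +
          Ψ z⁻¹ / (2 * Real.pi * I * z⁻¹) / z ^ 2) := by
  have hc : theta (T a * T b) q * theta (T a * W) q * theta (T b * W) q ≠ 0 :=
    mul_ne_zero (mul_ne_zero hTab haW) hbW
  have hlat := countable_nomeLattice p q
  have hexc := ((countable_iUnion fun r => hlat.preimage (mul_right_injective₀ (hT r))).union
    (countable_iUnion fun r =>
      hlat.preimage ((mul_right_injective₀ (hT r)).comp inv_injective))).union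
    ((countable_setOf_sq_mem hlat one_ne_zero).union
      (countable_setOf_sq_mem hlat (mul_ne_zero (hT a) (hT b))))
  rw [← Chain.integral_const_mul]
  refine Chain.integral_congr_of_countable hexc fun z hzC hz => ?_
  simp only [mem_union, mem_iUnion, mem_preimage, mem_ofPred_eq, not_or, not_exists, div_one,
    Function.comp_apply] at hz
  obtain ⟨⟨hleft, hright⟩, hsq, hsq_div⟩ := hz
  have hz0 : z ≠ 0 := (hC hzC).1
  have hsum := hΨ.add_inv (hf z hz0) (hg z hz0) (hC hzC) (hCinv hzC) hleft hright
  rw [brokenWeight_add_inv hp0 hp hq0 hq hT hab hε hW hz0 hTab hleft hright hsq hsq_div] at hsum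
  have hjac : Ψ z⁻¹ / (2 * Real.pi * I * z⁻¹) / z ^ 2 = Ψ z⁻¹ / (2 * Real.pi * I * z) := by
    field_simp
  rw [hjac, ← add_div, hsum, eq_inv_mul_iff_mul_eq₀ hc]
  ring

theorem integral_eq_broken (hp0 : p ≠ 0) (hp : ‖p‖ < 1) (hq0 : q ≠ 0) (hq : ‖q‖ < 1)
    {T : Fin 6 → ℂ} (hT : ∀ r, T r ≠ 0) {a b : Fin 6} (hab : a ≠ b)
    (hε : ∀ r, ε r = if r = a ∨ r = b then p else 1) {f g : ℂ → ℂ} {mf mg : ℕ}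
    (hf : ∀ z, z ≠ 0 → f z⁻¹ = f z) (hg : ∀ z, z ≠ 0 → g z⁻¹ = g z) {W : ℂ} (hW : W ≠ 0)
    (hTab : theta (T a * T b) q ≠ 0) (haW : theta (T a * W) q ≠ 0) (hbW : theta (T b * W) q ≠ 0)
    {Ψ : ℂ → ℂ} (hΨ : IsRegularised mf mg T ε p q a b W f g Ψ) {C D : Chain}
    (hC : C.Separates (ellInner (shifted q mf mg T) p q) (ellOuter (shifted q mf mg T) p q))
    (hD : D.support ⊆ regularDomain (shifted q mf mg T) ε p q)
    (hDw : ∀ x ∉ regularDomain (shifted q mf mg T) ε p q, D.winding x = C.winding x) :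
    C.integral (fun z => f z * g z *
        ((∏ r, ellGamma (T r * z) p q * ellGamma (T r * z⁻¹) p q) /
          (ellGamma (z ^ 2) p q * ellGamma ((z ^ 2)⁻¹) p q)) / (2 * Real.pi * I * z)) =
      2 * (theta (T a * T b) q * theta (T a * W) q * theta (T b * W) q)⁻¹ *
        D.integral (fun z => Ψ z / (2 * Real.pi * I * z)) := by
  have hU := isOpen_regularDomain hp hq (shifted q mf mg T) ε
  have hUc (z : ℂ) := notMem_regularDomain (τ := shifted q mf mg T) (ε := ε) (z := z) hp hq
    fun r => by rw [hε]; split_ifs <;> simp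
  have hC_support := hC.support_subset hUc
  have hC_support_inv := hC.support_subset
    (U := Inv.inv ⁻¹' regularDomain (shifted q mf mg T) ε p q)
    fun x hx => inv_eq_zero_or_mem_ell_iff.1 (hUc _ hx)
  have hA : DifferentiableOn ℂ (fun z => Ψ z / (2 * Real.pi * I * z))
      (regularDomain (shifted q mf mg T) ε p q) :=
    hΨ.differentiableOn.fun_div (differentiableOn_id.const_mul _)
      fun z hz => mul_ne_zero Complex.two_pi_I_ne_zero hz.1
  rw [integral_eq_integral_symmetrised hp0 hp hq0 hq hT hab hε hf hg hW hTab haW hbW hΨ hC_support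
      hC_support_inv,
    hC.integral_add_comp_inv hp0 hp hq0 hq (shifted_ne_zero hq0 hT mf mg) hU hUc hA,
    Chain.integral_eq_of_winding_eq hU hC_support hD hA fun x hx => (hDw x hx).symm]
  ring

/-! ### Powers of the nome -/

theorem nomePow_zero (l : ℂ) : nomePow 0 l = 1 := by simp [nomePow]

theorem nomePow_one (l : ℂ) : nomePow 1 l = exp l := by simp [nomePow]

theorem nomePow_add (s u : ℝ) (l : ℂ) : nomePow (s + u) l = nomePow s l * nomePow u l := by
  rw [nomePow, nomePow, nomePow, ← exp_add, ofReal_add, add_mul]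

theorem nomePow_neg (s : ℝ) (l : ℂ) : nomePow (-s) l = (nomePow s l)⁻¹ := by
  rw [nomePow, nomePow, ← exp_neg, ofReal_neg, neg_mul]

theorem nomePow_sub (s u : ℝ) (l : ℂ) : nomePow (s - u) l = nomePow s l / nomePow u l := by
  rw [sub_eq_add_neg, nomePow_add, nomePow_neg, div_eq_mul_inv]

theorem nomePow_natCast (i : ℕ) (l : ℂ) : nomePow i l = exp l ^ i := by
  rw [nomePow, ← exp_nat_mul, ofReal_natCast]

theorem nomePow_ne_zero (s : ℝ) (l : ℂ) : nomePow s l ≠ 0 := exp_ne_zero _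

theorem norm_nomePow (s : ℝ) (l : ℂ) : ‖nomePow s l‖ = Real.exp (s * l.re) := by
  rw [nomePow, norm_exp, re_ofReal_mul]

theorem tendsto_re_nomeToZero : Tendsto re nomeToZero atBot := tendsto_comap

theorem tendsto_nomePow {s : ℝ} (hs : 0 < s) : Tendsto (nomePow s) nomeToZero (𝓝 0) := by
  rw [tendsto_zero_iff_norm_tendsto_zero]
  simp only [norm_nomePow]
  exact Real.tendsto_exp_atBot.comp (tendsto_re_nomeToZero.const_mul_atBot hs)

theorem tendsto_exp_nomeToZero : Tendsto exp nomeToZero (𝓝 0) := by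
  rw [← show nomePow 1 = exp from funext nomePow_one]
  exact tendsto_nomePow one_pos

theorem eventually_norm_exp_lt_one : ∀ᶠ l in nomeToZero, ‖exp l‖ < 1 :=
  tendsto_exp_nomeToZero.norm.eventually (gt_mem_nhds (by simp))

theorem norm_mul_nomePow_mul_pow_le {q : ℂ} (hq : ‖q‖ < 1) (v : ℂ) {s c : ℝ} {l : ℂ}
    (hl : l.re ≤ 0) {i : ℕ} (hc : c ≤ s + i) (j : ℕ) :
    ‖v * nomePow s l * exp l ^ i * q ^ j‖ ≤ ‖v * nomePow c l‖ := by
  rw [mul_assoc v, ← nomePow_natCast, ← nomePow_add, norm_mul, norm_mul, norm_mul, norm_pow,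
    norm_nomePow, norm_nomePow]
  calc ‖v‖ * Real.exp ((s + i) * l.re) * ‖q‖ ^ j ≤ ‖v‖ * Real.exp ((s + i) * l.re) * 1 := by
        gcongr
        exact pow_le_one₀ (norm_nonneg q) hq.le
    _ ≤ ‖v‖ * Real.exp (c * l.re) := by
        rw [mul_one]
        gcongr ‖v‖ * Real.exp ?_
        exact mul_le_mul_of_nonpos_right hc hl

theorem eventually_norm_mul_nomePow_lt {q : ℂ} (hq : ‖q‖ < 1) (v : ℂ) {s δ : ℝ} (hs : 0 ≤ s)
    (hδ : 0 < δ) : ∀ᶠ l in nomeToZero, ∀ i j : ℕ, ¬ (i = 0 ∧ s = 0) →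
      ‖v * nomePow s l * exp l ^ i * q ^ j‖ < δ := by
  obtain ⟨c, hc0, hc⟩ : ∃ c : ℝ, 0 < c ∧ ∀ i : ℕ, ¬ (i = 0 ∧ s = 0) → c ≤ s + i := by
    rcases hs.eq_or_lt with rfl | hs
    · refine ⟨1, one_pos, fun i hi => ?_⟩
      rw [zero_add, Nat.one_le_cast]
      exact Nat.one_le_iff_ne_zero.2 fun h => hi ⟨h, rfl⟩
    · exact ⟨s, hs, fun i _ => le_add_of_nonneg_right i.cast_nonneg⟩
  have hsmall := ((tendsto_nomePow hc0).const_mul v).norm.eventually_lt_const (u := δ)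
    (by simpa using hδ)
  filter_upwards [hsmall, tendsto_re_nomeToZero.eventually (eventually_le_atBot 0)]
    with l hl hre i j hij
  exact (norm_mul_nomePow_mul_pow_le hq v hre (hc i hij) j).trans_lt hl

/-! ### Limits of the elliptic symbols -/

section Limits

variable {ι : Type*} {L : Filter ι} {l y : ι → ℂ} {y₀ q : ℂ} {s : ℝ}

theorem tendsto_mul_nomePow (hl : Tendsto l L nomeToZero) (hy : Tendsto y L (𝓝 y₀)) (hs : 0 ≤ s) :
    Tendsto (fun i => y i * nomePow s (l i)) L (𝓝 (if s = 0 then y₀ else 0)) := by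
  split_ifs with h
  · simpa only [h, nomePow_zero, mul_one] using hy
  · simpa using hy.mul ((tendsto_nomePow (lt_of_le_of_ne hs (Ne.symm h))).comp hl)

theorem tendsto_pqPoch (hq : ‖q‖ < 1) (hl : Tendsto l L nomeToZero) (hy : Tendsto y L (𝓝 y₀))
    (hs : 0 ≤ s) : Tendsto (fun i => pqPoch (y i * nomePow s (l i)) (exp (l i)) q) L
      (𝓝 (if s = 0 then qPoch y₀ q else 1)) := by
  have hvalue : (if s = 0 then qPoch y₀ q else 1) = pqPoch (if s = 0 then y₀ else 0) 0 q := by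
    rw [pqPoch_zero_middle]
    split_ifs <;> simp [qPoch_zero_left]
  have hlim := (continuousAt_pqPoch hq (if s = 0 then y₀ else 0) (p := 0) (by simp)).tendsto.comp
    ((tendsto_mul_nomePow hl hy hs).prodMk_nhds (tendsto_exp_nomeToZero.comp hl))
  rw [hvalue]
  exact hlim

theorem tendsto_qPoch_nome (hl : Tendsto l L nomeToZero) (hy : Tendsto y L (𝓝 y₀))
    (hs : 0 ≤ s) : Tendsto (fun i => qPoch (y i * nomePow s (l i)) (exp (l i))) L
      (𝓝 (if s = 0 then 1 - y₀ else 1)) := by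
  have hvalue : (if s = 0 then 1 - y₀ else 1) = qPoch (if s = 0 then y₀ else 0) 0 := by
    rw [qPoch_zero_right]
    split_ifs <;> simp
  have hlim := (continuousAt_qPoch (if s = 0 then y₀ else 0) (p := 0) (by simp)).tendsto.comp
    ((tendsto_mul_nomePow hl hy hs).prodMk_nhds (tendsto_exp_nomeToZero.comp hl))
  rw [hvalue]
  exact hlim

theorem tendsto_ellGamma (hq : ‖q‖ < 1) (hl : Tendsto l L nomeToZero) (hy : Tendsto y L (𝓝 y₀))
    (hy0 : y₀ ≠ 0) (hs : 0 ≤ s) (hs1 : s ≤ 1) (h0 : s = 0 → qPoch y₀ q ≠ 0) :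
    Tendsto (fun i => ellGamma (y i * nomePow s (l i)) (exp (l i)) q) L
      (𝓝 ((if s = 1 then qPoch (q / y₀) q else 1) / (if s = 0 then qPoch y₀ q else 1))) := by
  have hlim := (tendsto_pqPoch hq hl ((tendsto_const_nhds (x := q)).div hy hy0)
    (sub_nonneg.2 hs1)).div (tendsto_pqPoch hq hl hy hs)
    (by split_ifs with h; exacts [h0 h, one_ne_zero])
  simp only [sub_eq_zero, eq_comm (a := (1 : ℝ))] at hlim
  refine hlim.congr fun i => ?_
  simp only [Pi.div_apply]
  rw [ellGamma, nomePow_sub, nomePow_one]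
  congr 2
  field_simp

theorem tendsto_theta_nome (hl : Tendsto l L nomeToZero) (hy : Tendsto y L (𝓝 y₀))
    (hy0 : y₀ ≠ 0) (hs : 0 < s) (hs1 : s ≤ 1) :
    Tendsto (fun i => theta (y i * nomePow s (l i)) (exp (l i))) L
      (𝓝 (if s = 1 then 1 - y₀⁻¹ else 1)) := by
  have hlim := (tendsto_qPoch_nome hl hy hs.le).mul
    (tendsto_qPoch_nome hl (hy.inv₀ hy0) (sub_nonneg.2 hs1))
  simp only [sub_eq_zero, eq_comm (a := (1 : ℝ)), hs.ne', if_false, one_mul] at hlim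
  refine hlim.congr fun i => ?_
  rw [theta, nomePow_sub, nomePow_one]
  congr 2
  field_simp

end Limits

/-! ### The broken weight in the limit -/

/-- The factors `p` by which the arguments with index `a`, `b` are shifted. -/
def nomeShift (a b : Fin 6) (l : ℂ) (r : Fin 6) : ℂ := if r = a ∨ r = b then exp l else 1

/-- The exponent of `p` in the argument `t_r p^{α_r} p^ζ z` (after the shift by `nomeShift`). -/
def outerExp (α : Fin 6 → ℝ) (ζ : ℝ) (a b r : Fin 6) : ℝ :=
  α r + ζ + if r = a ∨ r = b then 1 else 0

theorem nomeShift_eq (a b : Fin 6) (l : ℂ) (r : Fin 6) : nomeShift a b l r = 1 ∨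
    nomeShift a b l r = exp l := by
  unfold nomeShift
  split_ifs <;> simp

theorem nomeShift_mul (α : Fin 6 → ℝ) (ζ : ℝ) (a b r : Fin 6) (l z c : ℂ) :
    nomeShift a b l r * (c * nomePow (α r) l) * (nomePow ζ l * z) =
      c * z * nomePow (outerExp α ζ a b r) l := by
  unfold nomeShift outerExp
  split_ifs
  · rw [nomePow_add, nomePow_add, nomePow_one]; ring
  · rw [add_zero, nomePow_add]; ring

theorem mul_nomePow_inv (s ζ : ℝ) (l z c : ℂ) :
    c * nomePow s l * (nomePow ζ l * z)⁻¹ = c * z⁻¹ * nomePow (s - ζ) l := by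
  rw [nomePow_sub, mul_inv]
  ring

theorem shifted_scaled (q : ℂ) (mf mg : ℕ) (t : Fin 6 → ℂ) (α : Fin 6 → ℝ) (l : ℂ) (r : Fin 6) :
    shifted q mf mg (scaled t α l) r = shifted q mf mg t r * nomePow (α r) l := by
  rw [shifted_eq, shifted_eq, scaled]
  ring

/-- The conditions of the proposition on the exponents, except for `∑ r, α r = 1`. -/
structure Exponents (α : Fin 6 → ℝ) (ζ : ℝ) (a b : Fin 6) : Prop where
  lower : -1 / 2 ≤ ζ
  neg : ζ < 0
  ne : a ≠ b
  left : α a = ζ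
  right : α b = ζ
  other : ∀ r, r ≠ a → r ≠ b → -ζ ≤ α r ∧ α r ≤ 1 + ζ

namespace Exponents

variable {α : Fin 6 → ℝ} {ζ : ℝ} {a b : Fin 6}

theorem eq_of_or (h : Exponents α ζ a b) {r : Fin 6} (hr : r = a ∨ r = b) : α r = ζ :=
  hr.elim (fun hr => hr ▸ h.left) fun hr => hr ▸ h.right

theorem outerExp_mem (h : Exponents α ζ a b) (r : Fin 6) :
    0 ≤ outerExp α ζ a b r ∧ outerExp α ζ a b r < 1 := by
  have hlow := h.lower
  have hneg := h.neg
  unfold outerExp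
  split_ifs with hr
  · rw [h.eq_of_or hr]
    constructor <;> linarith
  · obtain ⟨hl, hu⟩ := h.other r (fun ha => hr (.inl ha)) fun hb => hr (.inr hb)
    constructor <;> linarith

theorem innerExp_mem (h : Exponents α ζ a b) (r : Fin 6) : 0 ≤ α r - ζ ∧ α r - ζ ≤ 1 := by
  have hneg := h.neg
  by_cases hr : r = a ∨ r = b
  · rw [h.eq_of_or hr]
    constructor <;> linarith
  · obtain ⟨hl, hu⟩ := h.other r (fun ha => hr (.inl ha)) fun hb => hr (.inr hb)
    constructor <;> linarith

theorem outerExp_eq_zero (h : Exponents α ζ a b) (r : Fin 6) :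
    outerExp α ζ a b r = 0 ↔ α r = -ζ ∨ (ζ = -1 / 2 ∧ (r = a ∨ r = b)) := by
  have hneg := h.neg
  unfold outerExp
  split_ifs with hr
  · simp only [hr, and_true, h.eq_of_or hr]
    grind
  · simp only [hr, and_false, or_false, add_zero]
    exact add_eq_zero_iff_eq_neg

theorem innerExp_eq_zero (h : Exponents α ζ a b) (r : Fin 6) :
    α r - ζ = 0 ↔ r = a ∨ r = b := by
  refine ⟨fun h0 => ?_, fun hr => by rw [h.eq_of_or hr, sub_self]⟩
  by_contra! hr
  linarith [h.neg, (h.other r hr.1 hr.2).1]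

theorem prod_ite_outerExp_eq_zero (h : Exponents α ζ a b) (X : Fin 6 → ℂ) :
    (∏ r, if outerExp α ζ a b r = 0 then X r else 1) =
      (∏ r with α r = -ζ, X r) * if ζ = -1 / 2 then X a * X b else 1 := by
  have hζ : ζ ≠ -ζ := by linarith [h.neg]
  have hsplit (r : Fin 6) : (if outerExp α ζ a b r = 0 then X r else 1) =
      (if α r = -ζ then X r else 1) * ((if r = a then (if ζ = -1 / 2 then X a else 1) else 1) *
        (if r = b then (if ζ = -1 / 2 then X b else 1) else 1)) := by
    simp only [h.outerExp_eq_zero]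
    by_cases ha : r = a
    · simp [ha, h.ne, h.left, hζ]
    · by_cases hb : r = b
      · simp [hb, h.ne.symm, h.right, hζ]
      · simp [ha, hb]
  rw [Finset.prod_congr rfl fun r _ => hsplit r, Finset.prod_mul_distrib, Finset.prod_mul_distrib,
    Finset.prod_filter]
  simp only [Finset.prod_ite_eq', Finset.mem_univ, if_true]
  split_ifs <;> simp

theorem prod_ite_innerExp_eq_zero (h : Exponents α ζ a b) (X : Fin 6 → ℂ) :
    (∏ r, if α r - ζ = 0 then X r else 1) = X a * X b := by
  have hpair : Finset.univ.filter (fun r => α r - ζ = 0) = {a, b} := by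
    ext r
    simp [h.innerExp_eq_zero]
  rw [← Finset.prod_filter, hpair, Finset.prod_pair h.ne]

end Exponents

/-- The part of the plane on which the limiting integrand is holomorphic. -/
def limDomain (q : ℂ) (τ : Fin 6 → ℂ) (α : Fin 6 → ℝ) (ζ : ℝ) (a b : Fin 6) : Set ℂ :=
  {z | z ≠ 0 ∧ z ∉ limInner q τ a b ∧ z ∉ limOuter q τ α ζ a b}

section Weight

variable {q : ℂ} {τ t : Fin 6 → ℂ} {α : Fin 6 → ℝ} {ζ : ℝ} {a b : Fin 6} {z : ℂ}

theorem qPoch_outer_ne_zero (hq : ‖q‖ < 1) (h : Exponents α ζ a b)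
    (hz : z ∈ limDomain q τ α ζ a b) {r : Fin 6} (hr : outerExp α ζ a b r = 0) :
    qPoch (τ r * z) q ≠ 0 := by
  intro h0
  obtain ⟨j, hj⟩ := qPoch_eq_zero hq h0
  refine hz.2.2 ⟨r, j, (h.outerExp_eq_zero r).1 hr, eq_inv_of_mul_eq_one_left ?_⟩
  rw [← hj]
  ring

theorem qPoch_inner_ne_zero (hq : ‖q‖ < 1) (h : Exponents α ζ a b)
    (hz : z ∈ limDomain q τ α ζ a b) {r : Fin 6} (hr : α r - ζ = 0) :
    qPoch (τ r * z⁻¹) q ≠ 0 := by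
  intro h0
  obtain ⟨j, hj⟩ := qPoch_eq_zero hq h0
  have hzj : z = τ r * q ^ j := by
    have hz0 := hz.1
    field_simp at hj
    exact hj.symm
  refine hz.2.1 ⟨j, ?_⟩
  rcases (h.innerExp_eq_zero r).1 hr with rfl | rfl
  · exact Or.inl hzj
  · exact Or.inr hzj

theorem eventually_mem_regularDomain (hq : ‖q‖ < 1) (h : Exponents α ζ a b) {mf mg : ℕ}
    (hz : z ∈ limDomain q (shifted q mf mg t) α ζ a b) :
    ∀ᶠ x : ℂ × ℂ in nomeToZero ×ˢ 𝓝 z, nomePow ζ x.1 * x.2 ∈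
      regularDomain (shifted q mf mg (scaled t α x.1)) (nomeShift a b x.1) (exp x.1) q := by
  have hl : Tendsto Prod.fst (nomeToZero ×ˢ 𝓝 z) nomeToZero := tendsto_fst
  have hy : Tendsto Prod.snd (nomeToZero ×ˢ 𝓝 z) (𝓝 z) := tendsto_snd
  have houter (r : Fin 6) : ∀ᶠ x : ℂ × ℂ in nomeToZero ×ˢ 𝓝 z,
      pqPoch (shifted q mf mg t r * x.2 * nomePow (outerExp α ζ a b r) x.1) (exp x.1) q ≠ 0 := by
    refine (tendsto_pqPoch hq hl (hy.const_mul _) (h.outerExp_mem r).1).eventually_ne ?_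
    split_ifs with h0
    exacts [qPoch_outer_ne_zero hq h hz h0, one_ne_zero]
  have hinner (r : Fin 6) : ∀ᶠ x : ℂ × ℂ in nomeToZero ×ˢ 𝓝 z,
      pqPoch (shifted q mf mg t r * x.2⁻¹ * nomePow (α r - ζ) x.1) (exp x.1) q ≠ 0 := by
    refine (tendsto_pqPoch hq hl ((hy.inv₀ hz.1).const_mul _) (h.innerExp_mem r).1).eventually_ne ?_
    split_ifs with h0
    exacts [qPoch_inner_ne_zero hq h hz h0, one_ne_zero]
  filter_upwards [hy.eventually_ne hz.1, eventually_all.2 houter, eventually_all.2 hinner]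
    with x hx0 hxouter hxinner
  refine ⟨mul_ne_zero (nomePow_ne_zero _ _) hx0, fun r => ?_⟩
  rw [shifted_scaled, nomeShift_mul, mul_nomePow_inv]
  exact ⟨hxouter r, hxinner r⟩

theorem limDomain_shifted_subset (hq0 : q ≠ 0) (mf mg : ℕ) :
    limDomain q (shifted q mf mg t) α ζ a b ⊆ limDomain q t α ζ a b := by
  have hshift (r : Fin 6) (k : ℕ) :
      t r * q ^ k = shifted q mf mg t r * q ^ (k + shiftOrder mf mg r) := by
    rw [shifted_eq, pow_add]
    field_simp
  rintro z ⟨hz0, hinner, houter⟩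
  refine ⟨hz0, ?_, ?_⟩
  · rintro ⟨k, hk | hk⟩
    · exact hinner ⟨_, Or.inl (hk.trans (hshift a k))⟩
    · exact hinner ⟨_, Or.inr (hk.trans (hshift b k))⟩
  · rintro ⟨r, k, hr, hk⟩
    exact houter ⟨r, _, hr, hk.trans (by rw [hshift])⟩

theorem brokenWeight_scaled (ht : ∀ r, t r ≠ 0) (h : Exponents α ζ a b) {w : ℂ} (l z : ℂ) :
    brokenWeight (scaled t α l) (nomeShift a b l) (exp l) q a b (w * nomePow (-ζ) l)
        (nomePow ζ l * z) =
      (∏ r, ellGamma (t r * z * nomePow (outerExp α ζ a b r) l) (exp l) q *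
          ellGamma (t r * z⁻¹ * nomePow (α r - ζ) l) (exp l) q) *
        theta ((z ^ 2)⁻¹ * nomePow (-2 * ζ) l) (exp l) *
        (theta (w * z) q * theta (q * z / (t a * t b * w)) q) := by
  have hζ := nomePow_ne_zero ζ l
  have hgamma (r : Fin 6) :
      ellGamma (nomeShift a b l r * scaled t α l r * (nomePow ζ l * z)) (exp l) q *
        ellGamma (scaled t α l r * (nomePow ζ l * z)⁻¹) (exp l) q =
      ellGamma (t r * z * nomePow (outerExp α ζ a b r) l) (exp l) q *
        ellGamma (t r * z⁻¹ * nomePow (α r - ζ) l) (exp l) q := by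
    rw [scaled, nomeShift_mul, mul_nomePow_inv]
  have hsq : ((nomePow ζ l * z) ^ 2)⁻¹ = (z ^ 2)⁻¹ * nomePow (-2 * ζ) l := by
    rw [show -2 * ζ = -ζ + -ζ by ring, nomePow_add, nomePow_neg, mul_pow, mul_inv]
    ring
  have hleft : w * nomePow (-ζ) l * (nomePow ζ l * z) = w * z := by
    rw [nomePow_neg]
    field_simp
  have hright : q * (nomePow ζ l * z) / (scaled t α l a * scaled t α l b *
      (w * nomePow (-ζ) l)) = q * z / (t a * t b * w) := by
    have hta := ht a
    have htb := ht b
    rw [scaled, scaled, h.left, h.right, nomePow_neg]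
    field_simp
  rw [brokenWeight, Finset.prod_congr rfl fun r _ => hgamma r, hsq, hleft, hright]

theorem theta_mul_theta_mul_limWeight (h : Exponents α ζ a b) {w : ℂ}
    (haw : theta (t a * w) q ≠ 0) (hbw : theta (t b * w) q ≠ 0) :
    theta (t a * w) q * theta (t b * w) q * limWeight q t α ζ a b w z =
      (∏ r, (1 / if outerExp α ζ a b r = 0 then qPoch (t r * z) q else 1) *
        ((if α r - ζ = 1 then qPoch (q / (t r * z⁻¹)) q else 1) /
          if α r - ζ = 0 then qPoch (t r * z⁻¹) q else 1)) *
      (if -2 * ζ = 1 then 1 - z ^ 2 else 1) *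
      (theta (w * z) q * theta (q * z / (t a * t b * w)) q) := by
  have hzeros : (∏ r, if α r - ζ = 1 then qPoch (q / (t r * z⁻¹)) q else 1) =
      ∏ r with α r = 1 + ζ, qPoch (q * z / t r) q := by
    simp only [Finset.prod_filter, sub_eq_iff_eq_add, ← div_eq_mul_inv, div_div_eq_mul_div]
  have hhalf : -2 * ζ = 1 ↔ ζ = -1 / 2 := ⟨fun h => by linarith, fun h => by linarith⟩
  rw [Finset.prod_mul_distrib, Finset.prod_div_distrib, Finset.prod_div_distrib,
    h.prod_ite_outerExp_eq_zero, h.prod_ite_innerExp_eq_zero, hzeros, Finset.prod_const_one,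
    limWeight]
  simp only [hhalf, ← div_eq_mul_inv]
  generalize theta (t a * w) q = u at *
  generalize theta (t b * w) q = v at *
  generalize (∏ r with α r = -ζ, qPoch (t r * z) q) = P
  generalize (∏ r with α r = 1 + ζ, qPoch (q * z / t r) q) = Q
  generalize theta (w * z) q * theta (q * z / (t a * t b * w)) q = T
  generalize qPoch (t a * z) q * qPoch (t b * z) q = R
  split_ifs <;> field_simp

theorem tendsto_brokenWeight (hq0 : q ≠ 0) (hq : ‖q‖ < 1) (ht : ∀ r, t r ≠ 0)
    (h : Exponents α ζ a b) {w : ℂ} (hw : w ≠ 0) (haw : theta (t a * w) q ≠ 0)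
    (hbw : theta (t b * w) q ≠ 0) (hz : z ∈ limDomain q t α ζ a b) :
    Tendsto (fun x : ℂ × ℂ => brokenWeight (scaled t α x.1) (nomeShift a b x.1) (exp x.1) q a b
        (w * nomePow (-ζ) x.1) (nomePow ζ x.1 * x.2)) (nomeToZero ×ˢ 𝓝 z)
      (𝓝 (theta (t a * w) q * theta (t b * w) q * limWeight q t α ζ a b w z)) := by
  have hl : Tendsto Prod.fst (nomeToZero ×ˢ 𝓝 z) nomeToZero := tendsto_fst
  have hy : Tendsto Prod.snd (nomeToZero ×ˢ 𝓝 z) (𝓝 z) := tendsto_snd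
  have hz0 := hz.1
  have houter (r : Fin 6) := tendsto_ellGamma hq hl (hy.const_mul (t r))
    (mul_ne_zero (ht r) hz0) (h.outerExp_mem r).1 (h.outerExp_mem r).2.le
    fun hr => qPoch_outer_ne_zero hq h hz hr
  simp only [(h.outerExp_mem _).2.ne, if_false] at houter
  have hinner (r : Fin 6) := tendsto_ellGamma hq hl ((hy.inv₀ hz0).const_mul (t r))
    (mul_ne_zero (ht r) (inv_ne_zero hz0)) (h.innerExp_mem r).1 (h.innerExp_mem r).2
    fun hr => qPoch_inner_ne_zero hq h hz hr
  have hsq0 := pow_ne_zero 2 hz0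
  have hsq := tendsto_theta_nome (s := -2 * ζ) hl ((hy.pow 2).inv₀ hsq0) (inv_ne_zero hsq0)
    (by linarith [h.neg]) (by linarith [h.lower])
  rw [inv_inv] at hsq
  have hleft := (differentiableAt_theta hq (mul_ne_zero hw hz0)).continuousAt.tendsto.comp
    (hy.const_mul w)
  have hright := (differentiableAt_theta hq (div_ne_zero (mul_ne_zero hq0 hz0)
    (mul_ne_zero (mul_ne_zero (ht a) (ht b)) hw))).continuousAt.tendsto.comp
    ((hy.const_mul q).div_const _)
  rw [theta_mul_theta_mul_limWeight h haw hbw]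
  exact (((tendsto_finsetProd Finset.univ fun r _ => (houter r).mul (hinner r)).mul hsq).mul
    (hleft.mul hright)).congr fun x => (brokenWeight_scaled ht h x.1 x.2).symm

end Weight

/-! ### Passing to the limit in integrals along chains -/

section Limits

variable {ι E : Type*} {L : Filter ι} [NormedAddCommGroup E]

theorem tendsto_prod_of_eqOn_compl_countable {X Y : ι → ℂ → E} {z₀ : ℂ} {y₀ : E}
    {S : ι → Set ℂ} (hS : ∀ i, (S i).Countable)
    (hX : ∀ᶠ x : ι × ℂ in L ×ˢ 𝓝 z₀, ContinuousAt (X x.1) x.2)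
    (hXY : ∀ᶠ x : ι × ℂ in L ×ˢ 𝓝 z₀, x.2 ∉ S x.1 → X x.1 x.2 = Y x.1 x.2)
    (hY : Tendsto (fun x : ι × ℂ => Y x.1 x.2) (L ×ˢ 𝓝 z₀) (𝓝 y₀)) :
    Tendsto (fun x : ι × ℂ => X x.1 x.2) (L ×ˢ 𝓝 z₀) (𝓝 y₀) := by
  rw [Metric.nhds_basis_closedBall.tendsto_right_iff] at hY ⊢
  intro δ hδ
  obtain ⟨⟨A, B⟩, ⟨hA, hB⟩, hAB⟩ :=
    ((L.basis_sets.prod (nhds_basis_opens z₀)).eventually_iff).1 (hX.and (hXY.and (hY δ hδ)))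
  filter_upwards [prod_mem_prod hA (hB.2.mem_nhds hB.1)] with x hx
  by_contra hfar
  have hfar_near : ∀ᶠ y in 𝓝 x.2, X x.1 y ∉ Metric.closedBall y₀ δ :=
    (hAB hx).1.eventually (Metric.isClosed_closedBall.isOpen_compl.mem_nhds hfar)
  obtain ⟨y, hyS, hyfar, hyB⟩ := ((frequently_notMem_of_countable (hS x.1) x.2).and_eventually
    (hfar_near.and (hB.2.mem_nhds hx.2))).exists
  obtain ⟨-, heq, hclose⟩ := hAB (x := (x.1, y)) ⟨hx.1, hyB⟩
  exact hyfar ((heq hyS).symm ▸ hclose)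

theorem exists_eventually_forall_norm_le {Z : Type*} [TopologicalSpace Z] {X : ι → Z → E}
    {K : Set Z} (hK : IsCompact K)
    (h : ∀ z ∈ K, ∃ M : ℝ, ∀ᶠ x : ι × Z in L ×ˢ 𝓝 z, ‖X x.1 x.2‖ ≤ M) :
    ∃ M : ℝ, ∀ᶠ i in L, ∀ z ∈ K, ‖X i z‖ ≤ M := by
  refine hK.induction_on (p := fun s => ∃ M : ℝ, ∀ᶠ i in L, ∀ z ∈ s, ‖X i z‖ ≤ M) ?_ ?_ ?_ ?_
  · exact ⟨0, by simp⟩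
  · rintro s t hst ⟨M, hM⟩
    exact ⟨M, hM.mono fun i hi z hz => hi z (hst hz)⟩
  · rintro s t ⟨M, hM⟩ ⟨M', hM'⟩
    refine ⟨max M M', (hM.and hM').mono fun i hi z hz => ?_⟩
    rcases hz with hz | hz
    · exact (hi.1 z hz).trans (le_max_left _ _)
    · exact (hi.2 z hz).trans (le_max_right _ _)
  · intro z hz
    obtain ⟨M, hM⟩ := h z hz
    obtain ⟨A, hA, B, hB, hAB⟩ := mem_prod_iff.1 hM
    exact ⟨B, mem_nhdsWithin_of_mem_nhds hB, M, by
      filter_upwards [hA] with i hi y hy using hAB (mk_mem_prod hi hy)⟩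

theorem eventually_forall_of_isCompact {Z : Type*} [TopologicalSpace Z] {K : Set Z}
    (hK : IsCompact K) {P : ι → Z → Prop}
    (h : ∀ z ∈ K, ∀ᶠ x : ι × Z in L ×ˢ 𝓝 z, P x.1 x.2) : ∀ᶠ i in L, ∀ z ∈ K, P i z := by
  have hprod := hK.mem_prod_nhdsSet_of_forall (s := {x : ι × Z | P x.1 x.2}) h
  obtain ⟨A, hA, B, hB, hAB⟩ := mem_prod_iff.1 hprod
  filter_upwards [hA] with i hi z hz using hAB (mk_mem_prod hi (subset_of_mem_nhdsSet hB hz))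

end Limits

theorem exists_sphere_disjoint {Z : Type*} [PseudoMetricSpace Z] {B : Set Z} (hB : B.Countable)
    (z : Z) {R : ℝ} (hR : 0 < R) : ∃ r, 0 < r ∧ r < R ∧ Disjoint (Metric.sphere z r) B := by
  have huncountable : ¬ (Ioo 0 R).Countable := by
    rw [← Cardinal.le_aleph0_iff_set_countable, Cardinal.mk_Ioo_real hR, not_le]
    exact Cardinal.aleph0_lt_continuum
  obtain ⟨r, hr, hrB⟩ : ∃ r ∈ Ioo 0 R, r ∉ (fun y => dist y z) '' B := by
    by_contra! hcover
    exact huncountable ((hB.image _).mono hcover)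
  exact ⟨r, hr.1, hr.2, disjoint_left.2 fun y hy hyB => hrB ⟨y, hyB, hy⟩⟩

-- By the maximum principle it suffices to bound the family on a circle that avoids `B`.
theorem exists_eventually_norm_le_of_tendsto {ι : Type*} {L : Filter ι} {Ω : Set ℂ}
    (hΩ : IsOpen Ω) {X : ι → ℂ → ℂ} {Y : ℂ → ℂ} {B : Set ℂ} (hB : B.Countable)
    (hX : ∀ z ∈ Ω, ∀ᶠ x : ι × ℂ in L ×ˢ 𝓝 z, DifferentiableAt ℂ (X x.1) x.2)
    (hY : ∀ z ∈ Ω, z ∉ B → Tendsto (fun x : ι × ℂ => X x.1 x.2) (L ×ˢ 𝓝 z) (𝓝 (Y z)))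
    {z : ℂ} (hz : z ∈ Ω) : ∃ M : ℝ, ∀ᶠ x : ι × ℂ in L ×ˢ 𝓝 z, ‖X x.1 x.2‖ ≤ M := by
  obtain ⟨R, hR, hRΩ⟩ := Metric.isOpen_iff.1 hΩ z hz
  obtain ⟨r, hr, hrR, hdisj⟩ := exists_sphere_disjoint hB z hR
  have hball : Metric.closedBall z r ⊆ Ω := (Metric.closedBall_subset_ball hrR).trans hRΩ
  obtain ⟨M, hM⟩ : ∃ M, ∀ᶠ i in L, ∀ y ∈ Metric.sphere z r, ‖X i y‖ ≤ M :=
    exists_eventually_forall_norm_le (isCompact_sphere z r) fun y hy =>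
      ⟨‖Y y‖ + 1, ((hY y (hball (Metric.sphere_subset_closedBall hy))
        (disjoint_left.1 hdisj hy)).norm.eventually_lt_const (lt_add_one _)).mono fun _ => le_of_lt⟩
  have hdiff : ∀ᶠ i in L, ∀ y ∈ Metric.closedBall z r, DifferentiableAt ℂ (X i) y :=
    eventually_forall_of_isCompact (isCompact_closedBall z r) fun y hy => hX y (hball hy)
  refine ⟨M, ?_⟩
  filter_upwards [prod_mem_prod (hM.and hdiff) (Metric.ball_mem_nhds z hr)] with x hx
  refine norm_le_of_forall_mem_frontier_norm_le (U := Metric.ball z r) Metric.isBounded_ball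
    (DifferentiableOn.diffContOnCl fun y hy => ?_) (fun y hy => ?_) (subset_closure hx.2)
  · rw [closure_ball _ hr.ne'] at hy
    exact (hx.1.2 y hy).differentiableWithinAt
  · rw [frontier_ball _ hr.ne'] at hy
    exact hx.1.1 y hy

namespace Chain

theorem tendsto_integral_of_dominated {ι : Type*} {L : Filter ι} [L.IsCountablyGenerated]
    {D : Chain} {X : ι → ℂ → ℂ} {Y : ℂ → ℂ} {B : Set ℂ} (hB : B.Countable) {M : ℝ}
    (hcont : ∀ᶠ i in L, ContinuousOn (X i) D.support)
    (hM : ∀ᶠ i in L, ∀ z ∈ D.support, ‖X i z‖ ≤ M)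
    (hlim : ∀ z ∈ D.support, z ∉ B → Tendsto (fun i => X i z) L (𝓝 (Y z))) :
    Tendsto (fun i => D.integral (X i)) L (𝓝 (D.integral Y)) := by
  unfold integral
  refine tendsto_finsetSum _ fun j _ => Tendsto.const_mul _ ?_
  refine intervalIntegral.tendsto_integral_filter_of_dominated_convergence
    (fun s => M * ‖deriv (D.loop j) s‖) ?_ ?_
    ((continuous_const.mul (D.continuous_deriv_loop j).norm).intervalIntegrable _ _) ?_
  · filter_upwards [hcont] with i hi
    rw [uIoc_of_le zero_le_one]
    exact (intervalIntegrable hi j).1.aestronglyMeasurable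
  · filter_upwards [hM] with i hi
    refine Eventually.of_forall fun s hs => ?_
    rw [uIoc_of_le zero_le_one] at hs
    rw [norm_mul]
    exact mul_le_mul_of_nonneg_right (hi _ (D.mem_support j (Ioc_subset_Icc_self hs)))
      (norm_nonneg _)
  · have hae := (countable_setOf_mem_and_deriv_ne_zero
      ((D.smooth j).differentiable one_ne_zero) hB).ae_notMem volume
    filter_upwards [hae] with s hs hs'
    rw [uIoc_of_le zero_le_one] at hs'
    by_cases hderiv : deriv (D.loop j) s = 0
    · simp only [hderiv, mul_zero]
      exact tendsto_const_nhds
    · exact (hlim _ (D.mem_support j (Ioc_subset_Icc_self hs'))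
        fun hsB => hs ⟨hsB, hderiv⟩).mul_const _

theorem tendsto_integral {ι : Type*} {L : Filter ι} [L.IsCountablyGenerated] {D : Chain}
    {Ω : Set ℂ} (hΩ : IsOpen Ω) (hD : D.support ⊆ Ω) {X : ι → ℂ → ℂ} {Y : ℂ → ℂ} {B : Set ℂ}
    (hB : B.Countable)
    (hX : ∀ z ∈ Ω, ∀ᶠ x : ι × ℂ in L ×ˢ 𝓝 z, DifferentiableAt ℂ (X x.1) x.2)
    (hY : ∀ z ∈ Ω, z ∉ B → Tendsto (fun x : ι × ℂ => X x.1 x.2) (L ×ˢ 𝓝 z) (𝓝 (Y z))) :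
    Tendsto (fun i => D.integral (X i)) L (𝓝 (D.integral Y)) := by
  obtain ⟨M, hM⟩ := exists_eventually_forall_norm_le D.isCompact_support fun z hz =>
    exists_eventually_norm_le_of_tendsto hΩ hB hX hY (hD hz)
  have hdiff : ∀ᶠ i in L, ∀ z ∈ D.support, DifferentiableAt ℂ (X i) z :=
    eventually_forall_of_isCompact D.isCompact_support fun z hz => hX z (hD hz)
  refine tendsto_integral_of_dominated hB
    (hdiff.mono fun i hi z hz => (hi z hz).continuousAt.continuousWithinAt) hM fun z hz hzB => ?_
  exact (hY z (hD hz) hzB).comp (tendsto_id.prodMk tendsto_const_nhds)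

end Chain

/-! ### Leading coefficients of expansions -/

namespace NomeSeries

theorem val_le (F : NomeSeries) {s : ℝ} (hs : F.coeff s ≠ 0) : F.val ≤ s := by
  refine csInf_le ?_ hs
  obtain ⟨m, hm⟩ := (F.finite_le s).bddBelow
  refine ⟨min m s, fun u hu => ?_⟩
  rcases le_total u s with h | h
  · exact (min_le_left _ _).trans (hm ⟨h, hu⟩)
  · exact (min_le_right _ _).trans h

theorem sum_ite_eq_lc (F : NomeSeries) {N : ℝ} (hN : F.val ≤ N) (z : ℂ) :
    (∑ s ∈ (F.finite_le N).toFinset,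
      if s = F.val then (F.coeff s).eval (RingHom.id ℂ) z else 0) = F.lc z := by
  rw [Finset.sum_ite_eq', lc]
  split_ifs with hmem
  · rfl
  · have hzero : F.coeff F.val = 0 := by
      by_contra hne
      exact hmem (by simpa using ⟨hN, hne⟩)
    rw [hzero, RatFunc.eval_zero]

theorem tendsto_partialSum (F : NomeSeries) {N : ℝ} (hN : F.val ≤ N) {z₀ : ℂ}
    (hz : ∀ s, (F.coeff s).denom.eval z₀ ≠ 0) :
    Tendsto (fun x : ℂ × ℂ => nomePow (-F.val) x.1 * F.partialSum N x.1 x.2)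
      (nomeToZero ×ˢ 𝓝 z₀) (𝓝 (F.lc z₀)) := by
  have hterm : ∀ s ∈ (F.finite_le N).toFinset, Tendsto
      (fun x : ℂ × ℂ => (F.coeff s).eval (RingHom.id ℂ) x.2 * nomePow (s - F.val) x.1)
      (nomeToZero ×ˢ 𝓝 z₀) (𝓝 (if s = F.val then (F.coeff s).eval (RingHom.id ℂ) z₀ else 0)) := by
    intro s hs
    have hs : s ≤ N ∧ F.coeff s ≠ 0 := by simpa using hs
    have hcoeff : ContinuousAt (fun z => (F.coeff s).eval (RingHom.id ℂ) z) z₀ :=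
      (F.coeff s).num.continuous.continuousAt.div (F.coeff s).denom.continuous.continuousAt (hz s)
    have hlim := tendsto_mul_nomePow tendsto_fst
      (hcoeff.tendsto.comp (tendsto_snd (f := nomeToZero))) (sub_nonneg.2 (F.val_le hs.2))
    simpa only [sub_eq_zero, Function.comp_apply] using hlim
  rw [← F.sum_ite_eq_lc hN]
  refine (tendsto_finsetSum _ hterm).congr fun x => ?_
  rw [partialSum, Finset.mul_sum]
  refine Finset.sum_congr rfl fun s _ => ?_
  rw [sub_eq_add_neg, nomePow_add]
  ring

theorem ConvergesTo.exists_tendsto {F : NomeSeries} {f : ℂ → ℂ → ℂ} (h : F.ConvergesTo f) :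
    ∃ P : Polynomial ℂ, P ≠ 0 ∧ ∀ z₀, z₀ ≠ 0 → P.eval z₀ ≠ 0 →
      Tendsto (fun x : ℂ × ℂ => nomePow (-F.val) x.1 * f x.1 x.2) (nomeToZero ×ˢ 𝓝 z₀)
        (𝓝 (F.lc z₀)) := by
  obtain ⟨P, hP0, hden, hconv⟩ := h
  refine ⟨P, hP0, fun z₀ hz0 hPz => ?_⟩
  have hopen : IsOpen {z : ℂ | z ≠ 0 ∧ P.eval z ≠ 0} :=
    isOpen_ne.inter (isOpen_ne_fun P.continuous continuous_const)
  obtain ⟨r, hr, hrK⟩ := Metric.nhds_basis_closedBall.mem_iff.1 (hopen.mem_nhds ⟨hz0, hPz⟩)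
  obtain ⟨M, hM⟩ := hconv _ (isCompact_closedBall z₀ r) hrK
  rw [Metric.tendsto_nhds]
  intro δ hδ
  obtain ⟨N, hN, hNval⟩ := ((Metric.tendstoUniformlyOn_iff.1 hM (δ / 2) (half_pos hδ)).and
    (eventually_ge_atTop F.val)).exists
  have hpartial := Metric.tendsto_nhds.1
    (F.tendsto_partialSum hNval fun s => hden s z₀ hz0 hPz) (δ / 2) (half_pos hδ)
  have hmem : ∀ᶠ x : ℂ × ℂ in nomeToZero ×ˢ 𝓝 z₀,
      x ∈ {l : ℂ | l.re ≤ M} ×ˢ Metric.closedBall z₀ r :=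
    prod_mem_prod (tendsto_re_nomeToZero.eventually (eventually_le_atBot M))
      (Metric.closedBall_mem_nhds z₀ hr)
  filter_upwards [hpartial, hmem] with x hx hxK
  linarith [hN x hxK, dist_triangle (nomePow (-F.val) x.1 * f x.1 x.2)
    (nomePow (-F.val) x.1 * F.partialSum N x.1 x.2) (F.lc z₀)]

end NomeSeries

/-! ### Contours for the limiting form -/

section Contours

variable {q : ℂ} {τ t : Fin 6 → ℂ} {α : Fin 6 → ℝ} {ζ : ℝ} {a b : Fin 6} {mf mg : ℕ}

theorem shifted_mul_ne (hq0 : q ≠ 0) (hgen : ∀ (r s : Fin 6) (n : ℤ), t r * t s ≠ q ^ n)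
    (mf mg : ℕ) (r s : Fin 6) (n : ℤ) : shifted q mf mg t r * shifted q mf mg t s ≠ q ^ n := by
  rw [shifted_eq, shifted_eq]
  intro h
  refine hgen r s (n + shiftOrder mf mg r + shiftOrder mf mg s) ?_
  rw [zpow_add₀ hq0, zpow_add₀ hq0, ← h, zpow_natCast, zpow_natCast]
  field_simp

theorem limInner_subset (q : ℂ) (τ : Fin 6 → ℂ) (a b : Fin 6) :
    limInner q τ a b ⊆ ellInner τ q q := by
  rintro z ⟨k, rfl | rfl⟩
  · exact ⟨a, 0, k, by ring⟩
  · exact ⟨b, 0, k, by ring⟩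

theorem limOuter_subset (q : ℂ) (τ : Fin 6 → ℂ) (α : Fin 6 → ℝ) (ζ : ℝ) (a b : Fin 6) :
    limOuter q τ α ζ a b ⊆ ellOuter τ q q := by
  rintro z ⟨r, k, -, rfl⟩
  exact ⟨r, 0, k, by ring⟩

theorem finite_limInner (hq : ‖q‖ < 1) (τ : Fin 6 → ℂ) (a b : Fin 6) {δ : ℝ} (hδ : 0 < δ) :
    {x ∈ limInner q τ a b | δ ≤ ‖x‖}.Finite :=
  (finite_ellInner hq hq τ hδ).subset fun _ hx => ⟨limInner_subset _ _ _ _ hx.1, hx.2⟩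

theorem finite_limOuter (hq0 : q ≠ 0) (hq : ‖q‖ < 1) (hτ : ∀ r, τ r ≠ 0) (α : Fin 6 → ℝ)
    (ζ : ℝ) (a b : Fin 6) (R : ℝ) : {x ∈ limOuter q τ α ζ a b | ‖x‖ ≤ R}.Finite :=
  (finite_ellOuter hq0 hq hq0 hq hτ R).subset
    fun _ hx => ⟨limOuter_subset _ _ _ _ _ _ hx.1, hx.2⟩

theorem zero_mem_closure_limInner (hq : ‖q‖ < 1) (τ : Fin 6 → ℂ) (a b : Fin 6) :
    0 ∈ closure (limInner q τ a b) := by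
  have hlim : Tendsto (fun j : ℕ => τ a * q ^ j) atTop (𝓝 0) := by
    simpa using (tendsto_pow_atTop_nhds_zero_of_norm_lt_one hq).const_mul (τ a)
  exact mem_closure_of_tendsto hlim (Eventually.of_forall fun j => ⟨j, Or.inl rfl⟩)

theorem disjoint_limInner_limOuter (hq0 : q ≠ 0) (hτ : ∀ r, τ r ≠ 0)
    (hgen : ∀ (r s : Fin 6) (n : ℤ), τ r * τ s ≠ q ^ n) (α : Fin 6 → ℝ) (ζ : ℝ) (a b : Fin 6) :
    Disjoint (limInner q τ a b) (limOuter q τ α ζ a b) := by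
  have hne (c r : Fin 6) (j k : ℕ) : τ c * q ^ j ≠ (τ r * q ^ k)⁻¹ := by
    intro h
    have hr := hτ r
    refine hgen c r (-(j + k)) ?_
    rw [zpow_neg, zpow_add₀ hq0, zpow_natCast, zpow_natCast]
    field_simp at h ⊢
    linear_combination h
  refine disjoint_left.2 ?_
  rintro z ⟨j, hz | hz⟩ ⟨r, k, -, hz'⟩
  · exact hne a r j k (hz.symm.trans hz')
  · exact hne b r j k (hz.symm.trans hz')

theorem exists_separates_lim (hq0 : q ≠ 0) (hq : ‖q‖ < 1) (hτ : ∀ r, τ r ≠ 0)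
    (hgen : ∀ (r s : Fin 6) (n : ℤ), τ r * τ s ≠ q ^ n) (α : Fin 6 → ℝ) (ζ : ℝ) (a b : Fin 6) :
    ∃ C : Chain, C.Separates (limInner q τ a b) (limOuter q τ α ζ a b) := by
  have h0 := zero_notMem_ellInner hq0 hq0 hτ
  obtain ⟨C, hC, -⟩ := Chain.exists_separates (disjoint_limInner_limOuter hq0 hτ hgen α ζ a b)
    (fun h => h0 (limInner_subset _ _ _ _ h))
    (fun h => h0 (by simpa using mem_ellOuter_iff.1 (limOuter_subset _ _ _ _ _ _ h)))
    (fun _ => finite_limInner hq τ a b) (finite_limOuter hq0 hq hτ α ζ a b)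
  exact ⟨C, hC⟩

theorem isOpen_limDomain (hq0 : q ≠ 0) (hq : ‖q‖ < 1) (hτ : ∀ r, τ r ≠ 0) :
    IsOpen (limDomain q τ α ζ a b) := by
  rw [isOpen_iff_mem_nhds]
  rintro z ⟨hz0, hzi, hzo⟩
  have hz := norm_pos_iff.2 hz0
  filter_upwards [isOpen_ne.mem_nhds hz0,
    (finite_limInner hq τ a b (half_pos hz)).isClosed.isOpen_compl.mem_nhds fun h => hzi h.1,
    (finite_limOuter hq0 hq hτ α ζ a b (‖z‖ + 1)).isClosed.isOpen_compl.mem_nhds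
      fun h => hzo h.1,
    continuous_norm.continuousAt.eventually (lt_mem_nhds (half_lt_self hz)),
    continuous_norm.continuousAt.eventually (gt_mem_nhds (lt_add_one ‖z‖))]
    with y hy0 hyi hyo hlower hupper
  exact ⟨hy0, fun h => hyi ⟨h, hlower.le⟩, fun h => hyo ⟨h, hupper.le⟩⟩

theorem Chain.Separates.support_subset_limDomain {D : Chain}
    (hD : D.Separates (limInner q τ a b) (limOuter q τ α ζ a b)) :
    D.support ⊆ limDomain q τ α ζ a b := fun _ hz =>
  ⟨fun h => hD.zero_notMem (h ▸ hz), disjoint_left.1 hD.disjoint_inner hz,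
    disjoint_left.1 hD.disjoint_outer hz⟩

/-! ### Comparison of the contours -/

theorem eventually_dilate_support_subset (hq : ‖q‖ < 1) (h : Exponents α ζ a b) {D : Chain}
    (hD : D.Separates (limInner q (shifted q mf mg t) a b)
      (limOuter q (shifted q mf mg t) α ζ a b)) :
    ∀ᶠ l in nomeToZero, (D.dilate (nomePow ζ l)).support ⊆
      regularDomain (shifted q mf mg (scaled t α l)) (nomeShift a b l) (exp l) q := by
  filter_upwards [eventually_forall_of_isCompact (P := fun l z => nomePow ζ l * z ∈
      regularDomain (shifted q mf mg (scaled t α l)) (nomeShift a b l) (exp l) q)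
    D.isCompact_support fun z hz => eventually_mem_regularDomain hq h
      (hD.support_subset_limDomain hz)] with l hl
  rw [Chain.support_dilate]
  rintro _ ⟨z, hz, rfl⟩
  exact hl z hz

-- An inner singularity either lies in `limInner`, or tends to `0`.
theorem Chain.Separates.eventually_winding_eq_one (hq : ‖q‖ < 1) (h : Exponents α ζ a b)
    {D : Chain} (hD : D.Separates (limInner q τ a b) (limOuter q τ α ζ a b)) :
    ∀ᶠ l in nomeToZero, ∀ (r : Fin 6) (i j : ℕ),
      D.winding (τ r * nomePow (α r - ζ) l * exp l ^ i * q ^ j) = 1 := by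
  obtain ⟨δ, hδ, hball⟩ := Chain.exists_ball_winding_eq hD.zero_notMem
  filter_upwards [eventually_all.2 fun r =>
    eventually_norm_mul_nomePow_lt hq (τ r) (h.innerExp_mem r).1 hδ] with l hsmall r i j
  by_cases hfixed : i = 0 ∧ α r - ζ = 0
  · refine hD.winding_inner _ ⟨j, ?_⟩
    rw [hfixed.1, hfixed.2, nomePow_zero, mul_one, pow_zero, mul_one]
    exact ((h.innerExp_eq_zero r).1 hfixed.2).imp (fun hr => by rw [hr]) fun hr => by rw [hr]
  · rw [(hball _ (by simpa using hsmall r i j hfixed)).2]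
    exact hD.winding_zero (zero_mem_closure_limInner hq τ a b)

-- An outer singularity either lies in `limOuter`, or tends to infinity.
theorem Chain.Separates.eventually_winding_eq_zero (hq : ‖q‖ < 1) (h : Exponents α ζ a b)
    {D : Chain} (hD : D.Separates (limInner q τ a b) (limOuter q τ α ζ a b)) :
    ∀ᶠ l in nomeToZero, ∀ (r : Fin 6) (i j : ℕ) (y : ℂ),
      τ r * nomePow (outerExp α ζ a b r) l * exp l ^ i * q ^ j * y = 1 → D.winding y = 0 := by
  obtain ⟨R, hR, -, hfar⟩ := D.exists_winding_eq_zero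
  filter_upwards [eventually_all.2 fun r =>
    eventually_norm_mul_nomePow_lt hq (τ r) (h.outerExp_mem r).1 (inv_pos.2 hR)]
    with l hsmall r i j y hy
  by_cases hfixed : i = 0 ∧ outerExp α ζ a b r = 0
  · refine hD.winding_outer _ ⟨r, j, (h.outerExp_eq_zero r).1 hfixed.2, ?_⟩
    rw [hfixed.1, hfixed.2, nomePow_zero, mul_one, pow_zero, mul_one] at hy
    exact eq_inv_of_mul_eq_one_right hy
  · refine hfar y ?_
    have hnorm := congrArg norm hy
    rw [norm_mul, norm_one] at hnorm
    by_contra! hlt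
    have hprod := mul_lt_mul'' (hsmall r i j hfixed) hlt (norm_nonneg _) (norm_nonneg _)
    rw [hnorm, inv_mul_cancel₀ hR.ne'] at hprod
    exact lt_irrefl _ hprod

theorem eq_zero_or_mem_of_notMem_regularDomain (hq : ‖q‖ < 1) {l y : ℂ} (hp : ‖exp l‖ < 1)
    (hy : nomePow ζ l * y ∉
      regularDomain (shifted q mf mg (scaled t α l)) (nomeShift a b l) (exp l) q) :
    y = 0 ∨
    (nomePow ζ l * y ∈ scaledInner q mf mg t α l ∧ ∃ (r : Fin 6) (i j : ℕ),
      y = shifted q mf mg t r * nomePow (α r - ζ) l * exp l ^ i * q ^ j) ∨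
    (nomePow ζ l * y ∈ scaledOuter q mf mg t α l ∧ ∃ (r : Fin 6) (i j : ℕ),
      shifted q mf mg t r * nomePow (outerExp α ζ a b r) l * exp l ^ i * q ^ j * y = 1) := by
  refine or_iff_not_imp_left.2 fun hy0 => ?_
  have hζ := nomePow_ne_zero ζ l
  obtain ⟨r, hr⟩ : ∃ r, pqPoch (nomeShift a b l r * shifted q mf mg (scaled t α l) r *
      (nomePow ζ l * y)) (exp l) q = 0 ∨
      pqPoch (shifted q mf mg (scaled t α l) r * (nomePow ζ l * y)⁻¹) (exp l) q = 0 := by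
    by_contra! hregular
    exact hy ⟨mul_ne_zero hζ hy0, hregular⟩
  rcases hr with hr | hr
  · obtain ⟨i, j, hij⟩ := pqPoch_eq_zero hp hq hr
    refine Or.inr ⟨?_, r, i, j, ?_⟩
    · rw [scaledOuter, mem_ellOuter_iff]
      rcases nomeShift_eq a b l r with hshift | hshift
      · refine ⟨r, i, j, inv_eq_of_mul_eq_one_right ?_⟩
        rw [← hij, hshift]
        ring
      · refine ⟨r, i + 1, j, inv_eq_of_mul_eq_one_right ?_⟩
        rw [← hij, hshift]
        ring
    · rw [shifted_scaled, nomeShift_mul] at hij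
      rw [← hij]
      ring
  · obtain ⟨i, j, hij⟩ := pqPoch_eq_zero hp hq hr
    refine Or.inl ⟨⟨r, i, j, ?_⟩, r, i, j, ?_⟩
    · field_simp at hij
      rw [← hij]
      ring
    · rw [shifted_scaled, mul_nomePow_inv] at hij
      field_simp at hij
      exact hij.symm

theorem eventually_dilate_winding_eq (hq : ‖q‖ < 1) (h : Exponents α ζ a b) {D : Chain}
    (hD : D.Separates (limInner q (shifted q mf mg t) a b)
      (limOuter q (shifted q mf mg t) α ζ a b)) :
    ∀ᶠ l in nomeToZero, ∀ C : Chain,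
      C.Separates (scaledInner q mf mg t α l) (scaledOuter q mf mg t α l) →
      ∀ x ∉ regularDomain (shifted q mf mg (scaled t α l)) (nomeShift a b l) (exp l) q,
        (D.dilate (nomePow ζ l)).winding x = C.winding x := by
  filter_upwards [hD.eventually_winding_eq_one hq h, hD.eventually_winding_eq_zero hq h,
    eventually_norm_exp_lt_one] with l hone hzero hp C hC x hx
  have hζ := nomePow_ne_zero ζ l
  obtain ⟨y, rfl⟩ : ∃ y, x = nomePow ζ l * y := ⟨x / nomePow ζ l, by field_simp⟩
  rw [Chain.winding_dilate hζ]
  rcases eq_zero_or_mem_of_notMem_regularDomain hq hp hx with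
    rfl | ⟨hinner, r, i, j, rfl⟩ | ⟨houter, r, i, j, hy⟩
  · rw [mul_zero, hD.winding_zero (zero_mem_closure_limInner hq _ a b)]
    exact (hC.winding_zero (zero_mem_closure_ellInner hq _)).symm
  · rw [hone, hC.winding_inner _ hinner]
  · rw [hzero r i j y hy, hC.winding_outer _ houter]

/-! ### Nonresonance -/

theorem countable_setOf_exp_mul_eq {c : ℂ} (hc : c ≠ 0) (v : ℂ) :
    {l : ℂ | exp (c * l) = v}.Countable := by
  refine (countable_range fun n : ℤ => (log v + n * (2 * Real.pi * I)) / c).mono fun l hl => ?_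
  have hl : exp (c * l) = v := hl
  have hv : v ≠ 0 := hl ▸ exp_ne_zero _
  rw [← exp_log hv, exp_eq_exp_iff_exists_int] at hl
  obtain ⟨n, hn⟩ := hl
  exact ⟨n, by simp only [← hn, mul_div_cancel_left₀ _ hc]⟩

theorem countable_setOf_mul_nomePow_eq_one {c : ℂ} {s : ℝ} (h : s = 0 → c ≠ 1) :
    {l : ℂ | c * nomePow s l = 1}.Countable := by
  by_cases hs : s = 0
  · simp only [hs, nomePow_zero, mul_one, h hs, ofPred_false, countable_empty]
  · refine (countable_setOf_exp_mul_eq (ofReal_ne_zero.2 hs) c⁻¹).mono fun l hl => ?_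
    exact eq_inv_of_mul_eq_one_right hl

theorem exists_mul_nomePow_eq_one_of_notMem_nonresonant (hq0 : q ≠ 0) (ht : ∀ r, t r ≠ 0) {l : ℂ}
    (hl : l ∉ nonresonant q mf mg t α) : ∃ (r s : Fin 6) (n m : ℕ),
      q ^ m * (shifted q mf mg t r * shifted q mf mg t s) * nomePow (α r + α s + n) l = 1 := by
  obtain ⟨z, ⟨r, i, j, hinner⟩, ⟨s, i', j', houter⟩⟩ := not_disjoint_iff.1 hl
  refine ⟨r, s, i + i', j + j', ?_⟩
  have hs : shifted q mf mg (scaled t α l) s ≠ 0 :=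
    shifted_ne_zero hq0 (fun r => mul_ne_zero (ht r) (nomePow_ne_zero _ _)) mf mg s
  have hp0 := exp_ne_zero l
  rw [hinner, ← mul_eq_one_iff_eq_inv₀ (mul_ne_zero
    (mul_ne_zero (pow_ne_zero i' hp0) (pow_ne_zero j' hq0)) hs)] at houter
  rw [← houter, shifted_scaled, shifted_scaled, Nat.cast_add, nomePow_add, nomePow_add,
    nomePow_add, nomePow_natCast, nomePow_natCast]
  ring

theorem countable_compl_nonresonant (hq0 : q ≠ 0) (ht : ∀ r, t r ≠ 0)
    (hgen : ∀ (r s : Fin 6) (n : ℤ), t r * t s ≠ q ^ n) (mf mg : ℕ) (α : Fin 6 → ℝ) :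
    (nonresonant q mf mg t α)ᶜ.Countable := by
  have hne (r s : Fin 6) (m : ℕ) : q ^ m * (shifted q mf mg t r * shifted q mf mg t s) ≠ 1 := by
    intro h
    refine shifted_mul_ne hq0 hgen mf mg r s (-m) ?_
    rw [zpow_neg, zpow_natCast]
    exact eq_inv_of_mul_eq_one_right h
  have hcount : (⋃ x : (Fin 6 × Fin 6) × ℕ × ℕ, {l | q ^ x.2.2 *
      (shifted q mf mg t x.1.1 * shifted q mf mg t x.1.2) *
        nomePow (α x.1.1 + α x.1.2 + x.2.1) l = 1}).Countable :=
    countable_iUnion fun x => countable_setOf_mul_nomePow_eq_one fun _ => hne _ _ _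
  refine hcount.mono fun l hl => ?_
  obtain ⟨r, s, n, m, h⟩ := exists_mul_nomePow_eq_one_of_notMem_nonresonant hq0 ht hl
  exact mem_iUnion.2 ⟨⟨⟨r, s⟩, n, m⟩, h⟩

theorem frequently_nonresonant (hq0 : q ≠ 0) (ht : ∀ r, t r ≠ 0)
    (hgen : ∀ (r s : Fin 6) (n : ℤ), t r * t s ≠ q ^ n) (mf mg : ℕ) (α : Fin 6 → ℝ) :
    ∃ᶠ l in nomeToZero, l ∈ nonresonant q mf mg t α := by
  intro hresonant
  obtain ⟨A, hA, hsub⟩ := mem_comap.1 hresonant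
  obtain ⟨M, hM⟩ := mem_atBot_sets.1 hA
  have hopen : IsOpen {l : ℂ | l.re < M} := isOpen_lt continuous_re continuous_const
  have hmem : ((M - 1 : ℝ) : ℂ) ∈ {l : ℂ | l.re < M} := by simp
  obtain ⟨l, hl, hlM⟩ := ((frequently_notMem_of_countable
    (countable_compl_nonresonant hq0 ht hgen mf mg α) _).and_eventually
      (hopen.mem_nhds hmem)).exists
  exact hl (hsub (hM _ (le_of_lt hlM)))

theorem pqPoch_ne_zero_of_nonresonant (hq0 : q ≠ 0) (hq : ‖q‖ < 1) (ht : ∀ r, t r ≠ 0) {l : ℂ}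
    (hl : l ∈ nonresonant q mf mg t α) (hp : ‖exp l‖ < 1) (r s : Fin 6) :
    pqPoch (scaled t α l r * scaled t α l s) (exp l) q ≠ 0 := by
  intro hzero
  obtain ⟨i, j, hij⟩ := pqPoch_eq_zero hp hq hzero
  have hs : scaled t α l s ≠ 0 := mul_ne_zero (ht s) (nomePow_ne_zero _ _)
  have hinner : exp l ^ i * q ^ (j + shiftOrder mf mg r + shiftOrder mf mg s) *
      shifted q mf mg (scaled t α l) r ∈ scaledInner q mf mg t α l := ⟨r, i, _, rfl⟩
  refine disjoint_left.1 (mem_ofPred_eq.mp hl) hinner ⟨s, 0, 0, ?_⟩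
  rw [shifted_eq, shifted_eq, pow_add, pow_add]
  field_simp
  linear_combination hij

theorem eventually_qPoch_div_ne_zero (hq : ‖q‖ < 1) (h : Exponents α ζ a b) :
    ∀ᶠ l in nomeToZero, qPoch (q / (scaled t α l a * scaled t α l b)) q ≠ 0 := by
  have harg (l : ℂ) : q / (scaled t α l a * scaled t α l b) =
      q / (t a * t b) * nomePow (-ζ + -ζ) l := by
    rw [scaled, scaled, h.left, h.right, nomePow_add, nomePow_neg]
    have := nomePow_ne_zero ζ l
    field_simp
  have hlim : Tendsto (fun l => q / (t a * t b) * nomePow (-ζ + -ζ) l) nomeToZero (𝓝 0) := by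
    simpa using (tendsto_nomePow (s := -ζ + -ζ) (by linarith [h.neg])).const_mul (q / (t a * t b))
  have hqPoch := (differentiable_qPoch hq).continuous.continuousAt.tendsto.comp hlim
  rw [qPoch_zero_left] at hqPoch
  simp only [harg]
  exact hqPoch.eventually_ne one_ne_zero

end Contours

/-! ### The constant in front of the integral -/

theorem prod_Ioi_eq_prod {ι : Type*} [LinearOrder ι] [Fintype ι] [LocallyFiniteOrderTop ι]
    [LocallyFiniteOrderBot ι] {u v : ι → ι → ℂ} (huv : ∀ r s, r ≠ s → u r s = v r s * v s r)
    (hv : ∀ r, v r r = 1) : ∏ r, ∏ s ∈ Finset.Ioi r, u r s = ∏ r, ∏ s, v r s := by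
  have hpairs : ∏ r, ∏ s ∈ Finset.Ioi r, u r s = ∏ r, ∏ s ∈ Finset.Ioi r, v r s * v s r :=
    Finset.prod_congr rfl fun r _ => Finset.prod_congr rfl fun s hs =>
      huv r s (Finset.mem_Ioi.1 hs).ne
  rw [hpairs, Finset.prod_prod_Ioi_mul_eq_prod_prod_off_diag fun s r => v r s]
  refine Finset.prod_congr rfl fun r _ => Finset.prod_subset (Finset.subset_univ _) fun s _ hs => ?_
  simp only [Finset.mem_compl, Finset.mem_singleton, not_not] at hs
  rw [hs, hv]

theorem prod_ite_and_eq {ι : Type*} [DecidableEq ι] [Fintype ι] (b : ι) (Q : ι → Prop)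
    [DecidablePred Q] (X : ι → ℂ) :
    (∏ r, ∏ s, if s = b ∧ Q r then X r else 1) = ∏ r with Q r, X r := by
  rw [Finset.prod_filter]
  refine Finset.prod_congr rfl fun r _ => ?_
  by_cases h : Q r <;> simp [h]

/-- The exponent of `p` in the argument of `Γ(t_r t_s p^{α_r + α_s})`, raised by one for the pair
`a`, `b`, since `θ(x;q) Γ(x;p,q) = Γ(px;p,q)` and the factor `θ(t_a t_b;q)` is absorbed there. -/
def pairExp (α : Fin 6 → ℝ) (a b r s : Fin 6) : ℝ :=
  α r + α s + if (r = a ∧ s = b) ∨ (r = b ∧ s = a) then 1 else 0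

section Prefactor

variable {q : ℂ} {t : Fin 6 → ℂ} {α : Fin 6 → ℝ} {ζ : ℝ} {a b : Fin 6} {mf mg : ℕ}

namespace Exponents

theorem add_le_one (h : Exponents α ζ a b) (hsum : ∑ r, α r = 1) {r s : Fin 6} (hrs : r ≠ s)
    (hra : r ≠ a) (hrb : r ≠ b) (hsa : s ≠ a) (hsb : s ≠ b) : α r + α s ≤ 1 := by
  have hab := h.ne
  set A : Finset (Fin 6) := {a, b, r, s} with hA
  have hsumA : ∑ i ∈ A, α i = ζ + (ζ + (α r + α s)) := by
    rw [hA, Finset.sum_insert (by simp [hab, hra.symm, hsa.symm]),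
      Finset.sum_insert (by simp [hrb.symm, hsb.symm]), Finset.sum_pair hrs, h.left, h.right]
  have hcard : Aᶜ.card = 2 := by
    have hcardA : A.card = 4 := by
      rw [hA, Finset.card_insert_of_notMem (by simp [hab, hra.symm, hsa.symm]),
        Finset.card_insert_of_notMem (by simp [hrb.symm, hsb.symm]), Finset.card_pair hrs]
    rw [Finset.card_compl, hcardA, Fintype.card_fin]
  have hcompl := Finset.card_nsmul_le_sum Aᶜ α (-ζ) fun i hi => by
    have hi : i ≠ a ∧ i ≠ b ∧ i ≠ r ∧ i ≠ s := by simpa [hA] using hi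
    exact (h.other i hi.1 hi.2.1).1
  simp only [hcard, nsmul_eq_mul, Nat.cast_ofNat] at hcompl
  have htotal := Finset.sum_add_sum_compl A α
  linarith

theorem pairExp_mem (h : Exponents α ζ a b) (hsum : ∑ r, α r = 1) {r s : Fin 6} (hrs : r ≠ s) :
    0 ≤ pairExp α a b r s ∧ pairExp α a b r s ≤ 1 := by
  have hlower := h.lower; have hneg := h.neg; have ha := h.left; have hb := h.right
  unfold pairExp
  split_ifs with hc
  · rcases hc with ⟨rfl, rfl⟩ | ⟨rfl, rfl⟩ <;> constructor <;> linarith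
  · have one_special : ∀ r s, r ≠ s → (r = a ∨ r = b) →
        ¬ ((r = a ∧ s = b) ∨ (r = b ∧ s = a)) → 0 ≤ α r + α s ∧ α r + α s ≤ 1 := by
      intro r s hrs hr hc
      have hα : α r = ζ := by rcases hr with rfl | rfl <;> assumption
      obtain ⟨hge, hle⟩ := h.other s (by grind) (by grind)
      constructor <;> linarith
    rw [add_zero]
    by_cases hr : r = a ∨ r = b
    · exact one_special r s hrs hr hc
    by_cases hs : s = a ∨ s = b
    · rw [add_comm]
      exact one_special s r hrs.symm hs (by tauto)
    rw [not_or] at hr hs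
    refine ⟨?_, h.add_le_one hsum hrs hr.1 hr.2 hs.1 hs.2⟩
    linarith [(h.other r hr.1 hr.2).1, (h.other s hs.1 hs.2).1]

theorem pairExp_eq_one_iff (h : Exponents α ζ a b) (r s : Fin 6) :
    pairExp α a b r s = 1 ↔ α r + α s = 1 := by
  have hneg := h.neg; have ha := h.left; have hb := h.right
  unfold pairExp
  split_ifs with hc
  · rcases hc with ⟨rfl, rfl⟩ | ⟨rfl, rfl⟩ <;> constructor <;> intro <;> linarith
  · rw [add_zero]

theorem ite_pairExp_eq_zero (h : Exponents α ζ a b) {P : Fin 6 → Fin 6 → ℂ}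
    (hP : ∀ r s, P r s = P s r) {r s : Fin 6} (hrs : r ≠ s) :
    (if pairExp α a b r s = 0 then P r s else 1) =
      ((if s = a ∧ α r = -ζ then P r a else 1) * (if s = b ∧ α r = -ζ then P r b else 1) *
        (if s = b ∧ (r = a ∧ ζ = -1 / 2) then P r b else 1)) *
      ((if r = a ∧ α s = -ζ then P s a else 1) * (if r = b ∧ α s = -ζ then P s b else 1) *
        (if r = b ∧ (s = a ∧ ζ = -1 / 2) then P s b else 1)) := by
  have hneg := h.neg; have ha := h.left; have hb := h.right; have hab := h.ne
  have hne : ζ ≠ -ζ := by linarith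
  have half_iff : ζ + ζ + 1 = 0 ↔ ζ = -1 / 2 := by grind
  have add_left_iff : ∀ x : ℝ, ζ + x = 0 ↔ x = -ζ := by grind
  have add_right_iff : ∀ x : ℝ, x + ζ = 0 ↔ x = -ζ := by grind
  unfold pairExp
  by_cases hra : r = a
  · subst hra
    by_cases hsb : s = b
    · subst hsb
      simp [ha, hb, hne, hab, hab.symm, half_iff]
    · simp [ha, hne, hab, hsb, hrs.symm, add_left_iff, hP r s]
  by_cases hrb : r = b
  · subst hrb
    by_cases hsa : s = a
    · subst hsa
      simp [ha, hb, hne, hab, hab.symm, half_iff, hP r s]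
    · simp [hb, hne, hra, hsa, hrs.symm, add_left_iff, hP r s]
  by_cases hsa : s = a
  · subst hsa
    simp [ha, hra, hrb, hab, add_right_iff]
  by_cases hsb : s = b
  · subst hsb
    simp [hb, hra, hrb, hab.symm, add_right_iff]
  have hsum_ne : α r + α s ≠ 0 := by
    linarith [(h.other r hra hrb).1, (h.other s hsa hsb).1]
  simp [hra, hrb, hsa, hsb, hsum_ne]

theorem prod_pairExp_eq_zero (h : Exponents α ζ a b) {P : Fin 6 → Fin 6 → ℂ}
    (hP : ∀ r s, P r s = P s r) :
    (∏ r, ∏ s ∈ Finset.Ioi r, if pairExp α a b r s = 0 then P r s else 1) =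
      (if ζ = -1 / 2 then P a b else 1) * ∏ r with α r = -ζ, P r a * P r b := by
  have ha := h.left; have hb := h.right; have hab := h.ne
  have hne : ζ ≠ -ζ := by linarith [h.neg]
  rw [prod_Ioi_eq_prod (fun r s hrs => h.ite_pairExp_eq_zero hP hrs)]
  · simp only [Finset.prod_mul_distrib]
    rw [prod_ite_and_eq a, prod_ite_and_eq b, prod_ite_and_eq b, mul_comm]
    congr 1
    split_ifs with hζ
    · simp [hζ, Finset.prod_filter]
    · simp [hζ]
  · intro r
    by_cases hra : r = a
    · subst hra
      simp [ha, hne, hab]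
    · by_cases hrb : r = b
      · subst hrb
        simp [hb, hne, hra]
      · simp [hra, hrb]

end Exponents

theorem prod_ite_pair {a b : Fin 6} (hab : a ≠ b) (c : ℂ) :
    (∏ r, ∏ s ∈ Finset.Ioi r, if (r = a ∧ s = b) ∨ (r = b ∧ s = a) then c else 1) = c := by
  rw [prod_Ioi_eq_prod (v := fun r s => if s = b ∧ r = a then c else 1)]
  · rw [prod_ite_and_eq b fun r => r = a]
    simp [Finset.filter_eq']
  · intro r s hrs
    grind
  · intro r
    grind

theorem qPoch_ne_zero_of_forall_ne (hq : ‖q‖ < 1) {x : ℂ} (hx : ∀ n : ℤ, x ≠ q ^ n) :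
    qPoch x q ≠ 0 := by
  intro h0
  obtain ⟨j, hj⟩ := qPoch_eq_zero hq h0
  refine hx (-j) ?_
  rw [zpow_neg, zpow_natCast]
  exact eq_inv_of_mul_eq_one_left hj

theorem theta_mul_prod_ellGamma (hq : ‖q‖ < 1) (hab : a ≠ b) {l : ℂ} (hp : ‖exp l‖ < 1)
    (hne : pqPoch (scaled t α l a * scaled t α l b) (exp l) q ≠ 0) :
    theta (scaled t α l a * scaled t α l b) q *
      ∏ r, ∏ s ∈ Finset.Ioi r, ellGamma (scaled t α l r * scaled t α l s) (exp l) q =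
    ∏ r, ∏ s ∈ Finset.Ioi r, ellGamma (t r * t s * nomePow (pairExp α a b r s) l) (exp l) q := by
  rw [← prod_ite_pair hab (theta (scaled t α l a * scaled t α l b) q), ← Finset.prod_mul_distrib]
  refine Finset.prod_congr rfl fun r _ => ?_
  rw [← Finset.prod_mul_distrib]
  refine Finset.prod_congr rfl fun s _ => ?_
  have hscaled : t r * t s * nomePow (α r + α s) l = scaled t α l r * scaled t α l s := by
    rw [nomePow_add, scaled, scaled]
    ring
  have hshift := ellGamma_mul_left hp hq (exp_ne_zero l) hne
  unfold pairExp
  split_ifs with hc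
  · rw [nomePow_add, nomePow_one, ← mul_assoc, hscaled, mul_comm _ (exp l)]
    rcases hc with ⟨rfl, rfl⟩ | ⟨rfl, rfl⟩
    · exact hshift.symm
    · rw [mul_comm (scaled t α l r), hshift]
  · rw [add_zero, one_mul, hscaled]

theorem tendsto_ellGamma_pair (hq : ‖q‖ < 1) (ht : ∀ r, t r ≠ 0)
    (hgen : ∀ (r s : Fin 6) (n : ℤ), t r * t s ≠ q ^ n) (h : Exponents α ζ a b)
    (hsum : ∑ r, α r = 1) {r s : Fin 6} (hrs : r ≠ s) :
    Tendsto (fun l => ellGamma (t r * t s * nomePow (pairExp α a b r s) l) (exp l) q) nomeToZero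
      (𝓝 ((if α r + α s = 1 then qPoch (q / (t r * t s)) q else 1) /
        (if pairExp α a b r s = 0 then qPoch (t r * t s) q else 1))) := by
  obtain ⟨hnonneg, hle⟩ := h.pairExp_mem hsum hrs
  have := tendsto_ellGamma hq tendsto_id (tendsto_const_nhds (x := t r * t s))
    (mul_ne_zero (ht r) (ht s)) hnonneg hle fun _ => qPoch_ne_zero_of_forall_ne hq (hgen r s)
  simpa only [h.pairExp_eq_one_iff, id] using this

theorem ellGamma_pair_limit_ne_zero (hq0 : q ≠ 0) (hq : ‖q‖ < 1)
    (hgen : ∀ (r s : Fin 6) (n : ℤ), t r * t s ≠ q ^ n) (r s : Fin 6) :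
    (if α r + α s = 1 then qPoch (q / (t r * t s)) q else 1) /
      (if pairExp α a b r s = 0 then qPoch (t r * t s) q else 1) ≠ 0 := by
  have hgen_div : ∀ n : ℤ, q / (t r * t s) ≠ q ^ n := by
    intro n hn
    refine hgen r s (1 - n) ?_
    rw [zpow_sub₀ hq0, ← hn, zpow_one, div_div_cancel₀ hq0]
  refine div_ne_zero ?_ ?_ <;> split_ifs
  · exact qPoch_ne_zero_of_forall_ne hq hgen_div
  · exact one_ne_zero
  · exact qPoch_ne_zero_of_forall_ne hq (hgen r s)
  · exact one_ne_zero

theorem limPrefactor_eq_div (q : ℂ) (t : Fin 6 → ℂ) (h : Exponents α ζ a b) :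
    limPrefactor q t α ζ a b = qPoch q q / ∏ r, ∏ s ∈ Finset.Ioi r,
      (if α r + α s = 1 then qPoch (q / (t r * t s)) q else 1) /
        (if pairExp α a b r s = 0 then qPoch (t r * t s) q else 1) := by
  simp only [Finset.prod_div_distrib]
  rw [h.prod_pairExp_eq_zero (P := fun r s => qPoch (t r * t s) q) fun r s => by rw [mul_comm]]
  simp only [← Finset.prod_filter, limPrefactor]
  rw [div_div_eq_mul_div, mul_assoc (qPoch q q)]
  congr 1
  refine Finset.prod_congr rfl fun r _ => Finset.prod_congr rfl fun s _ => ?_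
  rw [div_eq_mul_inv, mul_inv, mul_assoc]

theorem tendsto_qPoch_exp_exp : Tendsto (fun l => qPoch (exp l) (exp l)) nomeToZero (𝓝 1) := by
  have := (continuousAt_qPoch 0 (p := 0) (by simp)).tendsto.comp
    (tendsto_exp_nomeToZero.prodMk_nhds tendsto_exp_nomeToZero)
  rwa [qPoch_zero_left] at this

theorem tendsto_prefactor (hq0 : q ≠ 0) (hq : ‖q‖ < 1) (ht : ∀ r, t r ≠ 0)
    (hgen : ∀ (r s : Fin 6) (n : ℤ), t r * t s ≠ q ^ n) (h : Exponents α ζ a b)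
    (hsum : ∑ r, α r = 1) :
    Tendsto (fun l => qPoch q q * qPoch (exp l) (exp l) /
        (theta (scaled t α l a * scaled t α l b) q *
          ∏ r, ∏ s ∈ Finset.Ioi r, ellGamma (scaled t α l r * scaled t α l s) (exp l) q))
      (nomeToZero ⊓ 𝓟 (nonresonant q mf mg t α)) (𝓝 (limPrefactor q t α ζ a b)) := by
  have hden := tendsto_finsetProd Finset.univ fun r _ => tendsto_finsetProd (Finset.Ioi r)
    fun s hs => tendsto_ellGamma_pair hq ht hgen h hsum (Finset.mem_Ioi.1 hs).ne
  have hlim := (tendsto_qPoch_exp_exp.const_mul (qPoch q q)).div hden <|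
    Finset.prod_ne_zero_iff.2 fun r _ => Finset.prod_ne_zero_iff.2 fun s _ =>
      ellGamma_pair_limit_ne_zero hq0 hq hgen r s
  rw [limPrefactor_eq_div q t h, ← mul_one (qPoch q q)]
  refine (hlim.mono_left inf_le_left).congr' ?_
  filter_upwards [mem_inf_of_left eventually_norm_exp_lt_one,
    mem_inf_of_right (mem_principal_self _)] with l hp hl
  simp only [Pi.div_apply]
  rw [mul_one, theta_mul_prod_ellGamma hq h.ne hp
    (pqPoch_ne_zero_of_nonresonant hq0 hq ht hl hp a b)]

end Prefactor

/-! ### The limit of the bilinear form -/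

instance : nomeToZero.IsCountablyGenerated := by
  unfold nomeToZero
  infer_instance

section Limit

variable {q : ℂ} {t : Fin 6 → ℂ} {α : Fin 6 → ℝ} {ζ : ℝ} {a b : Fin 6} {mf mg : ℕ}
  {f g : ℂ → ℂ → ℂ}

theorem scaled_ne_zero (ht : ∀ r, t r ≠ 0) (α : Fin 6 → ℝ) (l : ℂ) (r : Fin 6) :
    scaled t α l r ≠ 0 :=
  mul_ne_zero (ht r) (nomePow_ne_zero _ _)

theorem scaled_mul_nomePow_neg {r : Fin 6} (hr : α r = ζ) (w l : ℂ) :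
    scaled t α l r * (w * nomePow (-ζ) l) = t r * w := by
  have := nomePow_ne_zero ζ l
  rw [scaled, hr, nomePow_neg]
  field_simp

theorem countable_setOf_mem_nomeLattice {T : Fin 6 → ℂ} (hT : ∀ r, T r ≠ 0) {c : ℂ} (hc : c ≠ 0)
    (p q : ℂ) : {z : ℂ | ∃ r, T r * (c * z) ∈ nomeLattice p q ∨
      T r * (c * z)⁻¹ ∈ nomeLattice p q}.Countable := by
  have hinj (r : Fin 6) : Function.Injective fun z => T r * (c * z) :=
    (mul_right_injective₀ (hT r)).comp (mul_right_injective₀ hc)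
  have hinj_inv (r : Fin 6) : Function.Injective fun z => T r * (c * z)⁻¹ :=
    (mul_right_injective₀ (hT r)).comp (inv_injective.comp (mul_right_injective₀ hc))
  simp only [ofPred_exists]
  exact countable_iUnion fun r => ((countable_nomeLattice p q).preimage (hinj r)).union
    ((countable_nomeLattice p q).preimage (hinj_inv r))

theorem countable_setOf_eval_eq_zero {P : Polynomial ℂ} (hP : P ≠ 0) :
    {z : ℂ | P.eval z = 0}.Countable :=
  (P.finite_setOfPred_isRoot hP).countable

/-- For `p = exp l`, the function `Ψ l` regularises `f l` times `g l` times the broken weight with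
the parameters `t_r p^{α_r}` and the auxiliary parameter `w p^{-ζ}`, for which `t_a p^{α_a}` and
`t_b p^{α_b}` give the products `t_a w` and `t_b w`. -/
def IsScaledRegularised (q : ℂ) (t : Fin 6 → ℂ) (α : Fin 6 → ℝ) (ζ : ℝ) (a b : Fin 6)
    (mf mg : ℕ) (w : ℂ) (f g Ψ : ℂ → ℂ → ℂ) (l : ℂ) : Prop :=
  IsRegularised mf mg (scaled t α l) (nomeShift a b l) (exp l) q a b (w * nomePow (-ζ) l)
    (f l) (g l) (Ψ l)

theorem exists_eventually_isScaledRegularised (hq0 : q ≠ 0) (hq : ‖q‖ < 1) (ht : ∀ r, t r ≠ 0)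
    (ζ : ℝ) (a b : Fin 6)
    (hf : ∀ᶠ l in nomeToZero, HasPoleOrder (scaled t α l 4) (exp l) q mf (f l))
    (hg : ∀ᶠ l in nomeToZero, HasPoleOrder (scaled t α l 5) (exp l) q mg (g l)) {w : ℂ}
    (hw : w ≠ 0) : ∃ Ψ : ℂ → ℂ → ℂ, ∀ᶠ l in nomeToZero,
      IsScaledRegularised q t α ζ a b mf mg w f g Ψ l := by
  have hex : ∀ᶠ l in nomeToZero, ∃ Ψ : ℂ → ℂ,
      IsRegularised mf mg (scaled t α l) (nomeShift a b l) (exp l) q a b (w * nomePow (-ζ) l)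
        (f l) (g l) Ψ := by
    filter_upwards [eventually_norm_exp_lt_one, hf, hg] with l hp hfl hgl
    exact exists_isRegularised (exp_ne_zero l) hp hq0 hq (scaled_ne_zero ht α l)
      (nomeShift_eq a b l) hfl hgl a b (mul_ne_zero hw (nomePow_ne_zero _ _))
  exact Filter.skolem.1 hex

/-- The integrand of `p^c` times the broken form after the substitution `z ↦ p^ζ z`. -/
def rescaledIntegrand (ζ c : ℝ) (Ψ : ℂ → ℂ → ℂ) (l z : ℂ) : ℂ :=
  nomePow c l * (Ψ l (nomePow ζ l * z) / (2 * Real.pi * I * z))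

theorem integral_rescaledIntegrand (D : Chain) (ζ c : ℝ) (Ψ : ℂ → ℂ → ℂ) (l : ℂ) :
    D.integral (rescaledIntegrand ζ c Ψ l) =
      nomePow c l * (D.dilate (nomePow ζ l)).integral fun z => Ψ l z / (2 * Real.pi * I * z) := by
  unfold rescaledIntegrand
  rw [Chain.integral_const_mul, Chain.integral_dilate]
  congr 2
  funext z
  rw [← mul_div_assoc, mul_left_comm _ (nomePow ζ l), mul_div_mul_left _ _ (nomePow_ne_zero ζ l)]

section Convergence

variable {w : ℂ} {Ψ : ℂ → ℂ → ℂ}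

theorem eventually_differentiableAt_rescaledIntegrand (hq : ‖q‖ < 1) (h : Exponents α ζ a b)
    (hΨ : ∀ᶠ l in nomeToZero, IsScaledRegularised q t α ζ a b mf mg w f g Ψ l) (c : ℝ) {z : ℂ}
    (hz : z ∈ limDomain q (shifted q mf mg t) α ζ a b) :
    ∀ᶠ x : ℂ × ℂ in nomeToZero ×ˢ 𝓝 z,
      DifferentiableAt ℂ (rescaledIntegrand ζ c Ψ x.1) x.2 := by
  filter_upwards [eventually_mem_regularDomain hq h hz,
    tendsto_fst.eventually (eventually_norm_exp_lt_one.and hΨ),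
    tendsto_snd.eventually (eventually_ne_nhds hz.1)] with x hmem ⟨hp, hΨx⟩ hx0
  have hΨ_at := hΨx.differentiableOn.differentiableAt
    ((isOpen_regularDomain hp hq _ _).mem_nhds hmem)
  have hcomp : DifferentiableAt ℂ (fun z => Ψ x.1 (nomePow ζ x.1 * z)) x.2 :=
    hΨ_at.comp x.2 (differentiableAt_id.const_mul _)
  exact (hcomp.div (differentiableAt_id.const_mul _) (mul_ne_zero two_pi_I_ne_zero hx0)).const_mul _

theorem tendsto_rescaledIntegrand (hq0 : q ≠ 0) (hq : ‖q‖ < 1) (ht : ∀ r, t r ≠ 0)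
    (h : Exponents α ζ a b) (hw : w ≠ 0) (haw : theta (t a * w) q ≠ 0)
    (hbw : theta (t b * w) q ≠ 0)
    (hΨ : ∀ᶠ l in nomeToZero, IsScaledRegularised q t α ζ a b mf mg w f g Ψ l) {u v : ℝ}
    {f₀ g₀ z : ℂ} (hz : z ∈ limDomain q (shifted q mf mg t) α ζ a b)
    (hf : Tendsto (fun x : ℂ × ℂ => nomePow u x.1 * f x.1 (nomePow ζ x.1 * x.2))
      (nomeToZero ×ˢ 𝓝 z) (𝓝 f₀))
    (hg : Tendsto (fun x : ℂ × ℂ => nomePow v x.1 * g x.1 (nomePow ζ x.1 * x.2))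
      (nomeToZero ×ˢ 𝓝 z) (𝓝 g₀)) :
    Tendsto (fun x : ℂ × ℂ => rescaledIntegrand ζ (u + v) Ψ x.1 x.2) (nomeToZero ×ˢ 𝓝 z)
      (𝓝 (theta (t a * w) q * theta (t b * w) q *
        (f₀ * g₀ * limWeight q t α ζ a b w z / (2 * Real.pi * I * z)))) := by
  refine tendsto_prod_of_eqOn_compl_countable
    (fun l => countable_setOf_mem_nomeLattice (scaled_ne_zero ht α l) (nomePow_ne_zero ζ l)
      (exp l) q)
    ((eventually_differentiableAt_rescaledIntegrand hq h hΨ (u + v) hz).mono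
      fun x hx => hx.continuousAt)
    (Y := fun l z => (nomePow u l * f l (nomePow ζ l * z)) * (nomePow v l * g l (nomePow ζ l * z)) *
      brokenWeight (scaled t α l) (nomeShift a b l) (exp l) q a b (w * nomePow (-ζ) l)
        (nomePow ζ l * z) / (2 * Real.pi * I * z)) ?_ ?_
  · filter_upwards [eventually_mem_regularDomain hq h hz, tendsto_fst.eventually hΨ]
      with x hmem hΨx hx
    simp only [not_exists, not_or] at hx
    rw [rescaledIntegrand, hΨx.eq_of_notMem _ hmem (fun r => (hx r).1) (fun r => (hx r).2),
      nomePow_add]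
    ring
  · have hweight := tendsto_brokenWeight hq0 hq ht h hw haw hbw
      (limDomain_shifted_subset hq0 mf mg hz)
    have hdiv := ((hf.mul hg).mul hweight).div (tendsto_snd.const_mul (2 * Real.pi * I))
      (mul_ne_zero two_pi_I_ne_zero hz.1)
    convert hdiv using 2
    · rfl
    · ring

theorem tendsto_integral_rescaledIntegrand (hq0 : q ≠ 0) (hq : ‖q‖ < 1) (ht : ∀ r, t r ≠ 0)
    (h : Exponents α ζ a b) (hw : w ≠ 0) (haw : theta (t a * w) q ≠ 0)
    (hbw : theta (t b * w) q ≠ 0)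
    (hΨ : ∀ᶠ l in nomeToZero, IsScaledRegularised q t α ζ a b mf mg w f g Ψ l) {F G : NomeSeries}
    (hF : F.ConvergesTo fun l z => f l (nomePow ζ l * z))
    (hG : G.ConvergesTo fun l z => g l (nomePow ζ l * z)) {D : Chain}
    (hD : D.Separates (limInner q (shifted q mf mg t) a b)
      (limOuter q (shifted q mf mg t) α ζ a b)) :
    Tendsto (fun l => D.integral (rescaledIntegrand ζ (-F.val - G.val) Ψ l)) nomeToZero
      (𝓝 (theta (t a * w) q * theta (t b * w) q * D.integral fun z =>
        F.lc z * G.lc z * limWeight q t α ζ a b w z / (2 * Real.pi * I * z))) := by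
  obtain ⟨P, hP, hFlim⟩ := hF.exists_tendsto
  obtain ⟨Q, hQ, hGlim⟩ := hG.exists_tendsto
  rw [← Chain.integral_const_mul, sub_eq_add_neg]
  refine Chain.tendsto_integral
    (isOpen_limDomain hq0 hq (shifted_ne_zero hq0 ht mf mg)) hD.support_subset_limDomain
    ((countable_setOf_eval_eq_zero hP).union (countable_setOf_eval_eq_zero hQ))
    (fun z hz => eventually_differentiableAt_rescaledIntegrand hq h hΨ _ hz) fun z hz hroot => ?_
  rw [mem_union, not_or] at hroot
  exact tendsto_rescaledIntegrand hq0 hq ht h hw haw hbw hΨ hz (hFlim z hz.1 hroot.1)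
    (hGlim z hz.1 hroot.2)

theorem eventually_nomePow_mul_ellForm_eq (hq0 : q ≠ 0) (hq : ‖q‖ < 1) (ht : ∀ r, t r ≠ 0)
    (h : Exponents α ζ a b) (hf : ∀ᶠ l in nomeToZero, ∀ z, z ≠ 0 → f l z⁻¹ = f l z)
    (hg : ∀ᶠ l in nomeToZero, ∀ z, z ≠ 0 → g l z⁻¹ = g l z) (hw : w ≠ 0)
    (haw : theta (t a * w) q ≠ 0) (hbw : theta (t b * w) q ≠ 0)
    (hΨ : ∀ᶠ l in nomeToZero, IsScaledRegularised q t α ζ a b mf mg w f g Ψ l) {D : Chain}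
    (hD : D.Separates (limInner q (shifted q mf mg t) a b)
      (limOuter q (shifted q mf mg t) α ζ a b)) {C : ℂ → Chain}
    (hC : ∀ᶠ l in nomeToZero ⊓ 𝓟 (nonresonant q mf mg t α),
      (C l).Separates (scaledInner q mf mg t α l) (scaledOuter q mf mg t α l)) (c : ℝ) :
    ∀ᶠ l in nomeToZero ⊓ 𝓟 (nonresonant q mf mg t α),
      nomePow c l * ellForm (scaled t α l) (exp l) q (f l) (g l) (C l) =
        qPoch q q * qPoch (exp l) (exp l) / (theta (scaled t α l a * scaled t α l b) q *
            ∏ r, ∏ s ∈ Finset.Ioi r, ellGamma (scaled t α l r * scaled t α l s) (exp l) q) *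
          ((theta (t a * w) q * theta (t b * w) q)⁻¹ *
            D.integral (rescaledIntegrand ζ c Ψ l)) := by
  have hle : nomeToZero ⊓ 𝓟 (nonresonant q mf mg t α) ≤ nomeToZero := inf_le_left
  filter_upwards [hC, mem_inf_of_right (mem_principal_self _), hle eventually_norm_exp_lt_one,
    hle hf, hle hg, hle hΨ, hle (eventually_dilate_support_subset hq h hD),
    hle (eventually_dilate_winding_eq hq h hD),
    hle (eventually_qPoch_div_ne_zero (t := t) hq h)]
    with l hCl hl hp hfl hgl hΨl hsupport hwinding hab_div
  have hab : theta (scaled t α l a * scaled t α l b) q ≠ 0 :=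
    mul_ne_zero (qPoch_ne_zero_of_pqPoch hp hq
      (pqPoch_ne_zero_of_nonresonant hq0 hq ht hl hp a b)).2 hab_div
  have ha := scaled_mul_nomePow_neg (t := t) h.left w l
  have hb := scaled_mul_nomePow_neg (t := t) h.right w l
  rw [ellForm, integral_eq_broken (exp_ne_zero l) hp hq0 hq (scaled_ne_zero ht α l) h.ne
    (fun r => rfl) hfl hgl (mul_ne_zero hw (nomePow_ne_zero _ _)) hab (by rwa [ha]) (by rwa [hb])
    hΨl hCl hsupport (hwinding _ hCl), ha, hb, integral_rescaledIntegrand]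
  ring

end Convergence

theorem tendsto_ellForm (hq0 : q ≠ 0) (hq : ‖q‖ < 1) (ht : ∀ r, t r ≠ 0)
    (hgen : ∀ (r s : Fin 6) (n : ℤ), t r * t s ≠ q ^ n) (h : Exponents α ζ a b)
    (hsum : ∑ r, α r = 1)
    (hfsymm : ∀ᶠ l in nomeToZero, ∀ z, z ≠ 0 → f l z⁻¹ = f l z)
    (hgsymm : ∀ᶠ l in nomeToZero, ∀ z, z ≠ 0 → g l z⁻¹ = g l z)
    (hf : ∀ᶠ l in nomeToZero, HasPoleOrder (scaled t α l 4) (exp l) q mf (f l))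
    (hg : ∀ᶠ l in nomeToZero, HasPoleOrder (scaled t α l 5) (exp l) q mg (g l)) {F G : NomeSeries}
    (hF : F.ConvergesTo fun l z => f l (nomePow ζ l * z))
    (hG : G.ConvergesTo fun l z => g l (nomePow ζ l * z)) {w : ℂ} (hw : w ≠ 0)
    (haw : theta (t a * w) q ≠ 0) (hbw : theta (t b * w) q ≠ 0) {D : Chain}
    (hD : D.Separates (limInner q (shifted q mf mg t) a b)
      (limOuter q (shifted q mf mg t) α ζ a b)) {C : ℂ → Chain}
    (hC : ∀ᶠ l in nomeToZero ⊓ 𝓟 (nonresonant q mf mg t α),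
      (C l).Separates (scaledInner q mf mg t α l) (scaledOuter q mf mg t α l)) :
    Tendsto (fun l => nomePow (-F.val - G.val) l *
        ellForm (scaled t α l) (exp l) q (f l) (g l) (C l))
      (nomeToZero ⊓ 𝓟 (nonresonant q mf mg t α)) (𝓝 (limForm q t α ζ a b w F.lc G.lc D)) := by
  obtain ⟨Ψ, hΨ⟩ := exists_eventually_isScaledRegularised hq0 hq ht ζ a b hf hg hw
  have hintegral :=
    (tendsto_integral_rescaledIntegrand hq0 hq ht h hw haw hbw hΨ hF hG hD).mono_left
      (inf_le_left (b := 𝓟 (nonresonant q mf mg t α)))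
  have hlim := (tendsto_prefactor (mf := mf) (mg := mg) hq0 hq ht hgen h hsum).mul
    (hintegral.const_mul (theta (t a * w) q * theta (t b * w) q)⁻¹)
  rw [inv_mul_cancel_left₀ (mul_ne_zero haw hbw)] at hlim
  exact hlim.congr' <| (eventually_nomePow_mul_ellForm_eq hq0 hq ht h hfsymm hgsymm hw haw hbw hΨ hD
    hC _).mono fun l hl => hl.symm

end Limit

end EllipticLimit

end

open EllipticLimit in
theorem mainTheorem9_general
    (q : ℂ) (hq0 : q ≠ 0) (hq1 : ‖q‖ < 1)
    (t : Fin 6 → ℂ) (ht : ∀ r, t r ≠ 0)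
    (hgen : ∀ (r s : Fin 6) (n : ℤ), t r * t s ≠ q ^ n)
    (α : Fin 6 → ℝ) (ζ : ℝ) (a b : Fin 6)
    (hζ : -1 / 2 ≤ ζ) (hζ0 : ζ < 0) (hsum : ∑ r, α r = 1)
    (hab : a ≠ b) (ha : α a = ζ) (hb : α b = ζ)
    (hα : ∀ r, r ≠ a → r ≠ b → -ζ ≤ α r ∧ α r ≤ 1 + ζ)
    (f g : ℂ → ℂ → ℂ) (mf mg : ℕ)
    (hfsymm : ∀ᶠ l in nomeToZero, ∀ z, z ≠ 0 → f l z⁻¹ = f l z)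
    (hgsymm : ∀ᶠ l in nomeToZero, ∀ z, z ≠ 0 → g l z⁻¹ = g l z)
    (hf : ∀ᶠ l in nomeToZero, HasPoleOrder (t 4 * nomePow (α 4) l) (Complex.exp l) q mf (f l))
    (hg : ∀ᶠ l in nomeToZero, HasPoleOrder (t 5 * nomePow (α 5) l) (Complex.exp l) q mg (g l))
    (F G : NomeSeries)
    (hF : F.ConvergesTo (fun l z => f l (nomePow ζ l * z)))
    (hG : G.ConvergesTo (fun l z => g l (nomePow ζ l * z))) :
    (∃ᶠ l in nomeToZero, l ∈ nonresonant q mf mg t α) ∧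
    (∀ᶠ l in nomeToZero, l ∈ nonresonant q mf mg t α →
      ∃ C : Chain, C.Separates (scaledInner q mf mg t α l) (scaledOuter q mf mg t α l)) ∧
    (∃ C : Chain, C.Separates (limInner q (shifted q mf mg t) a b)
      (limOuter q (shifted q mf mg t) α ζ a b)) ∧
    ∀ (w : ℂ), w ≠ 0 → theta (t a * w) q ≠ 0 → theta (t b * w) q ≠ 0 →
      ∀ D : Chain, D.Separates (limInner q (shifted q mf mg t) a b)
          (limOuter q (shifted q mf mg t) α ζ a b) →
        ∀ C : ℂ → Chain,
          (∀ᶠ l in nomeToZero ⊓ 𝓟 (nonresonant q mf mg t α),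
            (C l).Separates (scaledInner q mf mg t α l) (scaledOuter q mf mg t α l)) →
          Tendsto
            (fun l => nomePow (-F.val - G.val) l *
              ellForm (scaled t α l) (Complex.exp l) q (f l) (g l) (C l))
            (nomeToZero ⊓ 𝓟 (nonresonant q mf mg t α))
            (𝓝 (limForm q t α ζ a b w F.lc G.lc D)) := by
  have h : Exponents α ζ a b := ⟨hζ, hζ0, hab, ha, hb, hα⟩
  refine ⟨frequently_nonresonant hq0 ht hgen mf mg α, ?_,
    exists_separates_lim hq0 hq1 (shifted_ne_zero hq0 ht mf mg)
      (shifted_mul_ne hq0 hgen mf mg) α ζ a b,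
    fun w hw haw hbw D hD C hC =>
      tendsto_ellForm hq0 hq1 ht hgen h hsum hfsymm hgsymm hf hg hF hG hw haw hbw hD hC⟩
  filter_upwards [eventually_norm_exp_lt_one] with l hp hl
  obtain ⟨C, hC, -⟩ := exists_separates_ell (Complex.exp_ne_zero l) hp hq0 hq1
    (shifted_ne_zero hq0 (scaled_ne_zero ht α l) mf mg) hl
  exact ⟨C, hC⟩

open EllipticLimit in
theorem mainTheorem9
    (q : ℂ) (hq0 : q ≠ 0) (hq1 : ‖q‖ < 1)
    (t : Fin 6 → ℂ) (ht : ∏ r, t r = q)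
    (hgen : ∀ (r s : Fin 6) (n : ℤ), t r * t s ≠ q ^ n)
    (α : Fin 6 → ℝ) (ζ : ℝ) (a b : Fin 6)
    (hζ : -1 / 2 ≤ ζ) (hζ0 : ζ < 0) (hsum : ∑ r, α r = 1)
    (hab : a ≠ b) (ha : α a = ζ) (hb : α b = ζ)
    (hα : ∀ r, r ≠ a → r ≠ b → -ζ ≤ α r ∧ α r ≤ 1 + ζ)
    (f g : ℂ → ℂ → ℂ) (mf mg : ℕ)
    (hf : ∀ᶠ l in nomeToZero, InA (t 4 * nomePow (α 4) l) (Complex.exp l) q mf (f l))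
    (hg : ∀ᶠ l in nomeToZero, InA (t 5 * nomePow (α 5) l) (Complex.exp l) q mg (g l))
    (F G : NomeSeries)
    (hF : F.ConvergesTo (fun l z => f l (nomePow ζ l * z)))
    (hG : G.ConvergesTo (fun l z => g l (nomePow ζ l * z))) :
    -- the contours exist
    (∃ᶠ l in nomeToZero, l ∈ nonresonant q mf mg t α) ∧
    (∀ᶠ l in nomeToZero, l ∈ nonresonant q mf mg t α →
      ∃ C : Chain, C.Separates (scaledInner q mf mg t α l) (scaledOuter q mf mg t α l)) ∧
    (∃ C : Chain, C.Separates (limInner q (shifted q mf mg t) a b)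
      (limOuter q (shifted q mf mg t) α ζ a b)) ∧
    -- the limit, for all admissible contours and every auxiliary parameter
    ∀ (w : ℂ), w ≠ 0 → theta (t a * w) q ≠ 0 → theta (t b * w) q ≠ 0 →
      ∀ D : Chain, D.Separates (limInner q (shifted q mf mg t) a b)
          (limOuter q (shifted q mf mg t) α ζ a b) →
        ∀ C : ℂ → Chain,
          (∀ᶠ l in nomeToZero ⊓ 𝓟 (nonresonant q mf mg t α),
            (C l).Separates (scaledInner q mf mg t α l) (scaledOuter q mf mg t α l)) →
          Tendsto
            (fun l => nomePow (-F.val - G.val) l *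
              ellForm (scaled t α l) (Complex.exp l) q (f l) (g l) (C l))
            (nomeToZero ⊓ 𝓟 (nonresonant q mf mg t α))
            (𝓝 (limForm q t α ζ a b w F.lc G.lc D)) :=
  mainTheorem9_general q hq0 hq1 t (Finset.prod_ne_zero_iff.1 (ht.symm ▸ hq0) · (Finset.mem_univ _))
    hgen α ζ a b hζ hζ0 hsum hab ha hb hα f g mf mg (hf.mono fun _ h => h.symmetric)
    (hg.mono fun _ h => h.symmetric) (hf.mono fun _ h => h.holomorphic)
    (hg.mono fun _ h => h.holomorphic) F G hF hG
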